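/- **Setting.** For each group size $n$ there are $G=G(n)\ge 1$ groups $g\in[G]$ of $n$ individuals, with $G(n)/n\to c\in[0,\infty)$ as $n\to\infty$. Individual $i$ of group $g$ has covariates $X_{ig}\in\mathbb R^d$ and influencers $\{j:F^g_{ij}=1\}$, $F^g_{ij}\in\{0,1\}$, $F^g_{ii}=0$, $N_i^g=\sum_jF_{ij}^g$. For $P\in\mathbb R^n$ put $\overline P_{i}=(N_i^g)^{-1}\sum_jF^g_{ij}P_j$ (and $\overline P_i=0$ if $N_i^g=0$), let $\Lambda(x)=1/(1+e^{-x})$, and for $\mu\in\mathbb R$, $\theta=(\overline\beta,\beta')'\in\mathbb R^{p}$, $p=1+d$, let $\Gamma_g(\mu,\theta;P)_i=\Lambda(\overline P_{i}\overline\beta+X_{ig}'\beta+\mu)$. If $|\overline\beta|<4$, let $P_g(\mu,\theta)$ be the unique solution of $P=\Gamma_g(\mu,\theta;P)$. The outcomes are $$Y_{ig}=1\{\overline P_{ig0}\overline\beta_{g0}+X_{ig}'\beta_{g0}+\mu_{g0}>\varepsilon_{ig}\},\qquad P_{g0}=P_g(\mu_{g0},\theta_{g0}),$$ where the $\varepsilon_{ig}$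 are i.i.d. standard logistic and independent of all $(X,F)$; $\mu_{g0}$ and $\theta_{g0}$ are nonrandom. The slopes have a latent structure: $[G]$ is partitioned into clusters $C_{10},\dots,C_{K_00}$ with $\#C_{k0}/G\to c_k>0$, and $\theta_{g0}=\vartheta_{k0}$ for $g\in C_{k0}$, with $\vartheta_{10},\dots,\vartheta_{K_00}$ distinct and not depending on $n$. **Procedure.** Let $\mathcal A\subset\mathbb R$ and $\Theta\subset\mathbb R^{p}$ be compact parameter spaces. Let $\psi_{ig}(P;\theta,\mu)=-Y_{ig}\log\Lambda_{i}-(1-Y_{ig})\log(1-\Lambda_i)$ with $\Lambda_i=\Gamma_g(\mu,\theta;P)_i$, let $\Psi_{ng}(\mu,\theta;P)=\frac1n\sum_i\psi_{ig}(P;\theta,\mu)$, let $\widehat\mu_g(\theta,P)\in\arg\min_{\mu\in\mathcal A}\Psi_{ng}(\mu,\theta;P)$ and $Q_{ng}(\theta;P)=\Psi_{ng}(\widehat\mu_g(\theta,P),\theta;P)$. For a set $S$ of groups, an *NPL fixed point* on $S$ is a triple $((\mu_g)_{g\in S},\theta,(P_g)_{g\in S})$ such that $((\mu_g),\theta)$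 minimizes $\frac1{\#S}\sum_{g\in S}\Psi_{ng}(\mu_g,\theta;P_g)$ over $\mathcal A^{S}\times\Theta$ and $P_g=\Gamma_g(\mu_g,\theta;P_g)$ for $g\in S$; an *NPL estimator* on $S$ is an NPL fixed point on $S$ at which this criterion is smallest among all NPL fixed points on $S$. For $K\in[K_{\max}]$: 1. $\widetilde P_g$ is the choice probability vector of an NPL estimator on $\{g\}$ (the same for all $K$); 2. (C-Lasso) $(\widetilde{\boldsymbol\theta},\widetilde\vartheta)$ minimizes $\frac1G\sum_gQ_{ng}(\theta_g;\widetilde P_g)+\frac{\rho}{G}\sum_g\prod_{k\in[K]}\|\theta_g-\vartheta_k\|_2$ over $\Theta^{G+K}$, and $g$ is put into a cluster $\widetilde C_k(K)$ for which $\|\widetilde\theta_g-\widetilde\vartheta_k\|_2$ is minimal over $k\in[K]$; 3. $\widehat\theta_{\widetilde C_k(K)}$ and $\widehat P_g$, $g\in\widetilde C_k(K)$, come from an NPL estimator on $\widetilde C_k(K)$. Let $$\mathrm{IC}(K)=\frac1{nG}\sum_{k\in[K]}\sum_{g\in\widetilde C_k(K)}\sum_{i\in[n]}\psi_{ig}\Big(\widehat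 P_g;\widehat\theta_{\widetilde C_k(K)},\widehat\mu_g\big(\widehat\theta_{\widetilde C_k(K)},\widehat P_g\big)\Big)+\lambda pK$$ and let $\widehat K$ be a minimizer of $\mathrm{IC}$ over $[K_{\max}]$. **Assumptions.** There is a constant $C<\infty$ with (i) $\max_{i,g}\|X_{ig}\|_\infty\le C$ and $\max_{j}\sum_i(N_i^g)^{-1}F^g_{ij}\le C$ for all $g$, almost surely (terms with $N_i^g=0$ are $0$); (ii) $|\overline\beta|<4$ for all $\theta=(\overline\beta,\beta')'\in\Theta$; each $\vartheta_{k0}$ is an interior point of $\Theta$; for some $r>0$, $[\mu_{g0}-r,\mu_{g0}+r]\subset\mathcal A$ for all $g$ and $n$; (iii) let $\zeta=(\mu,\theta')'$ and let $$M_g=\frac1n\sum_{i}\Big[\frac{\partial^2\psi_{ig}}{\partial\zeta\partial\zeta'}+\frac{\partial^2\psi_{ig}}{\partial\zeta\partial P'}\frac{\partial P_g(\zeta)}{\partial\zeta'}\Big]$$ evaluated at $\zeta=\zeta_{g0}=(\mu_{g0},\theta_{g0}')'$ and $P=P_{g0}$; for some $\eta>0$, with probability tending to one, $\|M_gu\|\ge\eta\|u\|$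 for all $u\in\mathbb R^{1+p}$ and all $g\in[G]$; (iv) with $M_g$ partitioned into blocks according to $\zeta=(\mu,\theta')'$, let $H_k=\frac1{\#C_{k0}}\sum_{g\in C_{k0}}\big[M_{g,\theta\theta}-M_{g,\theta\mu}M_{g,\mu\mu}^{-1}M_{g,\mu\theta}\big]$; for some $\eta>0$, with probability tending to one, $\|H_ku\|\ge\eta\|u\|$ for all $u\in\mathbb R^p$ and $k\in[K_0]$. The tuning parameters $\rho=\rho_n>0$ and $\lambda=\lambda_n>0$ satisfy $n\rho/\log n\to\infty$ (for instance, $\rho$ is a positive constant). **Proposition.** If $K_{\max}\ge K_0$ and $\lambda+(n\lambda)^{-1}\to0$ as $n\to\infty$, then $P(\widehat K=K_0)\to1$, for every choice of the estimators above. -/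

import Mathlib

open MeasureTheory ProbabilityTheory Filter Topology

noncomputable section

namespace PeerEffects

/-- Slope vectors `θ = (β̄, β)`: coordinate `0` is the peer effect `β̄`, the coordinates
`1, …, d` are the coefficients `β` of the covariates. The norm is the Euclidean one. -/
abbrev Slope (d : ℕ) := EuclideanSpace ℝ (Fin (d + 1))

/-- Data of one group of `n` individuals: outcomes, covariates and the directed friendship
matrix (`F i j = true` when `i` is influenced by `j`). -/
structure GroupData (n d : ℕ) where
  Y : Fin n → ℝ
  X : Fin n → Fin d → ℝ
  F : Fin n → Fin n → Bool

variable {n d G K : ℕ}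

/-- The number `N_i` of influencers of `i`. -/
def numFriends (F : Fin n → Fin n → Bool) (i : Fin n) : ℕ :=
  (Finset.univ.filter fun j => F i j = true).card

/-- The average of `P` over the influencers of `i`; it is `0` if `i` has none. -/
def peerAvg (F : Fin n → Fin n → Bool) (P : Fin n → ℝ) (i : Fin n) : ℝ :=
  if 0 < numFriends F i then
    (1 / (numFriends F i : ℝ)) * ∑ j ∈ Finset.univ.filter (fun j => F i j = true), P j
  else 0

/-- The single index `P̄_i β̄ + X_i'β + μ`. -/
def index (X : Fin n → Fin d → ℝ) (F : Fin n → Fin n → Bool) (μ : ℝ) (θ : Slope d)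
    (P : Fin n → ℝ) (i : Fin n) : ℝ :=
  peerAvg F P i * θ 0 + ∑ j, X i j * θ j.succ + μ

/-- The choice-probability map `Γ(ζ; P)` with logistic link. -/
def bestResponse (X : Fin n → Fin d → ℝ) (F : Fin n → Fin n → Bool) (μ : ℝ) (θ : Slope d)
    (P : Fin n → ℝ) : Fin n → ℝ :=
  fun i => Real.sigmoid (index X F μ θ P i)

/-- The equilibrium choice probabilities `P(ζ)`: the fixed point of `P = Γ(ζ; P)`, which exists
and is unique when the peer effect is smaller than `4` in absolute value. -/
def ccp (X : Fin n → Fin d → ℝ) (F : Fin n → Fin n → Bool) (μ : ℝ) (θ : Slope d) : Fin n → ℝ :=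
  Classical.epsilon fun P => P = bestResponse X F μ θ P

/-- The data generated by the game of incomplete information with parameters `(μ, θ)`:
`Y_i = 1{P̄_i β̄ + X_i'β + μ > ε_i}`, where `P` is the equilibrium belief. -/
def gameData (X : Fin n → Fin d → ℝ) (F : Fin n → Fin n → Bool) (ε : Fin n → ℝ) (μ : ℝ)
    (θ : Slope d) : GroupData n d where
  Y := fun i => if ε i < index X F μ θ (ccp X F μ θ) i then 1 else 0
  X := X
  F := F

/-- The negative log-likelihood `ψ(w_i, P; θ, μ)` of individual `i`. -/
def unitNLL (D : GroupData n d) (P : Fin n → ℝ) (θ : Slope d) (μ : ℝ) (i : Fin n) : ℝ :=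
  -D.Y i * Real.log (Real.sigmoid (index D.X D.F μ θ P i))
    - (1 - D.Y i) * Real.log (1 - Real.sigmoid (index D.X D.F μ θ P i))

/-- The average negative log-likelihood `Ψ_n(μ, θ; P)` of a group. -/
def groupNLL (D : GroupData n d) (μ : ℝ) (θ : Slope d) (P : Fin n → ℝ) : ℝ :=
  (1 / (n : ℝ)) * ∑ i, unitNLL D P θ μ i

/-- The fixed effect estimator `μ̂(θ, P)`: a minimizer of `μ ↦ Ψ_n(μ, θ; P)` over `A`. -/
def fixedEffect (A : Set ℝ) (D : GroupData n d) (θ : Slope d) (P : Fin n → ℝ) : ℝ :=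
  Classical.epsilon fun μ => μ ∈ A ∧ ∀ ν ∈ A, groupNLL D μ θ P ≤ groupNLL D ν θ P

/-- The profile negative log-likelihood `Q_n(θ; P)` of a group. -/
def profileNLL (A : Set ℝ) (D : GroupData n d) (θ : Slope d) (P : Fin n → ℝ) : ℝ :=
  (1 / (n : ℝ)) * ∑ i, unitNLL D P θ (fixedEffect A D θ P) i

/-- The average negative log-likelihood of the groups in `C`, with group-specific fixed effects
and a common slope. -/
def pooledNLL (D : Fin G → GroupData n d) (C : Finset (Fin G)) (μ : Fin G → ℝ) (θ : Slope d)
    (P : Fin G → Fin n → ℝ) : ℝ :=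
  (1 / (C.card : ℝ)) * ∑ g ∈ C, groupNLL (D g) (μ g) θ (P g)

/-- Nested pseudo likelihood (NPL) fixed points, for the groups in `C` with a common slope: the
parameters minimize the pseudo likelihood criterion given the choice probabilities, and the choice
probabilities are reproduced by the parameters. Entries of `μ` and `P` outside `C` are idle. -/
structure IsNPLFixedPoint (A : Set ℝ) (Θ : Set (Slope d)) (D : Fin G → GroupData n d)
    (C : Finset (Fin G)) (μ : Fin G → ℝ) (θ : Slope d) (P : Fin G → Fin n → ℝ) : Prop where
  mem_A : ∀ g ∈ C, μ g ∈ A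
  mem_Θ : θ ∈ Θ
  isMin : ∀ (ν : Fin G → ℝ) (η : Slope d), (∀ g ∈ C, ν g ∈ A) → η ∈ Θ →
    pooledNLL D C μ θ P ≤ pooledNLL D C ν η P
  fixed : ∀ g ∈ C, P g = bestResponse (D g).X (D g).F (μ g) θ (P g)

/-- The NPL estimator: the NPL fixed point with the largest pseudo likelihood. -/
structure IsNPLEstimator (A : Set ℝ) (Θ : Set (Slope d)) (D : Fin G → GroupData n d)
    (C : Finset (Fin G)) (μ : Fin G → ℝ) (θ : Slope d) (P : Fin G → Fin n → ℝ) : Prop where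
  fixedPoint : IsNPLFixedPoint A Θ D C μ θ P
  best : ∀ μ' θ' P', IsNPLFixedPoint A Θ D C μ' θ' P' →
    pooledNLL D C μ θ P ≤ pooledNLL D C μ' θ' P'

/-- `P` collects the first-step choice probabilities: NPL applied to each group separately. -/
def IsFirstStepCCP (A : Set ℝ) (Θ : Set (Slope d)) (D : Fin G → GroupData n d)
    (P : Fin G → Fin n → ℝ) : Prop :=
  ∀ g, ∃ (μ : Fin G → ℝ) (θ : Slope d), IsNPLEstimator A Θ D {g} μ θ P

/-- The C-Lasso criterion with `K` clusters. -/
def classoObjective (A : Set ℝ) (ρ : ℝ) (D : Fin G → GroupData n d) (P : Fin G → Fin n → ℝ)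
    (θ : Fin G → Slope d) (v : Fin K → Slope d) : ℝ :=
  (1 / (G : ℝ)) * ∑ g, profileNLL A (D g) (θ g) (P g)
    + ρ / (G : ℝ) * ∑ g, ∏ k, ‖θ g - v k‖

/-- `(θ, v)` minimizes the C-Lasso criterion over `Θ^G × Θ^K`. -/
structure IsCLasso (A : Set ℝ) (Θ : Set (Slope d)) (ρ : ℝ) (D : Fin G → GroupData n d)
    (P : Fin G → Fin n → ℝ) (θ : Fin G → Slope d) (v : Fin K → Slope d) : Prop where
  mem_θ : ∀ g, θ g ∈ Θ
  mem_v : ∀ k, v k ∈ Θ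
  isMin : ∀ (θ' : Fin G → Slope d) (v' : Fin K → Slope d), (∀ g, θ' g ∈ Θ) → (∀ k, v' k ∈ Θ) →
    classoObjective A ρ D P θ v ≤ classoObjective A ρ D P θ' v'

/-- Each group is classified into a cluster whose centre is closest to its slope estimate. -/
def IsNearest (θ : Fin G → Slope d) (v : Fin K → Slope d) (cl : Fin G → Fin K) : Prop :=
  ∀ g l, ‖θ g - v (cl g)‖ ≤ ‖θ g - v l‖

/-- The members of cluster `k` under the classification `cl`. -/
def cluster (cl : Fin G → Fin K) (k : Fin K) : Finset (Fin G) :=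
  Finset.univ.filter fun g => cl g = k

/-- The information criterion for a classification `cl` into `K` clusters, post-classification
slopes `θ` and post-classification choice probabilities `P`; here `p = d + 1`. -/
def infoCriterion (A : Set ℝ) (lam : ℝ) (D : Fin G → GroupData n d) (cl : Fin G → Fin K)
    (θ : Fin K → Slope d) (P : Fin G → Fin n → ℝ) : ℝ :=
  (1 / ((n : ℝ) * (G : ℝ))) * ∑ k, ∑ g ∈ cluster cl k, ∑ i,
      unitNLL (D g) (P g) (θ k) (fixedEffect A (D g) (θ k) (P g)) i
    + lam * ((d : ℝ) + 1) * (K : ℝ)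

/-- `x` is a value of `IC(K)` produced by the procedure from the first-step choice probabilities
`P`: C-Lasso with `K` clusters, classification, and NPL re-estimation within each cluster. -/
def IsICValue (A : Set ℝ) (Θ : Set (Slope d)) (ρ lam : ℝ) (D : Fin G → GroupData n d)
    (P : Fin G → Fin n → ℝ) (K : ℕ) (x : ℝ) : Prop :=
  ∃ (θ : Fin G → Slope d) (v : Fin K → Slope d) (cl : Fin G → Fin K)
    (μ' : Fin G → ℝ) (θ' : Fin K → Slope d) (P' : Fin G → Fin n → ℝ),
    IsCLasso A Θ ρ D P θ v ∧ IsNearest θ v cl ∧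
    (∀ k, IsNPLEstimator A Θ D (cluster cl k) μ' (θ' k) P') ∧
    x = infoCriterion A lam D cl θ' P'

/-- `K` is a minimizer of `IC` over `{1, …, Kmax}`. -/
def IsSelected (A : Set ℝ) (Θ : Set (Slope d)) (ρ lam : ℝ) (D : Fin G → GroupData n d)
    (Kmax K : ℕ) : Prop :=
  ∃ (P : Fin G → Fin n → ℝ) (IC : ℕ → ℝ), IsFirstStepCCP A Θ D P ∧
    (∀ k ∈ Finset.Icc 1 Kmax, IsICValue A Θ ρ lam D P k (IC k)) ∧
    K ∈ Finset.Icc 1 Kmax ∧ ∀ k ∈ Finset.Icc 1 Kmax, IC K ≤ IC k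

/-- The NPL score `∂Ψ_n(ζ; P)/∂ζ` at `P = P(ζ)`, for `ζ = (μ, θ)`. -/
def nplScore (D : GroupData n d) (ζ : ℝ × Slope d) : ℝ × Slope d →L[ℝ] ℝ :=
  fderiv ℝ (fun z : ℝ × Slope d => groupNLL D z.1 z.2 (ccp D.X D.F ζ.1 ζ.2)) ζ

/-- The total derivative of the NPL score, which by the chain rule is
`(1/n) ∑ᵢ [∂²ψᵢ/∂ζ∂ζ' + (∂²ψᵢ/∂ζ∂P') (∂P(ζ)/∂ζ')]`; `nplJacobian D ζ u w` is `w' (matrix) u`. -/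
def nplJacobian (D : GroupData n d) (ζ : ℝ × Slope d) :
    ℝ × Slope d →L[ℝ] (ℝ × Slope d →L[ℝ] ℝ) :=
  fderiv ℝ (nplScore D) ζ

/-- `w' H v` for the concentrated (fixed effects profiled out) Jacobian
`H = (1/|C|) ∑_{g ∈ C} [M_θθ - M_θμ M_μμ⁻¹ M_μθ]` of the NPL score of the groups in `C`, where
`M` is the NPL Jacobian of group `g` at `(μ g, θ)`. -/
def concentratedJacobian (D : Fin G → GroupData n d) (C : Finset (Fin G)) (μ : Fin G → ℝ)
    (θ v w : Slope d) : ℝ :=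
  (1 / (C.card : ℝ)) * ∑ g ∈ C,
    (nplJacobian (D g) (μ g, θ) (0, v) (0, w)
      - nplJacobian (D g) (μ g, θ) (1, 0) (0, w)
        * ((nplJacobian (D g) (μ g, θ) (1, 0) (1, 0))⁻¹
          * nplJacobian (D g) (μ g, θ) (0, v) (1, 0)))

end PeerEffects

end

open PeerEffects

/-!
The criterion compares likelihoods, and everything rests on a quadratic expansion, uniform over
the groups, of the likelihood of a group at the equilibrium choice probabilities `P(ζ)` of a
parameter `ζ = (μ, θ)` (`eqNLL`).

*Equilibrium.* Since `|β̄| ≤ 4 r` with `r < 1` on the compact parameter space, the best response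
is a contraction. Hence `P(ζ)` is unique, Lipschitz and differentiable with a quadratic remainder
(`norm_ccp_sub_sub_le`), every NPL fixed point consists of equilibrium choice probabilities, and
the likelihood at an NPL fixed point is `eqNLL`.

*Identification.* Invertibility of the NPL Jacobian at the truth bounds the design from below
(`exists_design_lower`), which gives `eqNLL ζ - eqNLL ζ₀ ≥ c ‖ζ - ζ₀‖² - C σ² - C κ` for all `ζ`
in the parameter space (`Bounds.Good.eqNLL_lower`). Here `σ` is the size of the score and of one
further linear functional of the residuals (`noise`), and `κ` is of order `1 / n`.

*Estimation.* Invertibility of the concentrated Jacobians yields a zero of the pooled score of a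
true cluster close to the truth (`exists_pooled_zero`); for given choice probabilities the
likelihood is convex, so that this zero is an NPL fixed point, with likelihood within
`C · mean σ²` of the likelihood at the truth (`exists_nplFixedPoint`). An NPL estimator is at least as good.
For a single group this gives the consistency of the first step (`exists_firstStep`), and then the
C-Lasso with `K₀` clusters classifies all groups correctly (`exists_classification`).

*Selection.* At `K₀` the criterion is therefore at most the likelihood at the truth plus
`C · mean σ²` plus the penalty. With more clusters the likelihood improves by at most `C · (mean σ² + κ)`,
which is less than the additional penalty `λ p`; with fewer clusters a non-vanishing proportion of
the groups is assigned a slope far from the true one, and the likelihood deteriorates by a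
constant (`exists_selection`).

*Probability.* Conditionally on the public information the sampling errors are weighted means of
independent centered bounded variables. Hoeffding's inequality, with a union bound over the groups
and over a net of the parameter space, makes them smaller than any constant uniformly
(`exists_noise_tail`, `exists_noiseRem_tail`). The mean of `σ²` over the groups is of order
`1 / n` in expectation (`exists_noise_sq_bound`), hence of smaller order than `min 1 ρ λ`. No rates for
the individual groups are needed.
-/

namespace PeerEffects

/-! ### The logistic function -/

/-- The derivative of the logistic function. -/
noncomputable def sigmoidDeriv (x : ℝ) : ℝ := Real.sigmoid x * (1 - Real.sigmoid x)

/-- The cumulant function of the logistic model: the negative log-likelihood of an outcome `y`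
at index `x` is `softplus x - y * x`. -/
noncomputable def softplus (x : ℝ) : ℝ := -Real.log (1 - Real.sigmoid x)

lemma sigmoidDeriv_pos (x : ℝ) : 0 < sigmoidDeriv x :=
  mul_pos (Real.sigmoid_pos x) (sub_pos.2 (Real.sigmoid_lt_one x))

lemma sigmoidDeriv_le (x : ℝ) : sigmoidDeriv x ≤ 1 / 4 := by
  unfold sigmoidDeriv; nlinarith [sq_nonneg (Real.sigmoid x - 1 / 2)]

lemma hasDerivAt_sigmoid' (x : ℝ) : HasDerivAt Real.sigmoid (sigmoidDeriv x) x :=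
  Real.hasDerivAt_sigmoid x

lemma continuous_sigmoidDeriv : Continuous sigmoidDeriv := by
  unfold sigmoidDeriv
  exact continuous_sigmoid.mul (continuous_const.sub continuous_sigmoid)

lemma exists_sigmoidDeriv_lower (B : ℝ) : ∃ c > 0, ∀ x, |x| ≤ B → c ≤ sigmoidDeriv x := by
  by_cases hB : 0 ≤ B
  · obtain ⟨x, -, hx⟩ := (isCompact_Icc (a := -B) (b := B)).exists_isMinOn
      ⟨0, by constructor <;> linarith⟩ continuous_sigmoidDeriv.continuousOn
    exact ⟨sigmoidDeriv x, sigmoidDeriv_pos x, fun y hy => hx (abs_le.1 hy)⟩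
  · exact ⟨1, one_pos, fun x hx => absurd ((abs_nonneg x).trans hx) hB⟩

lemma abs_sigmoid_sub_le (a b : ℝ) : |Real.sigmoid b - Real.sigmoid a| ≤ 1 / 4 * |b - a| := by
  have := (convex_univ (𝕜 := ℝ) (E := ℝ)).norm_image_sub_le_of_norm_hasDerivWithin_le
    (f := Real.sigmoid) (f' := sigmoidDeriv) (C := 1 / 4) (x := a) (y := b)
    (fun x _ => (hasDerivAt_sigmoid' x).hasDerivWithinAt)
    (fun x _ => by rw [Real.norm_of_nonneg (sigmoidDeriv_pos x).le]; exact sigmoidDeriv_le x)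
    trivial trivial
  simpa using this

lemma abs_sigmoidDeriv_sub_le (a b : ℝ) : |sigmoidDeriv b - sigmoidDeriv a| ≤ |b - a| := by
  have h := abs_sigmoid_sub_le a b
  have h1 := Real.sigmoid_pos a
  have h2 := Real.sigmoid_lt_one a
  have h3 := Real.sigmoid_pos b
  have h4 := Real.sigmoid_lt_one b
  have : sigmoidDeriv b - sigmoidDeriv a
      = (Real.sigmoid b - Real.sigmoid a) * (1 - Real.sigmoid a - Real.sigmoid b) := by
    unfold sigmoidDeriv; ring
  rw [this, abs_mul]
  have h5 : |1 - Real.sigmoid a - Real.sigmoid b| ≤ 1 := by rw [abs_le]; constructor <;> linarith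
  nlinarith [abs_nonneg (Real.sigmoid b - Real.sigmoid a), abs_nonneg (b - a)]

/-- First-order expansion of the logistic function, in the two-point form that yields strict
differentiability with uniform constants. -/
lemma abs_sigmoid_taylor (c a b r : ℝ) (ha : |a - c| ≤ r) (hb : |b - c| ≤ r) :
    |Real.sigmoid b - Real.sigmoid a - sigmoidDeriv c * (b - a)| ≤ r * |b - a| := by
  have := (convex_Icc (c - r) (c + r)).norm_image_sub_le_of_norm_hasDerivWithin_le
    (f := fun x => Real.sigmoid x - sigmoidDeriv c * x)
    (f' := fun x => sigmoidDeriv x - sigmoidDeriv c * 1) (C := r) (x := a) (y := b)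
    (fun x _ => ((hasDerivAt_sigmoid' x).sub ((hasDerivAt_id x).const_mul _)).hasDerivWithinAt)
    (fun x hx => by
      rw [mul_one, Real.norm_eq_abs]
      refine (abs_sigmoidDeriv_sub_le c x).trans ?_
      rw [abs_le]; constructor <;> linarith [hx.1, hx.2])
    (by rw [abs_le] at ha; constructor <;> linarith)
    (by rw [abs_le] at hb; constructor <;> linarith)
  rw [Real.norm_eq_abs, Real.norm_eq_abs] at this
  convert this using 2
  ring

lemma log_sigmoid (x : ℝ) : Real.log (Real.sigmoid x) = x - softplus x := by
  have h : Real.sigmoid x * Real.exp (-x) = 1 - Real.sigmoid x := by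
    rw [Real.sigmoid_mul_rexp_neg, Real.sigmoid_neg]
  have h2 := congrArg Real.log h
  rw [Real.log_mul (Real.sigmoid_pos x).ne' (Real.exp_pos _).ne', Real.log_exp] at h2
  unfold softplus; linarith

lemma hasDerivAt_softplus (x : ℝ) : HasDerivAt softplus (Real.sigmoid x) x := by
  have h0 : 1 - Real.sigmoid x ≠ 0 := (sub_pos.2 (Real.sigmoid_lt_one x)).ne'
  have h := (((hasDerivAt_sigmoid' x).const_sub 1).log h0).neg
  refine h.congr_deriv ?_
  unfold sigmoidDeriv; field_simp

/-- A function on an interval whose derivative increases at rate at least `c` lies above its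
tangents by `c / 2` times the squared distance. -/
lemma tangent_le_of_deriv {f f' : ℝ → ℝ} {s : Set ℝ} (hs : Convex ℝ s) {c : ℝ}
    (hf : ∀ x, HasDerivAt f (f' x) x)
    (hf' : ∀ x ∈ s, ∀ y ∈ s, x ≤ y → c * (y - x) ≤ f' y - f' x) {a b : ℝ} (ha : a ∈ s)
    (hb : b ∈ s) : c / 2 * (b - a) ^ 2 ≤ f b - f a - f' a * (b - a) := by
  let h : ℝ → ℝ := fun x => f x - f' a * (x - a) - c / 2 * (x - a) ^ 2
  have hd : ∀ x, HasDerivAt h (f' x - f' a - c * (x - a)) x := fun x => by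
    have h1 := ((hf x).sub (((hasDerivAt_id x).sub_const a).const_mul (f' a))).sub
      ((((hasDerivAt_id x).sub_const a).pow 2).const_mul (c / 2))
    refine h1.congr_deriv ?_
    simp; ring
  have hc : Continuous h := continuous_iff_continuousAt.2 fun x => (hd x).continuousAt
  have key : h a ≤ h b := by
    rcases le_total a b with hab | hab
    · have hsub : Set.Icc a b ⊆ s := hs.ordConnected.out ha hb
      exact monotoneOn_of_deriv_nonneg (convex_Icc a b) hc.continuousOn
        (fun x _ => (hd x).differentiableAt.differentiableWithinAt)
        (fun x hx => by
          rw [interior_Icc] at hx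
          rw [(hd x).deriv]
          linarith [hf' a ha x (hsub ⟨hx.1.le, hx.2.le⟩) hx.1.le])
        ⟨le_rfl, hab⟩ ⟨hab, le_rfl⟩ hab
    · have hsub : Set.Icc b a ⊆ s := hs.ordConnected.out hb ha
      exact antitoneOn_of_deriv_nonpos (convex_Icc b a) hc.continuousOn
        (fun x _ => (hd x).differentiableAt.differentiableWithinAt)
        (fun x hx => by
          rw [interior_Icc] at hx
          rw [(hd x).deriv]
          linarith [hf' x (hsub ⟨hx.1.le, hx.2.le⟩) a ha hx.2.le])
        ⟨le_rfl, hab⟩ ⟨hab, le_rfl⟩ hab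
  simp only [h, sub_self] at key
  linarith

lemma softplus_lower {B c : ℝ} (hc : ∀ x, |x| ≤ B → c ≤ sigmoidDeriv x) {a b : ℝ}
    (ha : |a| ≤ B) (hb : |b| ≤ B) :
    c / 2 * (b - a) ^ 2 ≤ softplus b - softplus a - Real.sigmoid a * (b - a) := by
  refine tangent_le_of_deriv (convex_Icc (-B) B) hasDerivAt_softplus ?_ (abs_le.1 ha) (abs_le.1 hb)
  intro x hx y hy hxy
  refine (convex_Icc (-B) B).mul_sub_le_image_sub_of_le_deriv
    continuous_sigmoid.continuousOn differentiable_sigmoid.differentiableOn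
    (fun z hz => ?_) x hx y hy hxy
  rw [(hasDerivAt_sigmoid' z).deriv]
  exact hc z (abs_le.2 (interior_subset (s := Set.Icc (-B) B) hz))

lemma softplus_tangent_le (a b : ℝ) :
    0 ≤ softplus b - softplus a - Real.sigmoid a * (b - a) := by
  have := tangent_le_of_deriv (c := 0) convex_univ hasDerivAt_softplus
    (fun x _ y _ hxy => by have := Real.sigmoid_le hxy; linarith) (a := a) (b := b)
    trivial trivial
  simpa using this

lemma softplus_upper (a b : ℝ) :
    softplus b - softplus a - Real.sigmoid a * (b - a) ≤ (b - a) ^ 2 := by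
  have := tangent_le_of_deriv (c := -(1 / 4)) (f := fun x => -softplus x) convex_univ
    (fun x => (hasDerivAt_softplus x).neg)
    (fun x _ y _ hxy => by
      have := le_of_abs_le (abs_sigmoid_sub_le x y)
      rw [abs_of_nonneg (by linarith)] at this; linarith) (a := a) (b := b) trivial trivial
  nlinarith [sq_nonneg (b - a)]

section Averages
/-! ### Averages -/

/-- The average of `f` over the finite set `s`; it is `0` if `s` is empty. -/
noncomputable def mean {ι : Type*} (s : Finset ι) (f : ι → ℝ) : ℝ :=
  (1 / (s.card : ℝ)) * ∑ i ∈ s, f i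

section Mean
variable {ι : Type*} {s : Finset ι} {f g : ι → ℝ} {b c : ℝ}

lemma mean_add : mean s (fun i => f i + g i) = mean s f + mean s g := by
  simp only [mean, Finset.sum_add_distrib, mul_add]

lemma mean_sub : mean s (fun i => f i - g i) = mean s f - mean s g := by
  simp only [mean, Finset.sum_sub_distrib, mul_sub]

lemma mean_const_mul : mean s (fun i => c * f i) = c * mean s f := by
  simp only [mean, ← Finset.mul_sum]; ring

lemma mean_congr (h : ∀ i ∈ s, f i = g i) : mean s f = mean s g := by
  unfold mean; rw [Finset.sum_congr rfl h]

lemma mean_mono (h : ∀ i ∈ s, f i ≤ g i) : mean s f ≤ mean s g :=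
  mul_le_mul_of_nonneg_left (Finset.sum_le_sum h) (by positivity)

lemma mean_nonneg (h : ∀ i ∈ s, 0 ≤ f i) : 0 ≤ mean s f :=
  mul_nonneg (by positivity) (Finset.sum_nonneg h)

lemma mean_const (hs : s.Nonempty) : mean s (fun _ => c) = c := by
  have : (s.card : ℝ) ≠ 0 := by exact_mod_cast hs.card_pos.ne'
  simp only [mean, Finset.sum_const, nsmul_eq_mul]; field_simp

lemma mean_const_le (hc : 0 ≤ c) : mean s (fun _ => c) ≤ c := by
  rcases s.eq_empty_or_nonempty with rfl | hs
  · simpa [mean] using hc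
  · exact (mean_const hs).le

lemma mean_le (h : ∀ i ∈ s, f i ≤ b) (hb : 0 ≤ b) : mean s f ≤ b :=
  (mean_mono h).trans (mean_const_le hb)

lemma abs_mean_le_mean : |mean s f| ≤ mean s (fun i => |f i|) := by
  unfold mean
  rw [abs_mul, abs_of_nonneg (by positivity : (0 : ℝ) ≤ 1 / (s.card : ℝ))]
  exact mul_le_mul_of_nonneg_left (Finset.abs_sum_le_sum_abs _ _) (by positivity)

lemma abs_mean_le (h : ∀ i ∈ s, |f i| ≤ b) (hb : 0 ≤ b) : |mean s f| ≤ b :=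
  abs_mean_le_mean.trans (mean_le h hb)

lemma mean_mul_sq_le :
    mean s (fun i => f i * g i) ^ 2 ≤ mean s (fun i => f i ^ 2) * mean s (fun i => g i ^ 2) := by
  have := Finset.sum_mul_sq_le_sq_mul_sq s f g
  unfold mean
  have h : (0 : ℝ) ≤ (1 / (s.card : ℝ)) ^ 2 := by positivity
  calc _ = (1 / (s.card : ℝ)) ^ 2 * (∑ i ∈ s, f i * g i) ^ 2 := by ring
    _ ≤ (1 / (s.card : ℝ)) ^ 2 * ((∑ i ∈ s, f i ^ 2) * ∑ i ∈ s, g i ^ 2) :=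
        mul_le_mul_of_nonneg_left this h
    _ = _ := by ring

lemma mean_sq_le : mean s f ^ 2 ≤ mean s (fun i => f i ^ 2) := by
  have h := mean_mul_sq_le (s := s) (f := f) (g := fun _ => 1)
  simp only [mul_one, one_pow] at h
  exact h.trans (mul_le_of_le_one_right (mean_nonneg fun i _ => sq_nonneg _)
    (mean_const_le zero_le_one))

end Mean

/-! ### Peer averages and indices -/

variable {n d : ℕ}

/-- The parameter `ζ = (μ, θ)` of a single group. -/
abbrev Param (d : ℕ) := ℝ × Slope d

/-- The weight of `j` in the peer average of `i`. -/
noncomputable def peerWeight (F : Fin n → Fin n → Bool) (i j : Fin n) : ℝ :=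
  (numFriends F i : ℝ)⁻¹ * (if F i j = true then 1 else 0)

lemma peerWeight_nonneg (F : Fin n → Fin n → Bool) (i j : Fin n) : 0 ≤ peerWeight F i j := by
  unfold peerWeight; positivity

lemma sum_peerWeight_le (F : Fin n → Fin n → Bool) (i : Fin n) : ∑ j, peerWeight F i j ≤ 1 := by
  simp only [peerWeight, ← Finset.mul_sum, Finset.sum_boole]
  change (numFriends F i : ℝ)⁻¹ * (numFriends F i : ℝ) ≤ 1
  exact inv_mul_le_one

lemma peerAvg_eq (F : Fin n → Fin n → Bool) (P : Fin n → ℝ) (i : Fin n) :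
    peerAvg F P i = ∑ j, peerWeight F i j * P j := by
  unfold peerAvg peerWeight
  simp only [mul_assoc, ← Finset.mul_sum, ite_mul, one_mul, zero_mul, ← Finset.sum_filter]
  split_ifs with h
  · rw [one_div]
  · have : numFriends F i = 0 := by omega
    simp [this]

lemma peerAvg_add (F : Fin n → Fin n → Bool) (P Q : Fin n → ℝ) (i : Fin n) :
    peerAvg F (P + Q) i = peerAvg F P i + peerAvg F Q i := by
  simp only [peerAvg_eq, Pi.add_apply, mul_add, Finset.sum_add_distrib]

lemma peerAvg_sub (F : Fin n → Fin n → Bool) (P Q : Fin n → ℝ) (i : Fin n) :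
    peerAvg F (P - Q) i = peerAvg F P i - peerAvg F Q i := by
  simp only [peerAvg_eq, Pi.sub_apply, mul_sub, Finset.sum_sub_distrib]

lemma peerAvg_mono (F : Fin n → Fin n → Bool) {P Q : Fin n → ℝ} (h : ∀ j, P j ≤ Q j) (i : Fin n) :
    peerAvg F P i ≤ peerAvg F Q i := by
  simp only [peerAvg_eq]
  exact Finset.sum_le_sum fun j _ => mul_le_mul_of_nonneg_left (h j) (peerWeight_nonneg F i j)

lemma abs_peerAvg_le_peerAvg (F : Fin n → Fin n → Bool) (P : Fin n → ℝ) (i : Fin n) :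
    |peerAvg F P i| ≤ peerAvg F (fun j => |P j|) i := by
  simp only [peerAvg_eq]
  refine (Finset.abs_sum_le_sum_abs _ _).trans (Finset.sum_le_sum fun j _ => ?_)
  rw [abs_mul, abs_of_nonneg (peerWeight_nonneg F i j)]

lemma peerAvg_const_le (F : Fin n → Fin n → Bool) {b : ℝ} (hb : 0 ≤ b) (i : Fin n) :
    peerAvg F (fun _ => b) i ≤ b := by
  rw [peerAvg_eq, ← Finset.sum_mul]
  exact mul_le_of_le_one_left hb (sum_peerWeight_le F i)

lemma abs_peerAvg_le (F : Fin n → Fin n → Bool) {P : Fin n → ℝ} {b : ℝ} (hb : 0 ≤ b)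
    (h : ∀ j, |P j| ≤ b) (i : Fin n) : |peerAvg F P i| ≤ b :=
  (abs_peerAvg_le_peerAvg F P i).trans ((peerAvg_mono F h i).trans (peerAvg_const_le F hb i))

lemma abs_le_norm (P : Fin n → ℝ) (i : Fin n) : |P i| ≤ ‖P‖ := norm_le_pi_norm P i

lemma abs_peerAvg_le_norm (F : Fin n → Fin n → Bool) (P : Fin n → ℝ) (i : Fin n) :
    |peerAvg F P i| ≤ ‖P‖ := abs_peerAvg_le F (norm_nonneg _) (abs_le_norm P) i

/-- Covariates bounded by `B`, and total influence of every individual bounded by `B`. The bound may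
always be enlarged, and `1 ≤ B` is part of the definition to keep the constants simple. -/
structure IsRegular (B : ℝ) (X : Fin n → Fin d → ℝ) (F : Fin n → Fin n → Bool) : Prop where
  one_le : 1 ≤ B
  abs_X_le : ∀ i j, |X i j| ≤ B
  col_le : ∀ j, ∑ i, peerWeight F i j ≤ B

/-- Bounded influence makes peer averaging a bounded operator in mean square: by Jensen's
inequality the row sums, and then the column sums, of the weights come in. -/
lemma IsRegular.mean_peerAvg_sq_le {B : ℝ} {X : Fin n → Fin d → ℝ} {F : Fin n → Fin n → Bool}
    (h : IsRegular B X F) (P : Fin n → ℝ) :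
    mean Finset.univ (fun i => peerAvg F P i ^ 2) ≤ B * mean Finset.univ (fun i => P i ^ 2) := by
  have h1 : ∀ i, peerAvg F P i ^ 2 ≤ ∑ j, peerWeight F i j * P j ^ 2 := fun i => by
    have h2 := Finset.sum_sq_le_sum_mul_sum_of_sq_le_mul Finset.univ
      (r := fun j => peerWeight F i j * P j) (f := fun j => peerWeight F i j)
      (g := fun j => peerWeight F i j * P j ^ 2) (fun j _ => peerWeight_nonneg F i j)
      (fun j _ => mul_nonneg (peerWeight_nonneg F i j) (sq_nonneg _))
      (fun j _ => (by ring : _ = _).le)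
    rw [peerAvg_eq]
    exact h2.trans (mul_le_of_le_one_left (Finset.sum_nonneg fun j _ =>
      mul_nonneg (peerWeight_nonneg F i j) (sq_nonneg _)) (sum_peerWeight_le F i))
  have h3 : ∑ i, peerAvg F P i ^ 2 ≤ B * ∑ j, P j ^ 2 := by
    refine (Finset.sum_le_sum fun i _ => h1 i).trans ?_
    rw [Finset.sum_comm, Finset.mul_sum]
    refine Finset.sum_le_sum fun j _ => ?_
    rw [← Finset.sum_mul]
    exact mul_le_mul_of_nonneg_right (h.col_le j) (sq_nonneg _)
  unfold mean
  have := mul_le_mul_of_nonneg_left h3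
    (by positivity : (0 : ℝ) ≤ 1 / ((Finset.univ : Finset (Fin n)).card : ℝ))
  linarith

/-- The index as a continuous linear functional of the parameter, for given choice
probabilities. -/
noncomputable def indexCLM (X : Fin n → Fin d → ℝ) (F : Fin n → Fin n → Bool) (P : Fin n → ℝ)
    (i : Fin n) : Param d →L[ℝ] ℝ :=
  (peerAvg F P i • EuclideanSpace.proj (0 : Fin (d + 1))
    + ∑ j : Fin d, X i j • EuclideanSpace.proj j.succ : Slope d →L[ℝ] ℝ).comp
      (ContinuousLinearMap.snd ℝ ℝ (Slope d)) + ContinuousLinearMap.fst ℝ ℝ (Slope d)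

lemma indexCLM_apply (X : Fin n → Fin d → ℝ) (F : Fin n → Fin n → Bool) (P : Fin n → ℝ)
    (i : Fin n) (z : Param d) : indexCLM X F P i z = index X F z.1 z.2 P i := by
  simp [indexCLM, index]

lemma index_eq (X : Fin n → Fin d → ℝ) (F : Fin n → Fin n → Bool) (μ : ℝ) (θ : Slope d)
    (P : Fin n → ℝ) (i : Fin n) : index X F μ θ P i = indexCLM X F P i (μ, θ) :=
  (indexCLM_apply X F P i (μ, θ)).symm

lemma indexCLM_sub_ccp (X : Fin n → Fin d → ℝ) (F : Fin n → Fin n → Bool) (P Q : Fin n → ℝ)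
    (i : Fin n) (z : Param d) :
    indexCLM X F P i z - indexCLM X F Q i z = z.2 0 * peerAvg F (P - Q) i := by
  simp only [indexCLM_apply, index, peerAvg_sub]; ring

lemma abs_snd_apply_le (z : Param d) (j : Fin (d + 1)) : |z.2 j| ≤ ‖z‖ :=
  (PiLp.norm_apply_le z.2 j).trans (norm_snd_le z)

/-- A bound for the norm of the index functional at choice probabilities in `[-1, 1]`. -/
noncomputable def indexBound (d : ℕ) (B : ℝ) : ℝ := 2 + d * B

lemma two_le_indexBound {B : ℝ} (hB : 1 ≤ B) : 2 ≤ indexBound d B := by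
  unfold indexBound; have : (0 : ℝ) ≤ d * B := by positivity
  linarith

lemma IsRegular.abs_indexCLM_le {B : ℝ} {X : Fin n → Fin d → ℝ} {F : Fin n → Fin n → Bool}
    (h : IsRegular B X F) {P : Fin n → ℝ} (hP : ‖P‖ ≤ 1) (i : Fin n) (z : Param d) :
    |indexCLM X F P i z| ≤ indexBound d B * ‖z‖ := by
  have h0 := norm_nonneg z
  have h1 : |peerAvg F P i * z.2 0| ≤ ‖z‖ := by
    rw [abs_mul]
    have := mul_le_mul ((abs_peerAvg_le_norm F P i).trans hP) (abs_snd_apply_le z 0)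
      (abs_nonneg _) zero_le_one
    linarith
  have h2 : |∑ j, X i j * z.2 j.succ| ≤ d * B * ‖z‖ := by
    refine (Finset.abs_sum_le_sum_abs _ _).trans ?_
    refine (Finset.sum_le_sum (g := fun _ => B * ‖z‖) fun j _ => ?_).trans ?_
    · rw [abs_mul]
      exact mul_le_mul (h.abs_X_le i j) (abs_snd_apply_le z _) (abs_nonneg _)
        (zero_le_one.trans h.one_le)
    · simp; linarith
  have h3 : |z.1| ≤ ‖z‖ := norm_fst_le z
  rw [indexCLM_apply, index, indexBound]
  refine (abs_add_three _ _ _).trans ?_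
  linarith

end Averages

section Equilibrium
variable {n d : ℕ}

/-! ### Equilibrium choice probabilities -/

section FixedPoint
variable {h : (Fin n → ℝ) → (Fin n → ℝ)} {r : ℝ}

lemma exists_fixedPoint (hr0 : 0 ≤ r) (hr : r < 1) (hh : ∀ P Q, ‖h P - h Q‖ ≤ r * ‖P - Q‖) :
    ∃ P, h P = P ∧ Tendsto (fun k => h^[k] 0) atTop (𝓝 P) := by
  have hc : ContractingWith ⟨r, hr0⟩ h :=
    ⟨by exact_mod_cast hr, LipschitzWith.of_dist_le_mul fun P Q => by
      rw [dist_eq_norm, dist_eq_norm]; exact hh P Q⟩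
  exact ⟨hc.fixedPoint, hc.fixedPoint_isFixedPt, hc.tendsto_iterate_fixedPoint 0⟩

lemma fixedPoint_unique (hr : r < 1) (hh : ∀ P Q, ‖h P - h Q‖ ≤ r * ‖P - Q‖) {P Q : Fin n → ℝ}
    (hP : h P = P) (hQ : h Q = Q) : P = Q := by
  have h1 := hh P Q
  rw [hP, hQ] at h1
  have h2 : ‖P - Q‖ = 0 := by nlinarith [norm_nonneg (P - Q)]
  exact sub_eq_zero.1 (norm_eq_zero.1 h2)

/-- The supremum norm of a vector whose entries are bounded by `a` plus a contraction of the vector.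
All bounds for equilibrium objects come from this, whence the factors `1 / (1 - r)`. -/
lemma norm_le_of_contraction {v : Fin n → ℝ} {a : ℝ} (ha : 0 ≤ a) (hr0 : 0 ≤ r) (hr : r < 1)
    (hv : ∀ i, |v i| ≤ a + r * ‖v‖) : ‖v‖ ≤ a / (1 - r) := by
  have h1 : ‖v‖ ≤ a + r * ‖v‖ := (pi_norm_le_iff_of_nonneg (by positivity)).2 hv
  rw [le_div_iff₀ (by linarith)]
  linarith

end FixedPoint

variable {X : Fin n → Fin d → ℝ} {F : Fin n → Fin n → Bool}

lemma bestResponse_contraction (μ : ℝ) (θ : Slope d) (P Q : Fin n → ℝ) :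
    ‖bestResponse X F μ θ P - bestResponse X F μ θ Q‖ ≤ |θ 0| / 4 * ‖P - Q‖ := by
  refine (pi_norm_le_iff_of_nonneg (by positivity)).2 fun i => ?_
  refine (abs_sigmoid_sub_le _ _).trans ?_
  rw [index_eq, index_eq, indexCLM_sub_ccp, abs_mul]
  have := mul_le_mul_of_nonneg_left (abs_peerAvg_le_norm F (P - Q) i) (abs_nonneg (θ 0))
  simp only
  linarith

lemma exists_ccp (μ : ℝ) {θ : Slope d} (hθ : |θ 0| < 4) :
    ∃ P, P = bestResponse X F μ θ P ∧
      Tendsto (fun k => (bestResponse X F μ θ)^[k] 0) atTop (𝓝 P) := by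
  obtain ⟨P, h1, h2⟩ := exists_fixedPoint (by positivity) (by linarith : |θ 0| / 4 < 1)
    (bestResponse_contraction (X := X) (F := F) μ θ)
  exact ⟨P, h1.symm, h2⟩

lemma ccp_eq (μ : ℝ) {θ : Slope d} (hθ : |θ 0| < 4) :
    ccp X F μ θ = bestResponse X F μ θ (ccp X F μ θ) :=
  Classical.epsilon_spec (p := fun P => P = bestResponse X F μ θ P)
    ((exists_ccp μ hθ).imp fun _ h => h.1)

lemma eq_ccp {μ : ℝ} {θ : Slope d} (hθ : |θ 0| < 4) {P : Fin n → ℝ}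
    (hP : P = bestResponse X F μ θ P) : P = ccp X F μ θ :=
  fixedPoint_unique (by linarith : |θ 0| / 4 < 1) (bestResponse_contraction μ θ)
    hP.symm (ccp_eq μ hθ).symm

lemma tendsto_iterate_ccp (μ : ℝ) {θ : Slope d} (hθ : |θ 0| < 4) :
    Tendsto (fun k => (bestResponse X F μ θ)^[k] 0) atTop (𝓝 (ccp X F μ θ)) := by
  obtain ⟨P, h1, h2⟩ := exists_ccp (X := X) (F := F) μ hθ
  rwa [← eq_ccp hθ h1]

lemma ccp_apply {z : Param d} (hz : |z.2 0| < 4) (i : Fin n) :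
    ccp X F z.1 z.2 i = Real.sigmoid (indexCLM X F (ccp X F z.1 z.2) i z) := by
  conv_lhs => rw [ccp_eq z.1 hz]
  rw [indexCLM_apply]; rfl

lemma norm_ccp_le {z : Param d} (hz : |z.2 0| < 4) : ‖ccp X F z.1 z.2‖ ≤ 1 := by
  refine (pi_norm_le_iff_of_nonneg zero_le_one).2 fun i => ?_
  rw [ccp_apply hz, Real.norm_of_nonneg (Real.sigmoid_nonneg _)]
  exact Real.sigmoid_le_one _

lemma abs_lt_four {r x : ℝ} (hr : r < 1) (h : |x| ≤ 4 * r) : |x| < 4 := by linarith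

/-- A Lipschitz constant of the equilibrium choice probabilities and of the equilibrium indices
as functions of the parameters, when the peer effects are bounded by `4 * r`. -/
noncomputable def ccpLip (d : ℕ) (B r : ℝ) : ℝ := indexBound d B / (1 - r)

/-- The constant of the quadratic error in the linearization of the equilibrium choice
probabilities. -/
noncomputable def ccpQuad (d : ℕ) (B r : ℝ) : ℝ :=
  2 * ccpLip d B r ^ 2 / (1 - r)

section Lipschitz
variable {B r : ℝ} (hreg : IsRegular B X F) (hr0 : 0 ≤ r) (hr : r < 1)
include hreg hr0 hr

lemma two_le_ccpLip : 2 ≤ ccpLip d B r := by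
  unfold ccpLip
  rw [le_div_iff₀ (by linarith)]
  linarith [two_le_indexBound (d := d) hreg.one_le]

omit hreg hr0 in
lemma ccpLip_mul : ccpLip d B r * (1 - r) = indexBound d B := by
  unfold ccpLip; field_simp [(by linarith : 1 - r ≠ 0)]

lemma norm_ccp_sub_le' {z z' : Param d} (hz : |z.2 0| ≤ 4 * r) (hz' : |z'.2 0| ≤ 4 * r) :
    ‖ccp X F z.1 z.2 - ccp X F z'.1 z'.2‖ ≤ ccpLip d B r / 4 * ‖z - z'‖ := by
  have h4 := abs_lt_four hr hz
  have h4' := abs_lt_four hr hz'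
  have hB := two_le_indexBound (d := d) hreg.one_le
  have key := norm_le_of_contraction (v := ccp X F z.1 z.2 - ccp X F z'.1 z'.2)
    (a := indexBound d B / 4 * ‖z - z'‖) (by positivity) hr0 hr fun i => ?_
  · refine key.trans (le_of_eq ?_)
    unfold ccpLip; field_simp
  · rw [Pi.sub_apply, ccp_apply h4, ccp_apply h4']
    refine (abs_sigmoid_sub_le _ _).trans ?_
    have e : indexCLM X F (ccp X F z.1 z.2) i z - indexCLM X F (ccp X F z'.1 z'.2) i z'
        = indexCLM X F (ccp X F z'.1 z'.2) i (z - z')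
          + z.2 0 * peerAvg F (ccp X F z.1 z.2 - ccp X F z'.1 z'.2) i := by
      rw [← indexCLM_sub_ccp X, map_sub]; ring
    rw [e]
    have h1 := hreg.abs_indexCLM_le (norm_ccp_le (X := X) (F := F) h4') i (z - z')
    have h2 : |z.2 0 * peerAvg F (ccp X F z.1 z.2 - ccp X F z'.1 z'.2) i|
        ≤ 4 * r * ‖ccp X F z.1 z.2 - ccp X F z'.1 z'.2‖ := by
      rw [abs_mul]
      exact mul_le_mul hz (abs_peerAvg_le_norm F _ i) (abs_nonneg _) (by linarith)
    have h3 := abs_add_le (indexCLM X F (ccp X F z'.1 z'.2) i (z - z'))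
      (z.2 0 * peerAvg F (ccp X F z.1 z.2 - ccp X F z'.1 z'.2) i)
    linarith

lemma norm_ccp_sub_le {z z' : Param d} (hz : |z.2 0| ≤ 4 * r) (hz' : |z'.2 0| ≤ 4 * r) :
    ‖ccp X F z.1 z.2 - ccp X F z'.1 z'.2‖ ≤ ccpLip d B r * ‖z - z'‖ := by
  have := norm_ccp_sub_le' hreg hr0 hr hz hz'
  have h2 := two_le_ccpLip hreg hr0 hr
  nlinarith [norm_nonneg (z - z')]

lemma abs_index_sub_le {z z' : Param d} (hz : |z.2 0| ≤ 4 * r) (hz' : |z'.2 0| ≤ 4 * r)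
    (i : Fin n) :
    |indexCLM X F (ccp X F z.1 z.2) i z - indexCLM X F (ccp X F z'.1 z'.2) i z'|
      ≤ ccpLip d B r * ‖z - z'‖ := by
  have h4' := abs_lt_four hr hz'
  have e : indexCLM X F (ccp X F z.1 z.2) i z - indexCLM X F (ccp X F z'.1 z'.2) i z'
      = indexCLM X F (ccp X F z'.1 z'.2) i (z - z')
        + z.2 0 * peerAvg F (ccp X F z.1 z.2 - ccp X F z'.1 z'.2) i := by
    rw [← indexCLM_sub_ccp X, map_sub]; ring
  rw [e]
  have h1 := hreg.abs_indexCLM_le (norm_ccp_le (X := X) (F := F) h4') i (z - z')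
  have h2 : |z.2 0 * peerAvg F (ccp X F z.1 z.2 - ccp X F z'.1 z'.2) i|
      ≤ 4 * r * (ccpLip d B r / 4 * ‖z - z'‖) := by
    rw [abs_mul]
    exact mul_le_mul hz ((abs_peerAvg_le_norm F _ i).trans (norm_ccp_sub_le' hreg hr0 hr hz hz'))
      (abs_nonneg _) (by linarith)
  have h3 := abs_add_le (indexCLM X F (ccp X F z'.1 z'.2) i (z - z'))
      (z.2 0 * peerAvg F (ccp X F z.1 z.2 - ccp X F z'.1 z'.2) i)
  have h5 := ccpLip_mul (d := d) (B := B) hr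
  rw [← h5] at h1
  nlinarith

end Lipschitz

/-! ### The derivative of the equilibrium choice probabilities -/

/-- The slope of the logistic function at the equilibrium index of individual `i`. -/
noncomputable def slopeAt (X : Fin n → Fin d → ℝ) (F : Fin n → Fin n → Bool) (z : Param d)
    (i : Fin n) : ℝ :=
  sigmoidDeriv (indexCLM X F (ccp X F z.1 z.2) i z)

/-- The derivative of the best response with respect to the choice probabilities, at the
equilibrium. -/
noncomputable def responseMatrix (X : Fin n → Fin d → ℝ) (F : Fin n → Fin n → Bool)
    (z : Param d) : Matrix (Fin n) (Fin n) ℝ :=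
  Matrix.of fun i j => slopeAt X F z i * z.2 0 * peerWeight F i j

/-- The derivative of the equilibrium choice probabilities with respect to the parameter, as
given by the implicit function theorem. -/
noncomputable def ccpDeriv (X : Fin n → Fin d → ℝ) (F : Fin n → Fin n → Bool) (z : Param d) :
    Param d →L[ℝ] (Fin n → ℝ) :=
  LinearMap.toContinuousLinearMap ((Matrix.toLin' (1 - responseMatrix X F z)⁻¹).comp
    (LinearMap.pi fun i => slopeAt X F z i •
      (indexCLM X F (ccp X F z.1 z.2) i : Param d →ₗ[ℝ] ℝ)))

/-- The map whose fixed point is the derivative of the equilibrium choice probabilities in the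
direction `u`. -/
noncomputable def linResponse (X : Fin n → Fin d → ℝ) (F : Fin n → Fin n → Bool) (z u : Param d)
    (v : Fin n → ℝ) : Fin n → ℝ :=
  fun i => slopeAt X F z i *
    (indexCLM X F (ccp X F z.1 z.2) i u + z.2 0 * peerAvg F v i)

lemma slopeAt_pos (z : Param d) (i : Fin n) : 0 < slopeAt X F z i := sigmoidDeriv_pos _

lemma slopeAt_le (z : Param d) (i : Fin n) : slopeAt X F z i ≤ 1 / 4 := sigmoidDeriv_le _

lemma responseMatrix_mulVec (z : Param d) (v : Fin n → ℝ) (i : Fin n) :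
    (responseMatrix X F z).mulVec v i = slopeAt X F z i * (z.2 0 * peerAvg F v i) := by
  simp only [responseMatrix, Matrix.mulVec, dotProduct, Matrix.of_apply, peerAvg_eq,
    Finset.mul_sum]
  exact Finset.sum_congr rfl fun j _ => by ring

lemma abs_slopeAt_mul_le {z : Param d} {r : ℝ} (hz : |z.2 0| ≤ 4 * r) (v : Fin n → ℝ)
    (i : Fin n) : |slopeAt X F z i * (z.2 0 * peerAvg F v i)| ≤ r * ‖v‖ := by
  rw [abs_mul, abs_mul, abs_of_pos (slopeAt_pos z i)]
  have h1 := mul_le_mul hz (abs_peerAvg_le_norm F v i) (abs_nonneg _)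
    ((abs_nonneg _).trans hz)
  have h2 := mul_le_mul (slopeAt_le (X := X) (F := F) z i) h1 (by positivity) (by norm_num)
  linarith

lemma linResponse_contraction {z : Param d} {r : ℝ} (hz : |z.2 0| ≤ 4 * r) (u : Param d)
    (v w : Fin n → ℝ) :
    ‖linResponse X F z u v - linResponse X F z u w‖ ≤ r * ‖v - w‖ := by
  have hr : 0 ≤ r := by linarith [abs_nonneg (z.2 0)]
  refine (pi_norm_le_iff_of_nonneg (by positivity)).2 fun i => ?_
  have := abs_slopeAt_mul_le (X := X) (F := F) hz (v - w) i
  rw [peerAvg_sub] at this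
  rw [Real.norm_eq_abs, Pi.sub_apply]
  convert this using 2
  unfold linResponse; ring

lemma ccpDeriv_eq {z : Param d} (hz : |z.2 0| < 4) (u : Param d) :
    linResponse X F z u (ccpDeriv X F z u) = ccpDeriv X F z u := by
  have hinj : Function.Injective (1 - responseMatrix X F z).mulVec := by
    intro v w hvw
    have h0 : (1 - responseMatrix X F z).mulVec (v - w) = 0 := by
      rw [Matrix.mulVec_sub, hvw, sub_self]
    have h1 : ∀ i, (v - w) i = slopeAt X F z i * (z.2 0 * peerAvg F (v - w) i) := fun i => by
      have := congrFun h0 i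
      rw [Matrix.sub_mulVec, Matrix.one_mulVec, Pi.sub_apply, responseMatrix_mulVec] at this
      simpa [sub_eq_zero] using this
    have h2 : ‖v - w‖ ≤ 0 / (1 - |z.2 0| / 4) :=
      norm_le_of_contraction le_rfl (by positivity) (by linarith) fun i => by
        rw [zero_add, h1 i]
        exact abs_slopeAt_mul_le (by linarith) _ i
    rw [zero_div] at h2
    exact sub_eq_zero.1 (norm_le_zero_iff.1 h2)
  have hunit : IsUnit (1 - responseMatrix X F z) := Matrix.mulVec_injective_iff_isUnit.1 hinj
  set b : Fin n → ℝ := fun i => slopeAt X F z i * indexCLM X F (ccp X F z.1 z.2) i u with hb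
  have hv : ccpDeriv X F z u = (1 - responseMatrix X F z)⁻¹.mulVec b := by
    simp only [ccpDeriv, hb]; rfl
  have h3 : (1 - responseMatrix X F z).mulVec (ccpDeriv X F z u) = b := by
    rw [hv, Matrix.mulVec_mulVec, Matrix.mul_nonsing_inv _
      ((Matrix.isUnit_iff_isUnit_det _).1 hunit), Matrix.one_mulVec]
  funext i
  have := congrFun h3 i
  rw [Matrix.sub_mulVec, Matrix.one_mulVec, Pi.sub_apply, responseMatrix_mulVec] at this
  unfold linResponse
  rw [mul_add]
  simp only [hb] at this
  linarith

lemma ccpDeriv_apply {z : Param d} (hz : |z.2 0| < 4) (u : Param d) (i : Fin n) :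
    ccpDeriv X F z u i = slopeAt X F z i *
      (indexCLM X F (ccp X F z.1 z.2) i u + z.2 0 * peerAvg F (ccpDeriv X F z u) i) :=
  (congrFun (ccpDeriv_eq hz u) i).symm

lemma tendsto_iterate_ccpDeriv {z : Param d} (hz : |z.2 0| < 4) (u : Param d) :
    Tendsto (fun k => (linResponse X F z u)^[k] 0) atTop (𝓝 (ccpDeriv X F z u)) := by
  have hc := linResponse_contraction (X := X) (F := F) (z := z) (r := |z.2 0| / 4)
    (by linarith) u
  obtain ⟨P, h1, h2⟩ := exists_fixedPoint (by positivity) (by linarith) hc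
  rwa [← fixedPoint_unique (by linarith) hc h1 (ccpDeriv_eq hz u)]

section Linearization
variable {B r : ℝ} (hreg : IsRegular B X F) (hr0 : 0 ≤ r) (hr : r < 1)
include hreg hr0 hr

lemma norm_ccpDeriv_le {z : Param d} (hz : |z.2 0| ≤ 4 * r) (u : Param d) :
    ‖ccpDeriv X F z u‖ ≤ ccpLip d B r * ‖u‖ := by
  have h4 := abs_lt_four hr hz
  have hB := two_le_indexBound (d := d) hreg.one_le
  have key := norm_le_of_contraction (v := ccpDeriv X F z u)
    (a := indexBound d B * ‖u‖) (by positivity) hr0 hr fun i => ?_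
  · refine key.trans (le_of_eq ?_)
    unfold ccpLip; field_simp
  · rw [ccpDeriv_apply h4, mul_add]
    refine (abs_add_le _ _).trans (add_le_add ?_ (abs_slopeAt_mul_le hz _ i))
    rw [abs_mul, abs_of_pos (slopeAt_pos z i)]
    have h1 := hreg.abs_indexCLM_le (norm_ccp_le (X := X) (F := F) h4) i u
    have h2 := slopeAt_le (X := X) (F := F) z i
    nlinarith [abs_nonneg (indexCLM X F (ccp X F z.1 z.2) i u)]

omit hreg hr0 in
lemma ccpQuad_nonneg : 0 ≤ ccpQuad d B r :=
  div_nonneg (by positivity) (by linarith)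

/-- Linearization of the equilibrium choice probabilities, uniformly in the group. The estimate for
two arbitrary parameters near `z₀` gives differentiability at `z₀` for `z' = z₀`. -/
lemma norm_ccp_sub_sub_le {z₀ z z' : Param d} {s : ℝ} (h₀ : |z₀.2 0| ≤ 4 * r)
    (hz : |z.2 0| ≤ 4 * r) (hz' : |z'.2 0| ≤ 4 * r) (hs : ‖z - z₀‖ ≤ s) (hs' : ‖z' - z₀‖ ≤ s) :
    ‖ccp X F z.1 z.2 - ccp X F z'.1 z'.2 - ccpDeriv X F z₀ (z - z')‖
      ≤ ccpQuad d B r * s * ‖z - z'‖ := by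
  have h4 := abs_lt_four hr hz
  have h4' := abs_lt_four hr hz'
  have h40 := abs_lt_four hr h₀
  have hs0 : 0 ≤ s := (norm_nonneg _).trans hs
  have hL := two_le_ccpLip hreg hr0 hr
  set L := ccpLip d B r
  have hd0 := norm_nonneg (z - z')
  have key := norm_le_of_contraction
    (v := ccp X F z.1 z.2 - ccp X F z'.1 z'.2 - ccpDeriv X F z₀ (z - z'))
    (a := (L ^ 2 + L) * s * ‖z - z'‖) (by positivity) hr0 hr fun i => ?_
  · refine key.trans ?_
    unfold ccpQuad
    rw [div_mul_eq_mul_div, div_mul_eq_mul_div]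
    refine div_le_div_of_nonneg_right ?_ (by linarith)
    refine mul_le_mul_of_nonneg_right (mul_le_mul_of_nonneg_right ?_ hs0) hd0
    change L ^ 2 + L ≤ 2 * L ^ 2
    nlinarith
  · set P := ccp X F z.1 z.2
    set P' := ccp X F z'.1 z'.2
    set P₀ := ccp X F z₀.1 z₀.2
    set v := ccpDeriv X F z₀ (z - z') with hv
    -- the Taylor remainder of the logistic function, the change of the index map, and the
    -- remainder itself, which enters through the contraction
    have e1 : (P - P' - v) i = (Real.sigmoid (indexCLM X F P i z)
        - Real.sigmoid (indexCLM X F P' i z')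
        - slopeAt X F z₀ i * (indexCLM X F P i z - indexCLM X F P' i z'))
        + slopeAt X F z₀ i * ((z - z').2 0 * peerAvg F (P' - P₀) i
          + (z.2 0 - z₀.2 0) * peerAvg F (P - P') i)
        + slopeAt X F z₀ i * (z₀.2 0 * peerAvg F (P - P' - v) i) := by
      have q1 : v i = slopeAt X F z₀ i * (indexCLM X F P₀ i (z - z') + z₀.2 0 * peerAvg F v i) :=
        ccpDeriv_apply h40 _ i
      have q2 : P i = Real.sigmoid (indexCLM X F P i z) := ccp_apply h4 i
      have q3 : P' i = Real.sigmoid (indexCLM X F P' i z') := ccp_apply h4' i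
      rw [Pi.sub_apply, Pi.sub_apply, q1, q2, q3, ← indexCLM_sub_ccp X]
      simp only [peerAvg_sub]
      have := indexCLM_sub_ccp X F P P' i z
      rw [peerAvg_sub] at this
      have h2 : indexCLM X F P' i (z - z') = indexCLM X F P' i z - indexCLM X F P' i z' :=
        map_sub _ _ _
      have h3 : indexCLM X F P i z = indexCLM X F P' i z
        + z.2 0 * (peerAvg F P i - peerAvg F P' i) := by linarith
      rw [h2, h3]; ring
    have t1 := abs_sigmoid_taylor (indexCLM X F P₀ i z₀) (indexCLM X F P' i z')
      (indexCLM X F P i z) (L * s)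
      ((abs_index_sub_le hreg hr0 hr hz' h₀ i).trans (mul_le_mul_of_nonneg_left hs' (by linarith)))
      ((abs_index_sub_le hreg hr0 hr hz h₀ i).trans (mul_le_mul_of_nonneg_left hs (by linarith)))
    have t2 := abs_index_sub_le hreg hr0 hr hz hz' i
    have t1' := t1.trans (mul_le_mul_of_nonneg_left t2 (by positivity))
    have t3 : |(z - z').2 0 * peerAvg F (P' - P₀) i| ≤ ‖z - z'‖ * (L * s) := by
      rw [abs_mul]
      exact mul_le_mul (abs_snd_apply_le _ 0) ((abs_peerAvg_le_norm F _ i).trans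
        ((norm_ccp_sub_le hreg hr0 hr hz' h₀).trans
          (mul_le_mul_of_nonneg_left hs' (by linarith)))) (abs_nonneg _) hd0
    have t4 : |(z.2 0 - z₀.2 0) * peerAvg F (P - P') i| ≤ s * (L * ‖z - z'‖) := by
      rw [abs_mul]
      exact mul_le_mul ((abs_snd_apply_le (z - z₀) 0).trans hs) ((abs_peerAvg_le_norm F _ i).trans
        (norm_ccp_sub_le hreg hr0 hr hz hz')) (abs_nonneg _) hs0
    have t5 : |slopeAt X F z₀ i * ((z - z').2 0 * peerAvg F (P' - P₀) i
          + (z.2 0 - z₀.2 0) * peerAvg F (P - P') i)| ≤ L * s * ‖z - z'‖ := by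
      rw [abs_mul, abs_of_pos (slopeAt_pos z₀ i)]
      have := (abs_add_le ((z - z').2 0 * peerAvg F (P' - P₀) i)
        ((z.2 0 - z₀.2 0) * peerAvg F (P - P') i)).trans (add_le_add t3 t4)
      have h6 := mul_le_mul (slopeAt_le (X := X) (F := F) z₀ i) this (abs_nonneg _) (by norm_num)
      have h7 : 0 ≤ L * s * ‖z - z'‖ := by positivity
      nlinarith
    have t6 := abs_slopeAt_mul_le (X := X) (F := F) h₀ (P - P' - v) i
    rw [e1]
    refine (abs_add_three _ _ _).trans ?_
    have t7 : |Real.sigmoid (indexCLM X F P i z) - Real.sigmoid (indexCLM X F P' i z')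
        - slopeAt X F z₀ i * (indexCLM X F P i z - indexCLM X F P' i z')|
        ≤ L * s * (L * ‖z - z'‖) := t1'
    nlinarith

end Linearization

end Equilibrium

section Score
variable {n d : ℕ}

/-! ### The likelihood, its score and the Jacobian of the score -/

/-- The outcomes are in `[0, 1]`, and covariates and friendships are regular. -/
structure IsRegularData (B : ℝ) (D : GroupData n d) : Prop where
  reg : IsRegular B D.X D.F
  mem_Icc : ∀ i, D.Y i ∈ Set.Icc (0 : ℝ) 1

lemma unitNLL_eq (D : GroupData n d) (P : Fin n → ℝ) (z : Param d) (i : Fin n) :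
    unitNLL D P z.2 z.1 i
      = softplus (indexCLM D.X D.F P i z) - D.Y i * indexCLM D.X D.F P i z := by
  have h : Real.log (1 - Real.sigmoid (index D.X D.F z.1 z.2 P i))
    = -softplus (index D.X D.F z.1 z.2 P i) := by unfold softplus; ring
  rw [unitNLL, log_sigmoid, h, indexCLM_apply]; ring

lemma groupNLL_eq (D : GroupData n d) (P : Fin n → ℝ) (z : Param d) :
    groupNLL D z.1 z.2 P = mean Finset.univ fun i =>
      softplus (indexCLM D.X D.F P i z) - D.Y i * indexCLM D.X D.F P i z := by
  simp only [groupNLL, mean, unitNLL_eq, Finset.card_univ, Fintype.card_fin]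

/-- The derivative of the likelihood with respect to the parameter for given choice
probabilities. -/
noncomputable def score (D : GroupData n d) (P : Fin n → ℝ) (z : Param d) : Param d →L[ℝ] ℝ :=
  (1 / (n : ℝ)) • ∑ i, (Real.sigmoid (indexCLM D.X D.F P i z) - D.Y i) • indexCLM D.X D.F P i

lemma score_apply (D : GroupData n d) (P : Fin n → ℝ) (z w : Param d) :
    score D P z w = mean Finset.univ fun i =>
      (Real.sigmoid (indexCLM D.X D.F P i z) - D.Y i) * indexCLM D.X D.F P i w := by
  simp [score, mean]

lemma hasFDerivAt_groupNLL (D : GroupData n d) (P : Fin n → ℝ) (z : Param d) :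
    HasFDerivAt (fun z : Param d => groupNLL D z.1 z.2 P) (score D P z) z := by
  simp only [groupNLL_eq, mean, Finset.card_univ, Fintype.card_fin]
  unfold score
  refine HasFDerivAt.const_mul (HasFDerivAt.fun_sum fun i _ => ?_) _
  have h1 := (indexCLM D.X D.F P i).hasFDerivAt (x := z)
  have h2 := ((hasDerivAt_softplus _).comp_hasFDerivAt z h1).sub (h1.const_mul (D.Y i))
  exact h2.congr_fderiv (sub_smul _ _ _).symm

lemma nplScore_eq (D : GroupData n d) (z : Param d) :
    nplScore D z = score D (ccp D.X D.F z.1 z.2) z :=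
  (hasFDerivAt_groupNLL D _ z).fderiv

lemma nplScore_apply (D : GroupData n d) {z : Param d} (hz : |z.2 0| < 4) (w : Param d) :
    nplScore D z w = mean Finset.univ fun i =>
      (ccp D.X D.F z.1 z.2 i - D.Y i) * indexCLM D.X D.F (ccp D.X D.F z.1 z.2) i w := by
  rw [nplScore_eq, score_apply]
  exact mean_congr fun i _ => by rw [← ccp_apply hz]

/-- The likelihood is convex in the parameter for given choice probabilities. -/
lemma groupNLL_tangent_le (D : GroupData n d) (P : Fin n → ℝ) (z z' : Param d) :
    groupNLL D z'.1 z'.2 P + score D P z' (z - z') ≤ groupNLL D z.1 z.2 P := by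
  rw [groupNLL_eq, groupNLL_eq, score_apply, ← mean_add]
  refine mean_mono fun i _ => ?_
  have := softplus_tangent_le (indexCLM D.X D.F P i z') (indexCLM D.X D.F P i z)
  rw [map_sub]
  linarith

/-- Second-order lower bound for the likelihood for given choice probabilities. -/
lemma groupNLL_lower (D : GroupData n d) {P : Fin n → ℝ} {z z' : Param d} {b c : ℝ}
    (hc : ∀ x, |x| ≤ b → c ≤ sigmoidDeriv x) (hz : ∀ i, |indexCLM D.X D.F P i z| ≤ b)
    (hz' : ∀ i, |indexCLM D.X D.F P i z'| ≤ b) :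
    groupNLL D z'.1 z'.2 P + score D P z' (z - z')
      + c / 2 * mean Finset.univ (fun i => indexCLM D.X D.F P i (z - z') ^ 2)
      ≤ groupNLL D z.1 z.2 P := by
  rw [groupNLL_eq, groupNLL_eq, score_apply, ← mean_add, ← mean_const_mul, ← mean_add]
  refine mean_mono fun i _ => ?_
  have := softplus_lower hc (hz' i) (hz i)
  rw [map_sub]
  linarith

lemma groupNLL_upper (D : GroupData n d) (P : Fin n → ℝ) (z z' : Param d) :
    groupNLL D z.1 z.2 P ≤ groupNLL D z'.1 z'.2 P + score D P z' (z - z')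
      + mean Finset.univ (fun i => indexCLM D.X D.F P i (z - z') ^ 2) := by
  rw [groupNLL_eq, groupNLL_eq, score_apply, ← mean_add, ← mean_add]
  refine mean_mono fun i _ => ?_
  have := softplus_upper (indexCLM D.X D.F P i z') (indexCLM D.X D.F P i z)
  rw [map_sub]
  linarith

/-- The peer average as a continuous linear functional. -/
noncomputable def peerAvgCLM (F : Fin n → Fin n → Bool) (i : Fin n) : (Fin n → ℝ) →L[ℝ] ℝ :=
  ∑ j, peerWeight F i j • ContinuousLinearMap.proj j

lemma peerAvgCLM_apply (F : Fin n → Fin n → Bool) (i : Fin n) (P : Fin n → ℝ) :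
    peerAvgCLM F i P = peerAvg F P i := by
  simp [peerAvgCLM, peerAvg_eq]

/-- The average of the regression errors weighted with the peer averages of the derivative of the
choice probabilities: the sampling error of the score that is due to the dependence of the
equilibrium on the parameters. -/
noncomputable def peerNoise (D : GroupData n d) (z : Param d) : Param d →L[ℝ] ℝ :=
  (1 / (n : ℝ)) • ∑ i, (D.Y i - ccp D.X D.F z.1 z.2 i) •
    (peerAvgCLM D.F i).comp (ccpDeriv D.X D.F z)

lemma peerNoise_apply (D : GroupData n d) (z u : Param d) :
    peerNoise D z u = mean Finset.univ fun i =>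
      (D.Y i - ccp D.X D.F z.1 z.2 i) * peerAvg D.F (ccpDeriv D.X D.F z u) i := by
  simp [peerNoise, mean, peerAvgCLM_apply]

/-- The peer effect coordinate of a parameter. -/
noncomputable def peerCoord (d : ℕ) : Param d →L[ℝ] ℝ :=
  (EuclideanSpace.proj (0 : Fin (d + 1)) : Slope d →L[ℝ] ℝ).comp
    (ContinuousLinearMap.snd ℝ ℝ (Slope d))

lemma peerCoord_apply (z : Param d) : peerCoord d z = z.2 0 := by simp [peerCoord]

/-- The Jacobian of the score, computed from the derivative of the choice probabilities. -/
noncomputable def scoreDeriv (D : GroupData n d) (z : Param d) :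
    Param d →L[ℝ] (Param d →L[ℝ] ℝ) :=
  (1 / (n : ℝ)) • ∑ i, ((ContinuousLinearMap.proj i).comp (ccpDeriv D.X D.F z)).smulRight
    (indexCLM D.X D.F (ccp D.X D.F z.1 z.2) i) - (peerNoise D z).smulRight (peerCoord d)

lemma scoreDeriv_apply (D : GroupData n d) (z u w : Param d) :
    scoreDeriv D z u w = mean Finset.univ (fun i =>
      ccpDeriv D.X D.F z u i * indexCLM D.X D.F (ccp D.X D.F z.1 z.2) i w)
      - peerNoise D z u * w.2 0 := by
  simp [scoreDeriv, mean, peerCoord_apply]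

/-- The constant of the quadratic error in the linearization of the score. -/
noncomputable def scoreQuad (d : ℕ) (B r : ℝ) : ℝ :=
  ccpQuad d B r * (indexBound d B + 1) + 2 * ccpLip d B r ^ 2

section
variable {D : GroupData n d} {B r : ℝ} (hD : IsRegularData B D) (hr0 : 0 ≤ r) (hr : r < 1)
include hD hr

lemma abs_residual_le {z : Param d} (hz : |z.2 0| ≤ 4 * r) (i : Fin n) :
    |D.Y i - ccp D.X D.F z.1 z.2 i| ≤ 1 := by
  have h := hD.mem_Icc i
  rw [ccp_apply (abs_lt_four hr hz)]
  have h1 := Real.sigmoid_nonneg (indexCLM D.X D.F (ccp D.X D.F z.1 z.2) i z)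
  have h2 := Real.sigmoid_le_one (indexCLM D.X D.F (ccp D.X D.F z.1 z.2) i z)
  rw [abs_le]; constructor <;> linarith [h.1, h.2]

include hr0

lemma scoreQuad_pos : 0 < scoreQuad d B r := by
  have h1 := two_le_indexBound (d := d) hD.reg.one_le
  have h2 := two_le_ccpLip (d := d) hD.reg hr0 hr
  have h3 := ccpQuad_nonneg (d := d) (B := B) hr
  unfold scoreQuad; positivity

/-- Linearization of the score at the equilibrium choice probabilities, uniformly in the group: the
score is strictly differentiable at `z₀`, with a rate. -/
lemma norm_nplScore_sub_sub_le {z₀ z z' : Param d} {s : ℝ} (h₀ : |z₀.2 0| ≤ 4 * r)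
    (hz : |z.2 0| ≤ 4 * r) (hz' : |z'.2 0| ≤ 4 * r) (hs : ‖z - z₀‖ ≤ s) (hs' : ‖z' - z₀‖ ≤ s) :
    ‖nplScore D z - nplScore D z' - scoreDeriv D z₀ (z - z')‖
      ≤ scoreQuad d B r * s * ‖z - z'‖ := by
  have hs0 : 0 ≤ s := (norm_nonneg _).trans hs
  have hd0 := norm_nonneg (z - z')
  have hpos := scoreQuad_pos (d := d) hD hr0 hr
  refine ContinuousLinearMap.opNorm_le_bound _ (by positivity) fun w => ?_
  have hw := norm_nonneg w
  have h4 := abs_lt_four hr hz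
  have h4' := abs_lt_four hr hz'
  have hL := two_le_ccpLip (d := d) hD.reg hr0 hr
  have hQ := ccpQuad_nonneg (d := d) (B := B) hr
  have hB := two_le_indexBound (d := d) hD.reg.one_le
  have a1 := norm_ccp_sub_sub_le hD.reg hr0 hr h₀ hz hz' hs hs'
  have a2 := norm_ccpDeriv_le hD.reg hr0 hr h₀ (z - z')
  have a3 := norm_ccp_sub_le hD.reg hr0 hr hz h₀
  have a4 := norm_ccp_sub_le hD.reg hr0 hr hz' h₀
  have a5 := norm_ccp_sub_le hD.reg hr0 hr hz hz'
  have a6 := norm_ccp_le (X := D.X) (F := D.F) h4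
  have hY := abs_residual_le hD hr h₀
  rw [_root_.sub_apply, _root_.sub_apply, nplScore_apply D h4,
    nplScore_apply D h4', scoreDeriv_apply, peerNoise_apply, mul_comm (mean _ _) (w.2 0),
    ← mean_const_mul, ← mean_sub, ← mean_sub, ← mean_sub]
  set P := ccp D.X D.F z.1 z.2
  set P' := ccp D.X D.F z'.1 z'.2
  set P₀ := ccp D.X D.F z₀.1 z₀.2
  set v := ccpDeriv D.X D.F z₀ (z - z')
  set L := ccpLip d B r
  set Q := ccpQuad d B r
  refine abs_mean_le (fun i _ => ?_) (by positivity)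
  -- the four terms are products of two increments, except for the first and the last, which contain
  -- the remainder of the linearized choice probabilities
  have e : (P i - D.Y i) * indexCLM D.X D.F P i w - (P' i - D.Y i) * indexCLM D.X D.F P' i w
      - (v i * indexCLM D.X D.F P₀ i w - w.2 0 * ((D.Y i - P₀ i) * peerAvg D.F v i))
      = (P - P' - v) i * indexCLM D.X D.F P i w
        + v i * (w.2 0 * peerAvg D.F (P - P₀) i)
        + (P' - P₀) i * (w.2 0 * peerAvg D.F (P - P') i)
        - (D.Y i - P₀ i) * (w.2 0 * peerAvg D.F (P - P' - v) i) := by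
    have h1 := indexCLM_sub_ccp D.X D.F P P' i w
    have h2 := indexCLM_sub_ccp D.X D.F P P₀ i w
    simp only [Pi.sub_apply, peerAvg_sub] at h1 h2 ⊢
    linear_combination (P' i - D.Y i) * h1 + v i * h2
  rw [e]
  have hw0 := abs_snd_apply_le w 0
  have hmul : ∀ V : Fin n → ℝ, ∀ b, ‖V‖ ≤ b → |w.2 0 * peerAvg D.F V i| ≤ ‖w‖ * b := by
    intro V b hV
    rw [abs_mul]
    exact mul_le_mul hw0 ((abs_peerAvg_le_norm D.F V i).trans hV) (abs_nonneg _) hw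
  have b1 : |(P - P' - v) i * indexCLM D.X D.F P i w|
      ≤ (Q * s * ‖z - z'‖) * (indexBound d B * ‖w‖) := by
    rw [abs_mul]
    exact mul_le_mul ((abs_le_norm _ i).trans a1) (hD.reg.abs_indexCLM_le a6 i w) (abs_nonneg _)
      (by positivity)
  have b2 : |v i * (w.2 0 * peerAvg D.F (P - P₀) i)| ≤ (L * ‖z - z'‖) * (‖w‖ * (L * s)) := by
    rw [abs_mul]
    exact mul_le_mul ((abs_le_norm _ i).trans a2) (hmul _ _ (a3.trans (by gcongr)))
      (abs_nonneg _) (by positivity)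
  have b3 : |(P' - P₀) i * (w.2 0 * peerAvg D.F (P - P') i)|
      ≤ (L * s) * (‖w‖ * (L * ‖z - z'‖)) := by
    rw [abs_mul]
    exact mul_le_mul ((abs_le_norm _ i).trans (a4.trans (by gcongr))) (hmul _ _ a5)
      (abs_nonneg _) (by positivity)
  have b4 : |(D.Y i - P₀ i) * (w.2 0 * peerAvg D.F (P - P' - v) i)|
      ≤ 1 * (‖w‖ * (Q * s * ‖z - z'‖)) := by
    rw [abs_mul]
    exact mul_le_mul (hY i) (hmul _ _ a1) (abs_nonneg _) zero_le_one
  refine (abs_sub _ _).trans ((add_le_add ((abs_add_three _ _ _).trans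
    (add_le_add (add_le_add b1 b2) b3)) b4).trans (le_of_eq ?_))
  unfold scoreQuad; ring

lemma hasFDerivAt_nplScore {z₀ : Param d} {s₀ : ℝ} (hs₀ : 0 < s₀)
    (h₀ : ∀ z : Param d, ‖z - z₀‖ ≤ s₀ → |z.2 0| ≤ 4 * r) :
    HasFDerivAt (nplScore D) (scoreDeriv D z₀) z₀ := by
  have hpos := scoreQuad_pos (d := d) hD hr0 hr
  have h00 : |z₀.2 0| ≤ 4 * r := h₀ z₀ (by simpa using hs₀.le)
  refine .of_isLittleO (Asymptotics.isLittleO_iff.2 fun c hc => ?_)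
  have hmem : Metric.closedBall z₀ (min s₀ (c / scoreQuad d B r)) ∈ 𝓝 z₀ :=
    Metric.closedBall_mem_nhds _ (by positivity)
  filter_upwards [hmem] with z hz
  rw [Metric.mem_closedBall, dist_eq_norm, le_min_iff] at hz
  have := norm_nplScore_sub_sub_le hD hr0 hr h00 (h₀ z hz.1) h00 le_rfl
    (by simp : ‖z₀ - z₀‖ ≤ ‖z - z₀‖)
  refine this.trans (mul_le_mul_of_nonneg_right ?_ (norm_nonneg _))
  rw [mul_comm, ← le_div_iff₀ hpos]
  exact hz.2

/-- The Jacobian of the score, defined as a Fréchet derivative, is `scoreDeriv` and not a junk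
value: the equilibrium is differentiable at interior points of `|β̄| ≤ 4 r`. -/
lemma nplJacobian_eq {z₀ : Param d} {s₀ : ℝ} (hs₀ : 0 < s₀)
    (h₀ : ∀ z : Param d, ‖z - z₀‖ ≤ s₀ → |z.2 0| ≤ 4 * r) :
    nplJacobian D z₀ = scoreDeriv D z₀ :=
  (hasFDerivAt_nplScore hD hr0 hr hs₀ h₀).fderiv

end

end Score

section Likelihood
variable {n d : ℕ}

/-! ### Identification -/

/-- The diagonal entry of the Jacobian of the score that belongs to the fixed effect is bounded
away from zero: the response of the equilibrium to the fixed effect is the limit of iterates that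
stay nonnegative and, if the peer effect is negative, stay below `1 / 4`. -/
lemma le_scoreDeriv_fixedEffect {D : GroupData n d} {z : Param d} {r c : ℝ} (hn : 0 < n)
    (hr : r < 1) (hz : |z.2 0| ≤ 4 * r) (hc0 : 0 ≤ c) (hc : ∀ i, c ≤ slopeAt D.X D.F z i) :
    c * (1 - r) ≤ scoreDeriv D z (1, 0) (1, 0) := by
  have h4 := abs_lt_four hr hz
  have hone : ∀ i, indexCLM D.X D.F (ccp D.X D.F z.1 z.2) i ((1, 0) : Param d) = 1 := fun i => by
    rw [indexCLM_apply]; simp [index]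
  have hr0 : 0 ≤ r := by linarith [abs_nonneg (z.2 0)]
  -- a closed set, invariant under the iteration whose limit is the response to the fixed effect
  let S : Set (Fin n → ℝ) := {v | ∀ i, 0 ≤ v i ∧ (z.2 0 < 0 → v i ≤ 1 / 4)}
  have hbound : ∀ v ∈ S, ∀ i, 1 - r ≤ 1 + z.2 0 * peerAvg D.F v i ∧
      (z.2 0 < 0 → 1 + z.2 0 * peerAvg D.F v i ≤ 1) := by
    intro v hv i
    have h0 : 0 ≤ peerAvg D.F v i := by
      rw [peerAvg_eq]
      exact Finset.sum_nonneg fun j _ => mul_nonneg (peerWeight_nonneg _ _ _) (hv j).1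
    rcases lt_or_ge (z.2 0) 0 with hneg | hpos
    · have h1 : peerAvg D.F v i ≤ 1 / 4 :=
        (peerAvg_mono D.F (fun j => (hv j).2 hneg) i).trans (peerAvg_const_le D.F (by norm_num) i)
      have h2 : -(4 * r) ≤ z.2 0 := (abs_le.1 hz).1
      exact ⟨by nlinarith, fun _ => by nlinarith⟩
    · exact ⟨by nlinarith, fun h => absurd h (not_lt.2 hpos)⟩
  have hmaps : ∀ v ∈ S, linResponse D.X D.F z (1, 0) v ∈ S := by
    intro v hv i
    have h1 := hbound v hv i
    have h2 := slopeAt_pos (X := D.X) (F := D.F) z i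
    have h3 := slopeAt_le (X := D.X) (F := D.F) z i
    simp only [linResponse, hone]
    refine ⟨mul_nonneg h2.le (by linarith [h1.1]), fun hneg => ?_⟩
    have h4 := h1.2 hneg
    nlinarith [h1.1]
  have hclosed : IsClosed S := by
    have : S = ⋂ i, ({v | 0 ≤ v i} ∩ {v | z.2 0 < 0 → v i ≤ 1 / 4}) := by
      ext v; simp [S]
    rw [this]
    refine isClosed_iInter fun i => (isClosed_le continuous_const (continuous_apply i)).inter ?_
    by_cases h : z.2 0 < 0
    · simpa [h] using isClosed_le (continuous_apply i) continuous_const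
    · simp [h]
  have hiter : ∀ k, (linResponse D.X D.F z (1, 0))^[k] 0 ∈ S := by
    intro k
    induction k with
    | zero => intro i; simp
    | succ k ih => rw [Function.iterate_succ_apply']; exact hmaps _ ih
  have hmem : ccpDeriv D.X D.F z (1, 0) ∈ S :=
    hclosed.mem_of_tendsto (tendsto_iterate_ccpDeriv h4 _) (Eventually.of_forall hiter)
  have : Nonempty (Fin n) := ⟨⟨0, hn⟩⟩
  rw [scoreDeriv_apply, show ((1, 0) : Param d).2 0 = 0 from rfl, mul_zero, sub_zero,
    ← mean_const (s := (Finset.univ : Finset (Fin n))) (c := c * (1 - r)) Finset.univ_nonempty]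
  refine mean_mono fun i _ => ?_
  rw [hone, mul_one, ccpDeriv_apply h4, hone]
  exact mul_le_mul (hc i) (hbound _ hmem i).1 (by linarith) (hc0.trans (hc i))

/-- A mean-square bound for vectors `v` that are dominated by `a` plus a contraction, in the
supremum norm, of `v`. Peer averaging need not be a contraction in mean square, so that the
inequality is iterated finitely often, and what is then left of `v` is small in the supremum
norm. -/
lemma mean_sq_le_of_contraction {B r : ℝ} (hr0 : 0 ≤ r) (hr : r < 1) {ε : ℝ} (hε : 0 < ε) :
    ∃ C > 0, ∀ (n : ℕ) (X : Fin n → Fin d → ℝ) (F : Fin n → Fin n → Bool), IsRegular B X F →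
      ∀ v a : Fin n → ℝ, (∀ i, |v i| ≤ |a i| + r * peerAvg F (fun j => |v j|) i) →
        mean Finset.univ (fun i => v i ^ 2)
          ≤ C * mean Finset.univ (fun i => a i ^ 2) + ε * ‖v‖ ^ 2 := by
  have key : ∀ k : ℕ, ∃ C > 0, ∀ (n : ℕ) (X : Fin n → Fin d → ℝ) (F : Fin n → Fin n → Bool),
      IsRegular B X F → ∀ v a : Fin n → ℝ,
        (∀ i, |v i| ≤ |a i| + r * peerAvg F (fun j => |v j|) i) →
        ∃ t : Fin n → ℝ, (∀ i, |v i| ≤ t i + r ^ k * ‖v‖) ∧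
          mean Finset.univ (fun i => t i ^ 2) ≤ C * mean Finset.univ (fun i => a i ^ 2) := by
    intro k
    induction k with
    | zero =>
      refine ⟨1, one_pos, fun n X F _ v a _ => ⟨0, fun i => by simpa using abs_le_norm v i, ?_⟩⟩
      have h0 : mean Finset.univ (fun i => (0 : Fin n → ℝ) i ^ 2) = 0 := by simp [mean]
      rw [h0, one_mul]
      exact mean_nonneg fun i _ => sq_nonneg _
    | succ k ih =>
      obtain ⟨C, hC, h⟩ := ih
      refine ⟨2 + 2 * |B| * C, by positivity, fun n X F hF v a hva => ?_⟩
      obtain ⟨t, ht, htC⟩ := h n X F hF v a hva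
      refine ⟨fun i => |a i| + r * peerAvg F t i, fun i => ?_, ?_⟩
      · have h1 : peerAvg F (fun j => |v j|) i ≤ peerAvg F t i + r ^ k * ‖v‖ := by
          have h2 := peerAvg_mono F (Q := t + fun _ => r ^ k * ‖v‖) ht i
          rw [peerAvg_add] at h2
          have h3 := peerAvg_const_le F (by positivity : 0 ≤ r ^ k * ‖v‖) i
          linarith
        have h4 := mul_le_mul_of_nonneg_left h1 hr0
        have := hva i
        rw [pow_succ]
        nlinarith
      · have h1 : mean Finset.univ (fun i => (|a i| + r * peerAvg F t i) ^ 2)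
            ≤ mean Finset.univ (fun i => 2 * a i ^ 2 + 2 * peerAvg F t i ^ 2) := by
          refine mean_mono fun i _ => ?_
          have hr2 : r ^ 2 ≤ 1 := by nlinarith
          have h2 : (r * peerAvg F t i) ^ 2 ≤ peerAvg F t i ^ 2 := by
            rw [mul_pow]; exact mul_le_of_le_one_left (sq_nonneg _) hr2
          nlinarith [sq_nonneg (|a i| - r * peerAvg F t i), sq_abs (a i)]
        rw [mean_add, mean_const_mul, mean_const_mul] at h1
        have h2 := hF.mean_peerAvg_sq_le t
        have h3 : B * mean Finset.univ (fun i => t i ^ 2)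
            ≤ |B| * (C * mean Finset.univ (fun i => a i ^ 2)) :=
          mul_le_mul (le_abs_self B) htC (mean_nonneg fun i _ => sq_nonneg _) (abs_nonneg _)
        linarith
  obtain ⟨k, hk⟩ := exists_pow_lt_of_lt_one (show 0 < min 1 (ε / 2) by positivity) hr
  obtain ⟨C, hC, h⟩ := key k
  refine ⟨2 * C, by positivity, fun n X F hF v a hva => ?_⟩
  obtain ⟨t, ht, htC⟩ := h n X F hF v a hva
  have hk0 : 0 ≤ r ^ k := by positivity
  have hk2 : (r ^ k) ^ 2 ≤ ε / 2 := by
    have := min_le_left 1 (ε / 2)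
    have := min_le_right 1 (ε / 2)
    nlinarith
  have h1 : mean Finset.univ (fun i => v i ^ 2)
      ≤ mean Finset.univ (fun i => 2 * t i ^ 2 + 2 * (r ^ k * ‖v‖) ^ 2) := by
    refine mean_mono fun i _ => ?_
    have h2 : v i ^ 2 ≤ (t i + r ^ k * ‖v‖) ^ 2 := by
      rw [← sq_abs]; exact pow_le_pow_left₀ (abs_nonneg _) (ht i) 2
    nlinarith [sq_nonneg (t i - r ^ k * ‖v‖)]
  rw [mean_add, mean_const_mul] at h1
  have h2 := mean_const_le (s := (Finset.univ : Finset (Fin n)))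
    (by positivity : 0 ≤ 2 * (r ^ k * ‖v‖) ^ 2)
  have h3 : 2 * (r ^ k * ‖v‖) ^ 2 ≤ ε * ‖v‖ ^ 2 := by
    rw [mul_pow]
    nlinarith [mul_le_mul_of_nonneg_right hk2 (sq_nonneg ‖v‖)]
  linarith

/-- Invertibility of the Jacobian of the score makes the indices at the true choice probabilities
a nondegenerate design. -/
lemma exists_design_lower (d : ℕ) {B r η : ℝ} (hB : 1 ≤ B) (hr0 : 0 ≤ r) (hr : r < 1)
    (hη : 0 < η) :
    ∃ c > 0, ∀ (n : ℕ) (D : GroupData n d) (z : Param d), IsRegularData B D → |z.2 0| ≤ 4 * r →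
      ‖peerNoise D z‖ ≤ η / 2 → (∀ u, η * ‖u‖ ≤ ‖scoreDeriv D z u‖) →
      ∀ u, c * ‖u‖ ^ 2
        ≤ mean Finset.univ (fun i => indexCLM D.X D.F (ccp D.X D.F z.1 z.2) i u ^ 2) := by
  have hb := two_le_indexBound (d := d) hB
  set b := indexBound d B
  set L := ccpLip d B r
  have hL : 0 < L := div_pos (by linarith) (by linarith)
  obtain ⟨C, hC, h⟩ := mean_sq_le_of_contraction (d := d) (B := B) hr0 hr
    (ε := (η / 2) ^ 2 / (2 * b ^ 2 * L ^ 2)) (by positivity)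
  refine ⟨(η / 2) ^ 2 / (2 * b ^ 2 * C), by positivity, fun n D z hD hz hT hM u => ?_⟩
  have h4 := abs_lt_four hr hz
  set v := ccpDeriv D.X D.F z u with hv
  set a : Fin n → ℝ := fun i => indexCLM D.X D.F (ccp D.X D.F z.1 z.2) i u with ha
  have h1 := h n D.X D.F hD.reg v a fun i => by
    have hs := slopeAt_pos (X := D.X) (F := D.F) z i
    have hs' := slopeAt_le (X := D.X) (F := D.F) z i
    rw [hv, ccpDeriv_apply h4, ← hv, abs_mul, abs_of_pos hs]
    change _ * |a i + _| ≤ _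
    have e1 := abs_add_le (a i) (z.2 0 * peerAvg D.F v i)
    have e2 : |z.2 0 * peerAvg D.F v i| ≤ 4 * r * peerAvg D.F (fun j => |v j|) i := by
      rw [abs_mul]
      exact mul_le_mul hz (abs_peerAvg_le_peerAvg D.F v i) (abs_nonneg _) (by linarith)
    have e3 := mul_le_mul hs' (e1.trans (add_le_add le_rfl e2)) (abs_nonneg _) (by norm_num)
    nlinarith [abs_nonneg (a i)]
  have hvL : ‖v‖ ^ 2 ≤ L ^ 2 * ‖u‖ ^ 2 := by
    rw [← mul_pow]
    exact pow_le_pow_left₀ (norm_nonneg _) (norm_ccpDeriv_le hD.reg hr0 hr hz u) 2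
  have hnu := norm_nonneg u
  have hm0 : 0 ≤ mean Finset.univ (fun i => |v i|) := mean_nonneg fun i _ => abs_nonneg _
  have h2 : ‖scoreDeriv D z u‖ ≤ b * mean Finset.univ (fun i => |v i|) + η / 2 * ‖u‖ := by
    refine ContinuousLinearMap.opNorm_le_bound _ (by positivity) fun w => ?_
    rw [scoreDeriv_apply, Real.norm_eq_abs, add_mul]
    refine (abs_sub _ _).trans (add_le_add ?_ ?_)
    · refine abs_mean_le_mean.trans ?_
      rw [mul_assoc, mul_comm _ ‖w‖, ← mul_assoc, ← mean_const_mul]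
      refine mean_mono fun i _ => ?_
      rw [abs_mul, mul_comm]
      exact mul_le_mul_of_nonneg_right (hD.reg.abs_indexCLM_le (norm_ccp_le h4) i w)
        (abs_nonneg _)
    · rw [abs_mul]
      exact mul_le_mul (((peerNoise D z).le_opNorm u).trans (by gcongr)) (abs_snd_apply_le w 0)
        (abs_nonneg _) (by positivity)
  have h3 : η / 2 * ‖u‖ ≤ b * mean Finset.univ (fun i => |v i|) := by linarith [hM u]
  have h5 : (η / 2) ^ 2 * ‖u‖ ^ 2 ≤ b ^ 2 * mean Finset.univ (fun i => v i ^ 2) := by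
    have e1 := pow_le_pow_left₀ (by positivity) h3 2
    have e2 := mean_sq_le (s := Finset.univ) (f := fun i => |v i|)
    simp only [sq_abs] at e2
    rw [mul_pow, mul_pow] at e1
    exact e1.trans (mul_le_mul_of_nonneg_left e2 (sq_nonneg _))
  have hb0 : 0 < b ^ 2 := by positivity
  have h6 : b ^ 2 * mean Finset.univ (fun i => v i ^ 2) ≤
      b ^ 2 * C * mean Finset.univ (fun i => a i ^ 2) + (η / 2) ^ 2 / 2 * ‖u‖ ^ 2 := by
    have e1 := mul_le_mul_of_nonneg_left h1 hb0.le
    have e2 : b ^ 2 * ((η / 2) ^ 2 / (2 * b ^ 2 * L ^ 2) * ‖v‖ ^ 2)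
        ≤ b ^ 2 * ((η / 2) ^ 2 / (2 * b ^ 2 * L ^ 2) * (L ^ 2 * ‖u‖ ^ 2)) := by gcongr
    have e3 : b ^ 2 * ((η / 2) ^ 2 / (2 * b ^ 2 * L ^ 2) * (L ^ 2 * ‖u‖ ^ 2))
        = (η / 2) ^ 2 / 2 * ‖u‖ ^ 2 := by field_simp
    linarith
  rw [div_mul_eq_mul_div, div_le_iff₀ (by positivity)]
  linarith

/-- Constants that hold for all groups: `B` bounds covariates and influence, `4 * r` bounds the peer
effect, `R` bounds the parameters, and `s` is the radius of a ball of parameters around the truth.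
The curvature `c₀` of the likelihood in the index is positive because the indices are bounded; the
design constant `c₁` comes from the invertibility of the Jacobian of the score. -/
structure Bounds (d : ℕ) where
  B : ℝ
  r : ℝ
  R : ℝ
  s : ℝ
  c₀ : ℝ
  c₁ : ℝ
  one_le_B : 1 ≤ B
  r_nonneg : 0 ≤ r
  r_lt_one : r < 1
  R_nonneg : 0 ≤ R
  s_pos : 0 < s
  c₀_pos : 0 < c₀
  c₁_pos : 0 < c₁
  le_sigmoidDeriv : ∀ x, |x| ≤ indexBound d B * R → c₀ ≤ sigmoidDeriv x

/-- The parameters at which the bounds apply. -/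
structure Bounds.Admissible (b : Bounds d) (z : Param d) : Prop where
  peer : |z.2 0| ≤ 4 * b.r
  norm : ‖z‖ ≤ b.R

/-- The data of a group are regular, the parameter `z₀` is an interior point of the admissible
ones, and the design at `z₀` is nondegenerate. -/
structure Bounds.Good (b : Bounds d) (D : GroupData n d) (z₀ : Param d) : Prop where
  n_pos : 0 < n
  data : IsRegularData b.B D
  ball : ∀ z : Param d, ‖z - z₀‖ ≤ b.s → b.Admissible z
  design : ∀ u, b.c₁ * ‖u‖ ^ 2
    ≤ mean Finset.univ (fun i => indexCLM D.X D.F (ccp D.X D.F z₀.1 z₀.2) i u ^ 2)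

/-- The size of the sampling errors of a group at the true parameter. -/
noncomputable def noise (D : GroupData n d) (z₀ : Param d) : ℝ :=
  ‖nplScore D z₀‖ + ‖peerNoise D z₀‖

/-- The sampling error in the linearization of the choice probabilities. -/
noncomputable def noiseRem (D : GroupData n d) (z₀ z : Param d) : ℝ :=
  mean Finset.univ fun i => (D.Y i - ccp D.X D.F z₀.1 z₀.2 i) *
    peerAvg D.F (ccp D.X D.F z.1 z.2 - ccp D.X D.F z₀.1 z₀.2 - ccpDeriv D.X D.F z₀ (z - z₀)) i

/-- The negative log-likelihood at the equilibrium choice probabilities. -/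
noncomputable def eqNLL (D : GroupData n d) (z : Param d) : ℝ :=
  groupNLL D z.1 z.2 (ccp D.X D.F z.1 z.2)

lemma noise_nonneg (D : GroupData n d) (z₀ : Param d) : 0 ≤ noise D z₀ := by
  unfold noise; positivity

section Good
variable {b : Bounds d} {D : GroupData n d} {z₀ : Param d}

lemma Bounds.Admissible.lt_four {z : Param d} (hz : b.Admissible z) : |z.2 0| < 4 :=
  abs_lt_four b.r_lt_one hz.peer

lemma Bounds.indexBound_ge : 2 ≤ indexBound d b.B := two_le_indexBound b.one_le_B

lemma Bounds.ccpLip_ge : 2 ≤ ccpLip d b.B b.r := by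
  unfold ccpLip
  rw [le_div_iff₀ (by linarith [b.r_lt_one])]
  linarith [b.indexBound_ge, b.r_nonneg]

variable (h : b.Good D z₀)
include h

lemma Bounds.Good.adm : b.Admissible z₀ := h.ball z₀ (by simpa using b.s_pos.le)

lemma Bounds.Good.abs_index_le {P : Fin n → ℝ} (hP : ‖P‖ ≤ 1) {z : Param d}
    (hz : b.Admissible z) (i : Fin n) : |indexCLM D.X D.F P i z| ≤ indexBound d b.B * b.R :=
  (h.data.reg.abs_indexCLM_le hP i z).trans
    (mul_le_mul_of_nonneg_left hz.norm (by linarith [b.indexBound_ge]))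

/-- The equilibrium indices identify the parameter. -/
lemma Bounds.Good.identification {z : Param d} (hz : b.Admissible z) :
    b.c₁ / (2 + 2 * b.B) * ‖z - z₀‖ ^ 2 ≤ mean Finset.univ (fun i =>
      (indexCLM D.X D.F (ccp D.X D.F z.1 z.2) i z
        - indexCLM D.X D.F (ccp D.X D.F z₀.1 z₀.2) i z₀) ^ 2) := by
  have hB := b.one_le_B
  set P := ccp D.X D.F z.1 z.2 with hP
  set P₀ := ccp D.X D.F z₀.1 z₀.2 with hP₀
  have h1 := h.design (z - z₀)
  have h2 : mean Finset.univ (fun i => indexCLM D.X D.F P₀ i (z - z₀) ^ 2) ≤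
      mean Finset.univ (fun i =>
        2 * (indexCLM D.X D.F P i z - indexCLM D.X D.F P₀ i z₀) ^ 2
          + 32 * peerAvg D.F (P - P₀) i ^ 2) := by
    refine mean_mono fun i _ => ?_
    have e := indexCLM_sub_ccp D.X D.F P P₀ i z
    have e1 : indexCLM D.X D.F P₀ i (z - z₀)
        = (indexCLM D.X D.F P i z - indexCLM D.X D.F P₀ i z₀)
          - z.2 0 * peerAvg D.F (P - P₀) i := by rw [map_sub]; linarith
    have e2 : (z.2 0 * peerAvg D.F (P - P₀) i) ^ 2 ≤ 16 * peerAvg D.F (P - P₀) i ^ 2 := by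
      rw [mul_pow]
      refine mul_le_mul_of_nonneg_right ?_ (sq_nonneg _)
      have := hz.lt_four
      rw [← sq_abs]
      nlinarith [abs_nonneg (z.2 0)]
    rw [e1]
    nlinarith [sq_nonneg ((indexCLM D.X D.F P i z - indexCLM D.X D.F P₀ i z₀)
      + z.2 0 * peerAvg D.F (P - P₀) i)]
  have h3 := h.data.reg.mean_peerAvg_sq_le (P - P₀)
  have h4 : mean Finset.univ (fun i => (P - P₀) i ^ 2) ≤ mean Finset.univ (fun i =>
      1 / 16 * (indexCLM D.X D.F P i z - indexCLM D.X D.F P₀ i z₀) ^ 2) := by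
    refine mean_mono fun i _ => ?_
    have e1 := abs_sigmoid_sub_le (indexCLM D.X D.F P₀ i z₀) (indexCLM D.X D.F P i z)
    rw [← ccp_apply hz.lt_four, ← ccp_apply h.adm.lt_four] at e1
    have e2 := pow_le_pow_left₀ (abs_nonneg _) e1 2
    rw [mul_pow, sq_abs, sq_abs] at e2
    rw [Pi.sub_apply]
    linarith
  rw [mean_add, mean_const_mul, mean_const_mul] at h2
  rw [mean_const_mul] at h4
  rw [div_mul_eq_mul_div, div_le_iff₀ (by linarith)]
  have h5 := mul_le_mul_of_nonneg_left h4 (by linarith : 0 ≤ b.B)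
  linarith

/-- The part of the likelihood that is linear in the residuals, in terms of the score, of
`peerNoise` and of a remainder of second order in `z - z₀`. -/
lemma Bounds.Good.mean_residual_mul (z : Param d) :
    mean Finset.univ (fun i => (D.Y i - ccp D.X D.F z₀.1 z₀.2 i) *
      (indexCLM D.X D.F (ccp D.X D.F z.1 z.2) i z
        - indexCLM D.X D.F (ccp D.X D.F z₀.1 z₀.2) i z₀))
      = -nplScore D z₀ (z - z₀)
        + z.2 0 * (peerNoise D z₀ (z - z₀) + noiseRem D z₀ z) := by
  rw [nplScore_apply D h.adm.lt_four, peerNoise_apply, noiseRem, ← mean_add, ← mean_const_mul,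
    neg_eq_neg_one_mul, ← mean_const_mul, ← mean_add]
  refine mean_congr fun i _ => ?_
  have e := indexCLM_sub_ccp D.X D.F (ccp D.X D.F z.1 z.2) (ccp D.X D.F z₀.1 z₀.2) i z
  rw [peerAvg_sub] at e
  rw [peerAvg_sub, peerAvg_sub, map_sub]
  linear_combination (D.Y i - ccp D.X D.F z₀.1 z₀.2 i) * e

/-- The likelihood relative to the truth: a Bregman divergence of `softplus`, whose mean is the
deterministic part, and the sampling error. -/
lemma Bounds.Good.eqNLL_sub (z : Param d) :
    eqNLL D z - eqNLL D z₀ = mean Finset.univ (fun i =>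
      softplus (indexCLM D.X D.F (ccp D.X D.F z.1 z.2) i z)
        - softplus (indexCLM D.X D.F (ccp D.X D.F z₀.1 z₀.2) i z₀)
        - Real.sigmoid (indexCLM D.X D.F (ccp D.X D.F z₀.1 z₀.2) i z₀) *
          (indexCLM D.X D.F (ccp D.X D.F z.1 z.2) i z
            - indexCLM D.X D.F (ccp D.X D.F z₀.1 z₀.2) i z₀))
      + nplScore D z₀ (z - z₀) - z.2 0 * (peerNoise D z₀ (z - z₀) + noiseRem D z₀ z) := by
  have e := h.mean_residual_mul z
  have e2 : ∀ A x y : ℝ, A + x - y = A - (-x + y) := fun A x y => by ring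
  rw [e2, ← e, ← mean_sub, eqNLL, eqNLL, groupNLL_eq, groupNLL_eq, ← mean_sub]
  refine mean_congr fun i _ => ?_
  rw [← ccp_apply h.adm.lt_four]
  ring

omit h in
lemma abs_linear_noise_le {z : Param d} (hz : b.Admissible z) :
    |nplScore D z₀ (z - z₀) - z.2 0 * (peerNoise D z₀ (z - z₀) + noiseRem D z₀ z)|
      ≤ 4 * noise D z₀ * ‖z - z₀‖ + 4 * |noiseRem D z₀ z| := by
  have h1 : |nplScore D z₀ (z - z₀)| ≤ _ := (nplScore D z₀).le_opNorm (z - z₀)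
  have h2 : |peerNoise D z₀ (z - z₀)| ≤ _ := (peerNoise D z₀).le_opNorm (z - z₀)
  have h3 := mul_le_mul hz.lt_four.le (abs_add_le (peerNoise D z₀ (z - z₀)) (noiseRem D z₀ z))
    (abs_nonneg _) (by norm_num)
  rw [← abs_mul] at h3
  have h4 := abs_sub (nplScore D z₀ (z - z₀))
    (z.2 0 * (peerNoise D z₀ (z - z₀) + noiseRem D z₀ z))
  have h5 := norm_nonneg (z - z₀)
  have h6 : 0 ≤ ‖nplScore D z₀‖ * ‖z - z₀‖ := by positivity
  unfold noise
  linarith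

/-- A constant in the lower bound for the likelihood. -/
noncomputable def _root_.PeerEffects.Bounds.lowerConst (b : Bounds d) : ℝ :=
  b.c₀ * (b.c₁ / (2 + 2 * b.B)) / 8

omit h in
lemma Bounds.lowerConst_pos : 0 < b.lowerConst := by
  have := b.c₀_pos
  have := b.c₁_pos
  have := b.one_le_B
  unfold Bounds.lowerConst; positivity

/-- The likelihood at any admissible parameter exceeds the likelihood at the truth by a multiple of
the squared distance, up to the squared sampling error at the truth. -/
lemma Bounds.Good.eqNLL_lower {z : Param d} (hz : b.Admissible z) {κ : ℝ}
    (hrem : |noiseRem D z₀ z| ≤ b.lowerConst / 4 * ‖z - z₀‖ ^ 2 + κ) :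
    b.lowerConst * ‖z - z₀‖ ^ 2 - 4 / b.lowerConst * noise D z₀ ^ 2 - 4 * κ
      ≤ eqNLL D z - eqNLL D z₀ := by
  have hc := b.lowerConst_pos
  rw [h.eqNLL_sub z]
  have h1 : b.c₀ / 2 * mean Finset.univ (fun i =>
      (indexCLM D.X D.F (ccp D.X D.F z.1 z.2) i z
        - indexCLM D.X D.F (ccp D.X D.F z₀.1 z₀.2) i z₀) ^ 2)
      ≤ mean Finset.univ (fun i =>
      softplus (indexCLM D.X D.F (ccp D.X D.F z.1 z.2) i z)
        - softplus (indexCLM D.X D.F (ccp D.X D.F z₀.1 z₀.2) i z₀)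
        - Real.sigmoid (indexCLM D.X D.F (ccp D.X D.F z₀.1 z₀.2) i z₀) *
          (indexCLM D.X D.F (ccp D.X D.F z.1 z.2) i z
            - indexCLM D.X D.F (ccp D.X D.F z₀.1 z₀.2) i z₀)) := by
    rw [← mean_const_mul]
    exact mean_mono fun i _ => softplus_lower b.le_sigmoidDeriv
      (h.abs_index_le (norm_ccp_le h.adm.lt_four) h.adm i)
      (h.abs_index_le (norm_ccp_le hz.lt_four) hz i)
  have h2 := mul_le_mul_of_nonneg_left (h.identification hz) (by linarith [b.c₀_pos] : 0 ≤ b.c₀ / 2)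
  have h3 : b.c₀ / 2 * (b.c₁ / (2 + 2 * b.B) * ‖z - z₀‖ ^ 2)
      = 4 * b.lowerConst * ‖z - z₀‖ ^ 2 := by unfold Bounds.lowerConst; ring
  have h4 := (abs_le.1 (abs_linear_noise_le (D := D) (z₀ := z₀) hz)).1
  -- the linear sampling error is absorbed into the quadratic term
  have h5 : 4 * noise D z₀ * ‖z - z₀‖
      ≤ b.lowerConst * ‖z - z₀‖ ^ 2 + 4 / b.lowerConst * noise D z₀ ^ 2 := by
    have e : b.lowerConst * ‖z - z₀‖ ^ 2 + 4 / b.lowerConst * noise D z₀ ^ 2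
        - 4 * noise D z₀ * ‖z - z₀‖
        = (b.lowerConst * ‖z - z₀‖ - 2 * noise D z₀) ^ 2 / b.lowerConst := by
      field_simp; ring
    have : 0 ≤ (b.lowerConst * ‖z - z₀‖ - 2 * noise D z₀) ^ 2 / b.lowerConst := by positivity
    linarith
  linarith [sq_nonneg ‖z - z₀‖, mul_nonneg hc.le (sq_nonneg ‖z - z₀‖)]

/-- A crude bound that ignores the averaging over the residuals. It suffices for upper bounds of the
likelihood; for lower bounds the remainder has to be small compared with `lowerConst`. -/
lemma Bounds.Good.abs_noiseRem_le {z : Param d} (hz : b.Admissible z) :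
    |noiseRem D z₀ z| ≤ ccpQuad d b.B b.r * ‖z - z₀‖ ^ 2 := by
  have hq := ccpQuad_nonneg (d := d) (B := b.B) b.r_lt_one
  refine abs_mean_le (fun i _ => ?_) (by positivity)
  have h1 := norm_ccp_sub_sub_le h.data.reg b.r_nonneg b.r_lt_one h.adm.peer hz.peer h.adm.peer
    le_rfl (by simp : ‖z₀ - z₀‖ ≤ ‖z - z₀‖)
  rw [abs_mul]
  have h2 := mul_le_mul (abs_residual_le h.data b.r_lt_one h.adm.peer i)
    ((abs_peerAvg_le_norm D.F _ i).trans h1) (abs_nonneg _) zero_le_one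
  rw [one_mul, mul_assoc, ← sq] at h2
  exact h2

/-- A constant in the upper bound for the likelihood. -/
noncomputable def _root_.PeerEffects.Bounds.upperConst (b : Bounds d) : ℝ :=
  ccpLip d b.B b.r ^ 2 + 4 * ccpQuad d b.B b.r + 4

/-- The likelihood near the truth exceeds the likelihood at the truth by at most a multiple of the
squared distance and of the squared sampling error. -/
lemma Bounds.Good.eqNLL_upper {z : Param d} (hz : b.Admissible z) :
    eqNLL D z - eqNLL D z₀ ≤ b.upperConst * ‖z - z₀‖ ^ 2 + noise D z₀ ^ 2 := by
  rw [h.eqNLL_sub z]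
  have hL := b.ccpLip_ge
  have h1 : mean Finset.univ (fun i =>
      softplus (indexCLM D.X D.F (ccp D.X D.F z.1 z.2) i z)
        - softplus (indexCLM D.X D.F (ccp D.X D.F z₀.1 z₀.2) i z₀)
        - Real.sigmoid (indexCLM D.X D.F (ccp D.X D.F z₀.1 z₀.2) i z₀) *
          (indexCLM D.X D.F (ccp D.X D.F z.1 z.2) i z
            - indexCLM D.X D.F (ccp D.X D.F z₀.1 z₀.2) i z₀))
      ≤ (ccpLip d b.B b.r * ‖z - z₀‖) ^ 2 := by
    refine mean_le (fun i _ => (softplus_upper _ _).trans ?_) (by positivity)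
    rw [← sq_abs]
    exact pow_le_pow_left₀ (abs_nonneg _) (abs_index_sub_le h.data.reg b.r_nonneg b.r_lt_one
      hz.peer h.adm.peer i) 2
  have h2 := (abs_le.1 (abs_linear_noise_le (D := D) (z₀ := z₀) hz)).2
  have h3 := h.abs_noiseRem_le hz
  unfold Bounds.upperConst
  nlinarith [sq_nonneg (noise D z₀ - 2 * ‖z - z₀‖)]

end Good

end Likelihood

/-! ### Zeros of pooled score equations with incidental parameters -/

section PooledZero
variable {ι V : Type*} [Fintype ι] [NormedAddCommGroup V] [NormedSpace ℝ V]

/-- The linear estimate behind the concentrated Jacobian: solving the equations of the fixed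
effects and substituting the solutions into the average equation bounds every increment
`(a g, u)` by the size of its own equation and the average size of all equations. -/
lemma norm_le_of_concentrated {M : ι → ℝ × V →L[ℝ] (ℝ × V →L[ℝ] ℝ)} {m K η : ℝ} (hm : 0 < m)
    (hK : 0 ≤ K) (hη : 0 < η) (hMm : ∀ g, m ≤ M g (1, 0) (1, 0)) (hMK : ∀ g, ‖M g‖ ≤ K)
    (hconc : ∀ u : V, ∃ w : V, ‖w‖ ≤ 1 ∧ η * ‖u‖ ≤ mean Finset.univ fun g =>
      M g (0, u) (0, w) - M g (1, 0) (0, w) * ((M g (1, 0) (1, 0))⁻¹ * M g (0, u) (1, 0)))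
    (a : ι → ℝ) (u : V) (y : ι → ℝ) (hy : ∀ g, |M g (a g, u) (1, 0)| ≤ y g)
    (hw : ∀ w : V, ‖w‖ ≤ 1 → mean Finset.univ (fun g => M g (a g, u) (0, w)) ≤ mean Finset.univ y)
    (g : ι) :
    ‖(a g, u)‖ ≤ m⁻¹ * y g + (K / m + 1) * (η⁻¹ * (1 + K / m)) * mean Finset.univ y := by
  have hsplit : ∀ g, M g (a g, u) = a g • M g (1, 0) + M g (0, u) := fun g => by
    rw [← map_smul, ← map_add]; congr 1; ext <;> simp
  have hy0 : ∀ g, 0 ≤ y g := fun g => (abs_nonneg _).trans (hy g)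
  have hα : ∀ g, 0 < M g (1, 0) (1, 0) := fun g => hm.trans_le (hMm g)
  have hu : ‖u‖ ≤ η⁻¹ * (1 + K / m) * mean Finset.univ y := by
    obtain ⟨w, hw1, hwη⟩ := hconc u
    have h1 : mean Finset.univ (fun g => M g (0, u) (0, w)
        - M g (1, 0) (0, w) * ((M g (1, 0) (1, 0))⁻¹ * M g (0, u) (1, 0)))
        ≤ mean Finset.univ (fun g => M g (a g, u) (0, w) + K / m * y g) := by
      refine mean_mono fun g _ => ?_
      have e1 : M g (a g, u) (1, 0) = a g * M g (1, 0) (1, 0) + M g (0, u) (1, 0) := by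
        rw [hsplit]; simp
      have e2 : M g (a g, u) (0, w) = a g * M g (1, 0) (0, w) + M g (0, u) (0, w) := by
        rw [hsplit]; simp
      have e3 : M g (0, u) (0, w)
          - M g (1, 0) (0, w) * ((M g (1, 0) (1, 0))⁻¹ * M g (0, u) (1, 0))
          = M g (a g, u) (0, w)
            - M g (1, 0) (0, w) * ((M g (1, 0) (1, 0))⁻¹ * M g (a g, u) (1, 0)) := by
        rw [e1, e2]
        have := (hα g).ne'
        field_simp
        ring
      have e4 : |M g (1, 0) (0, w)| ≤ K := by
        have h2 := (M g).le_opNorm₂ (1, 0) (0, w)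
        have h3 : ‖((1 : ℝ), (0 : V))‖ = 1 := by simp [Prod.norm_def]
        have h4 : ‖((0 : ℝ), w)‖ ≤ 1 := by simpa [Prod.norm_def] using hw1
        rw [h3, mul_one, Real.norm_eq_abs] at h2
        exact h2.trans ((mul_le_of_le_one_right (norm_nonneg (M g)) h4).trans (hMK g))
      have e5 : |M g (1, 0) (0, w) * ((M g (1, 0) (1, 0))⁻¹ * M g (a g, u) (1, 0))|
          ≤ K * (m⁻¹ * y g) := by
        rw [abs_mul, abs_mul, abs_of_pos (inv_pos.2 (hα g))]
        exact mul_le_mul e4 (mul_le_mul (inv_anti₀ hm (hMm g)) (hy g) (abs_nonneg _)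
          (inv_pos.2 hm).le) (mul_nonneg (inv_pos.2 (hα g)).le (abs_nonneg _)) hK
      rw [e3, div_mul_eq_mul_div, mul_div_assoc, div_eq_inv_mul]
      linarith [(abs_le.1 e5).1]
    rw [mean_add, mean_const_mul] at h1
    have h2 := hw w hw1
    rw [mul_assoc, ← div_eq_inv_mul, le_div_iff₀ hη]
    linarith
  have ha : |a g| ≤ m⁻¹ * y g + K / m * ‖u‖ := by
    have e1 : a g * M g (1, 0) (1, 0) = M g (a g, u) (1, 0) - M g (0, u) (1, 0) := by
      rw [hsplit]; simp
    have e2 : |M g (0, u) (1, 0)| ≤ K * ‖u‖ := by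
      have h2 := (M g).le_opNorm₂ (0, u) (1, 0)
      have h3 : ‖((1 : ℝ), (0 : V))‖ = 1 := by simp [Prod.norm_def]
      have h4 : ‖((0 : ℝ), u)‖ = ‖u‖ := by simp [Prod.norm_def]
      rw [h3, h4, mul_one] at h2
      exact h2.trans (mul_le_mul_of_nonneg_right (hMK g) (norm_nonneg _))
    have e3 : |a g| * m ≤ y g + K * ‖u‖ := by
      calc |a g| * m ≤ |a g| * M g (1, 0) (1, 0) :=
            mul_le_mul_of_nonneg_left (hMm g) (abs_nonneg _)
        _ = |M g (a g, u) (1, 0) - M g (0, u) (1, 0)| := by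
            rw [← e1, abs_mul, abs_of_pos (hα g)]
        _ ≤ _ := (abs_sub _ _).trans (add_le_add (hy g) e2)
    rw [← le_div_iff₀ hm] at e3
    refine e3.trans (le_of_eq ?_)
    field_simp
  have h0 : ‖(a g, u)‖ ≤ |a g| + ‖u‖ := by
    rw [Prod.norm_def]
    exact max_le (by simp) (by simp)
  have h1 := mul_le_mul_of_nonneg_left hu (by positivity : 0 ≤ K / m + 1)
  linarith

/-- The evaluation of a family of functionals that defines the pooled score equations: the
derivatives with respect to the fixed effects, and the average derivative with respect to the
common slope. -/
noncomputable def poolEquations (ι V : Type*) [Fintype ι] [NormedAddCommGroup V]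
    [NormedSpace ℝ V] : (ι → ℝ × V →L[ℝ] ℝ) →L[ℝ] (ι → ℝ) × (V →L[ℝ] ℝ) :=
  (ContinuousLinearMap.pi fun g => (ContinuousLinearMap.apply ℝ ℝ ((1, 0) : ℝ × V)).comp
      (ContinuousLinearMap.proj g)).prod
    ((1 / (Fintype.card ι : ℝ)) • ∑ g, (ContinuousLinearMap.precomp ℝ
      (ContinuousLinearMap.inr ℝ ℝ V)).comp (ContinuousLinearMap.proj g))

lemma poolEquations_fst (l : ι → ℝ × V →L[ℝ] ℝ) (g : ι) :
    (poolEquations ι V l).1 g = l g (1, 0) := by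
  simp [poolEquations]

lemma poolEquations_snd (l : ι → ℝ × V →L[ℝ] ℝ) (w : V) :
    (poolEquations ι V l).2 w = mean Finset.univ fun g => l g (0, w) := by
  simp [poolEquations, mean, Finset.card_univ]

lemma norm_poolEquations_le {l : ι → ℝ × V →L[ℝ] ℝ} {c : ℝ} (hc : 0 ≤ c) (hl : ∀ g, ‖l g‖ ≤ c) :
    ‖poolEquations ι V l‖ ≤ c := by
  rw [Prod.norm_def]
  refine max_le ((pi_norm_le_iff_of_nonneg hc).2 fun g => ?_)
    (ContinuousLinearMap.opNorm_le_bound _ hc fun w => ?_)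
  · rw [poolEquations_fst]
    have h3 : ‖((1 : ℝ), (0 : V))‖ = 1 := by simp [Prod.norm_def]
    have := (l g).le_opNorm (1, 0)
    rw [h3, mul_one] at this
    exact this.trans (hl g)
  · rw [poolEquations_snd]
    refine abs_mean_le (fun g _ => ?_) (by positivity)
    have h4 : ‖((0 : ℝ), w)‖ = ‖w‖ := by simp [Prod.norm_def]
    have := (l g).le_opNorm (0, w)
    rw [h4] at this
    exact this.trans (mul_le_mul_of_nonneg_right (hl g) (norm_nonneg _))

/-- The parameter of group `g` in the pooled parameter, which consists of the fixed effects of all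
groups and the common slope. -/
noncomputable def poolProj (ι V : Type*) [Fintype ι] [NormedAddCommGroup V]
    [NormedSpace ℝ V] (g : ι) : (ι → ℝ) × V →L[ℝ] ℝ × V :=
  ((ContinuousLinearMap.proj g).comp (ContinuousLinearMap.fst ℝ (ι → ℝ) V)).prod
    (ContinuousLinearMap.snd ℝ (ι → ℝ) V)

lemma poolProj_apply (g : ι) (x : (ι → ℝ) × V) : poolProj ι V g x = (x.1 g, x.2) := rfl

lemma norm_poolProj_le (g : ι) (x : (ι → ℝ) × V) : ‖poolProj ι V g x‖ ≤ ‖x‖ := by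
  rw [poolProj_apply, Prod.norm_def, Prod.norm_def]
  exact max_le_max (norm_le_pi_norm x.1 g) le_rfl

/-- Existence of a zero of the pooled score equations near the truth. The radius is uniform in the
number of groups, because the equations of the fixed effects are controlled in the supremum norm;
the mean-square bound for the zero involves the mean square of the scores at the truth only. -/
theorem exists_pooled_zero [FiniteDimensional ℝ V] {m K η q s₀ : ℝ} (hm : 0 < m) (hK : 0 ≤ K)
    (hη : 0 < η) (hq : 0 < q) (hs₀ : 0 < s₀) :
    ∃ τ > 0, ∃ A > 0, ∀ (ι : Type) [Fintype ι] (s : ι → ℝ × V → (ℝ × V →L[ℝ] ℝ))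
      (M : ι → ℝ × V →L[ℝ] (ℝ × V →L[ℝ] ℝ)),
      (∀ g, m ≤ M g (1, 0) (1, 0)) → (∀ g, ‖M g‖ ≤ K) →
      (∀ u : V, ∃ w : V, ‖w‖ ≤ 1 ∧ η * ‖u‖ ≤ mean Finset.univ fun g =>
        M g (0, u) (0, w) - M g (1, 0) (0, w) * ((M g (1, 0) (1, 0))⁻¹ * M g (0, u) (1, 0))) →
      (∀ g t z z', t ≤ s₀ → ‖z‖ ≤ t → ‖z'‖ ≤ t →
        ‖s g z - s g z' - M g (z - z')‖ ≤ q * t * ‖z - z'‖) →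
      (∀ g, ‖s g 0‖ ≤ τ) →
      ∃ (a : ι → ℝ) (u : V), (∀ g, ‖(a g, u)‖ ≤ s₀) ∧ (∀ g, s g (a g, u) (1, 0) = 0) ∧
        (∀ w, mean Finset.univ (fun g => s g (a g, u) (0, w)) = 0) ∧
        mean Finset.univ (fun g => ‖(a g, u)‖ ^ 2)
          ≤ A * mean Finset.univ (fun g => ‖s g 0‖ ^ 2) := by
  set A₁ := m⁻¹ with hA₁
  set A₂ := (K / m + 1) * (η⁻¹ * (1 + K / m)) with hA₂
  have hA₁0 : 0 < A₁ := inv_pos.2 hm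
  have hA₂0 : 0 < A₂ := by positivity
  -- `N` bounds the inverse of the Jacobian of the pooled equations, for any number of groups, and
  -- on a ball of radius `t` the nonlinearity is at most half of what this inverse allows
  set N := A₁ + A₂ with hN
  have hN0 : 0 < N := by positivity
  set t := min s₀ (1 / (2 * N * q)) with ht
  have ht0 : 0 < t := by positivity
  have hts : t ≤ s₀ := min_le_left _ _
  have htq : q * t * N ≤ 1 / 2 := by
    have h1 : t ≤ 1 / (2 * N * q) := min_le_right _ _
    rw [le_div_iff₀ (by positivity)] at h1
    linarith
  refine ⟨t / (2 * N), by positivity, 8 * A₁ ^ 2 + 32 * A₂ ^ 2, by positivity,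
    fun ι _ s M hMm hMK hconc hlin hs0 => ?_⟩
  have LE := norm_le_of_concentrated hm hK hη hMm hMK hconc
  let f : (ι → ℝ) × V → (ι → ℝ) × (V →L[ℝ] ℝ) :=
    fun x => poolEquations ι V fun g => s g (poolProj ι V g x)
  let f' : (ι → ℝ) × V →L[ℝ] (ι → ℝ) × (V →L[ℝ] ℝ) :=
    (poolEquations ι V).comp (ContinuousLinearMap.pi fun g => (M g).comp (poolProj ι V g))
  have hf' : ∀ x, f' x = poolEquations ι V fun g => M g (poolProj ι V g x) := fun x => rfl
  have hlow : ∀ x, ‖x‖ ≤ N * ‖f' x‖ := by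
    intro x
    have h1 : ∀ g, ‖(x.1 g, x.2)‖ ≤ A₁ * ‖f' x‖ + A₂ * ‖f' x‖ := by
      intro g
      have hne : (Finset.univ : Finset ι).Nonempty := ⟨g, Finset.mem_univ g⟩
      have := LE x.1 x.2 (fun _ => ‖f' x‖) (fun g => ?_) (fun w hw => ?_) g
      · rwa [mean_const hne] at this
      · have e : (f' x).1 g = M g (x.1 g, x.2) (1, 0) := by
          rw [hf', poolEquations_fst, poolProj_apply]
        rw [← e]
        exact (norm_le_pi_norm (f' x).1 g).trans (norm_fst_le _)
      · have e : (f' x).2 w = mean Finset.univ fun g => M g (x.1 g, x.2) (0, w) := by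
          rw [hf', poolEquations_snd]; rfl
        rw [mean_const hne, ← e]
        refine (le_abs_self _).trans (((f' x).2.le_opNorm w).trans ?_)
        exact (mul_le_of_le_one_right (norm_nonneg _) hw).trans (norm_snd_le _)
    rcases isEmpty_or_nonempty ι with hι | ⟨⟨g⟩⟩
    · -- without groups the condition on the concentrated Jacobian forces `V` to be trivial
      have hx2 : x.2 = 0 := by
        obtain ⟨w, -, hw⟩ := hconc x.2
        have h0 : mean (Finset.univ : Finset ι) (fun g => M g (0, x.2) (0, w)
          - M g (1, 0) (0, w) * ((M g (1, 0) (1, 0))⁻¹ * M g (0, x.2) (1, 0))) = 0 := by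
          simp [mean]
        rw [h0] at hw
        exact norm_le_zero_iff.1 (by nlinarith [norm_nonneg x.2])
      have hx : x = 0 := Prod.ext (Subsingleton.elim _ _) hx2
      rw [hx, norm_zero]; positivity
    · rw [Prod.norm_def]
      refine max_le ((pi_norm_le_iff_of_nonneg (by positivity)).2 fun g => ?_) ?_
      · exact (norm_fst_le (x.1 g, x.2)).trans ((h1 g).trans (le_of_eq (by ring)))
      · exact (norm_snd_le (x.1 g, x.2)).trans ((h1 g).trans (le_of_eq (by ring)))
  have hinj : Function.Injective f' := by
    refine (injective_iff_map_eq_zero f').2 fun x hx => ?_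
    have := hlow x
    rw [hx, norm_zero, mul_zero] at this
    exact norm_le_zero_iff.1 this
  have hsurj : Function.Surjective f' := by
    have hdim : Module.finrank ℝ ((ι → ℝ) × V) = Module.finrank ℝ ((ι → ℝ) × (V →L[ℝ] ℝ)) := by
      rw [Module.finrank_prod, Module.finrank_prod,
        ← (LinearMap.toContinuousLinearMap (𝕜 := ℝ) (E := V) (F' := ℝ)).finrank_eq,
        Module.finrank_linearMap, Module.finrank_self, mul_one]
    exact (LinearMap.injective_iff_surjective_of_finrank_eq_finrank
      (f := (f' : (ι → ℝ) × V →ₗ[ℝ] (ι → ℝ) × (V →L[ℝ] ℝ))) hdim).1 hinj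
  let inv : f'.NonlinearRightInverse :=
    { toFun := Function.surjInv hsurj
      nnnorm := ⟨N, hN0.le⟩
      bound' := fun y => by
        have h1 := hlow (Function.surjInv hsurj y)
        have h2 : f' (Function.surjInv hsurj y) = y := Function.surjInv_eq hsurj y
        rw [h2] at h1
        exact h1
      right_inv' := Function.surjInv_eq hsurj }
  have happrox : ApproximatesLinearOn f f' (Metric.closedBall 0 t) ⟨q * t, by positivity⟩ := by
    intro x hx y hy
    rw [mem_closedBall_zero_iff] at hx hy
    have e : f x - f y - f' (x - y) = poolEquations ι V (fun g =>
        s g (poolProj ι V g x) - s g (poolProj ι V g y)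
          - M g (poolProj ι V g x - poolProj ι V g y)) := by
      have e1 : (fun g => s g (poolProj ι V g x) - s g (poolProj ι V g y)
          - M g (poolProj ι V g x - poolProj ι V g y))
          = ((fun g => s g (poolProj ι V g x)) - fun g => s g (poolProj ι V g y))
            - fun g => M g (poolProj ι V g (x - y)) := by
        funext g
        simp only [Pi.sub_apply, map_sub]
      rw [e1, map_sub (poolEquations ι V), map_sub (poolEquations ι V), ← hf']
    change ‖f x - f y - f' (x - y)‖ ≤ q * t * ‖x - y‖
    rw [e]
    refine norm_poolEquations_le (by positivity) fun g => ?_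
    refine (hlin g t _ _ hts ((norm_poolProj_le g x).trans hx)
      ((norm_poolProj_le g y).trans hy)).trans ?_
    rw [← map_sub]
    exact mul_le_mul_of_nonneg_left (norm_poolProj_le g _) (by positivity)
  -- an approximately linear map sends the ball onto a ball around `f 0`, which contains zero
  have hball := happrox.surjOn_closedBall_of_nonlinearRightInverse inv ht0.le subset_rfl
  have hmem : (0 : (ι → ℝ) × (V →L[ℝ] ℝ)) ∈ Metric.closedBall (f 0)
      (((inv.nnnorm : ℝ)⁻¹ - ((⟨q * t, by positivity⟩ : NNReal) : ℝ)) * t) := by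
    rw [mem_closedBall_iff_norm, zero_sub, norm_neg]
    have h1 : ‖f 0‖ ≤ t / (2 * N) := norm_poolEquations_le (by positivity) fun g => by
      rw [map_zero]; exact hs0 g
    refine h1.trans ?_
    change t / (2 * N) ≤ (N⁻¹ - q * t) * t
    have h2 : q * t ≤ 1 / (2 * N) := by rw [le_div_iff₀ (by positivity)]; linarith
    have h3 : N⁻¹ = 2 * (1 / (2 * N)) := by field_simp
    rw [h3, div_eq_mul_one_div]
    nlinarith
  obtain ⟨x, hx, hfx⟩ := hball hmem
  rw [mem_closedBall_zero_iff] at hx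
  have hxg : ∀ g, ‖(x.1 g, x.2)‖ ≤ t := fun g => (norm_poolProj_le g x).trans hx
  have hz1 : ∀ g, s g (x.1 g, x.2) (1, 0) = 0 := fun g => by
    have := congrFun (congrArg Prod.fst hfx) g
    rwa [poolEquations_fst, poolProj_apply] at this
  have hz2 : ∀ w, mean Finset.univ (fun g => s g (x.1 g, x.2) (0, w)) = 0 := fun w => by
    have := congrArg (fun l : (ι → ℝ) × (V →L[ℝ] ℝ) => l.2 w) hfx
    simp only [f, poolEquations_snd, poolProj_apply] at this
    exact this
  refine ⟨x.1, x.2, fun g => (hxg g).trans hts, hz1, hz2, ?_⟩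
  set δ : ι → ℝ := fun g => ‖(x.1 g, x.2)‖ with hδ
  set σ : ι → ℝ := fun g => ‖s g 0‖ with hσ
  -- the zero nearly solves the linear equations, so that the linear estimate applies to it
  have hrem : ∀ g, ‖M g (x.1 g, x.2) - s g (x.1 g, x.2)‖ ≤ σ g + q * t * δ g := fun g => by
    have h1 := hlin g (δ g) (x.1 g, x.2) 0 ((hxg g).trans hts) le_rfl (by simp [hδ])
    rw [sub_zero] at h1
    have h2 : M g (x.1 g, x.2) - s g (x.1 g, x.2)
        = -(s g (x.1 g, x.2) - s g 0 - M g (x.1 g, x.2)) - s g 0 := by abel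
    rw [h2]
    refine (norm_sub_le _ _).trans ?_
    rw [norm_neg]
    have h3 : q * δ g * δ g ≤ q * t * δ g :=
      mul_le_mul_of_nonneg_right (mul_le_mul_of_nonneg_left (hxg g) hq.le) (norm_nonneg _)
    linarith [h1]
  have hδy := LE x.1 x.2 (fun g => σ g + q * t * δ g) (fun g => by
      have h3 : ‖((1 : ℝ), (0 : V))‖ = 1 := by simp [Prod.norm_def]
      have := (M g (x.1 g, x.2) - s g (x.1 g, x.2)).le_opNorm (1, 0)
      rw [h3, mul_one, _root_.sub_apply, hz1, sub_zero] at this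
      exact this.trans (hrem g)) (fun w hw => by
      have h0 := hz2 w
      have : mean Finset.univ (fun g => M g (x.1 g, x.2) (0, w))
          = mean Finset.univ (fun g => (M g (x.1 g, x.2) - s g (x.1 g, x.2)) (0, w)) := by
        simp only [_root_.sub_apply]
        rw [mean_sub, h0, sub_zero]
      rw [this]
      refine mean_mono fun g _ => ?_
      have h4 : ‖((0 : ℝ), w)‖ ≤ 1 := by simpa [Prod.norm_def] using hw
      exact (le_abs_self _).trans ((ContinuousLinearMap.le_opNorm _ _).trans
        ((mul_le_of_le_one_right (norm_nonneg _) h4).trans (hrem g))))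
  rw [mean_add, mean_const_mul] at hδy
  have hσ0 : 0 ≤ mean Finset.univ σ := mean_nonneg fun g _ => norm_nonneg _
  have hδ0 : 0 ≤ mean Finset.univ δ := mean_nonneg fun g _ => norm_nonneg _
  set μσ := mean Finset.univ σ with hμσ
  set μδ := mean Finset.univ δ with hμδ
  have hqt : 0 < q * t := by positivity
  have hA₁N : q * t * A₁ ≤ 1 / 2 := by nlinarith
  have hmean : μδ ≤ 2 * N * μσ := by
    have h1 : μδ ≤ mean Finset.univ (fun g => A₁ * (σ g + q * t * δ g) + A₂ * (μσ + q * t * μδ)) :=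
      mean_mono fun g _ => hδy g
    rw [mean_add, mean_const_mul, mean_add, mean_const_mul] at h1
    have h2 := mean_const_le (s := (Finset.univ : Finset ι))
      (by positivity : 0 ≤ A₂ * (μσ + q * t * μδ))
    have h3 := mul_le_mul_of_nonneg_right htq hδ0
    have h4 : μδ ≤ N * μσ + q * t * N * μδ := by rw [hN]; linarith
    linarith
  have hμ : μσ + q * t * μδ ≤ 2 * μσ := by
    have := mul_le_mul_of_nonneg_left hmean hqt.le
    nlinarith
  have hδσ : ∀ g, δ g ≤ 2 * A₁ * σ g + 4 * A₂ * μσ := fun g => by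
    have h1 := hδy g
    have h2 := mul_le_mul_of_nonneg_right hA₁N (norm_nonneg (x.1 g, x.2))
    have h3 := mul_le_mul_of_nonneg_left hμ hA₂0.le
    change δ g ≤ A₁ * (σ g + q * t * δ g) + A₂ * (μσ + q * t * μδ) at h1
    change q * t * A₁ * δ g ≤ 1 / 2 * δ g at h2
    linarith
  have hsq : mean Finset.univ (fun g => δ g ^ 2)
      ≤ mean Finset.univ (fun g => 8 * A₁ ^ 2 * σ g ^ 2 + 32 * A₂ ^ 2 * μσ ^ 2) := by
    refine mean_mono fun g _ => ?_
    have h1 := pow_le_pow_left₀ (norm_nonneg _) (hδσ g) 2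
    nlinarith [sq_nonneg (2 * A₁ * σ g - 4 * A₂ * μσ)]
  rw [mean_add, mean_const_mul] at hsq
  have h1 := mean_const_le (s := (Finset.univ : Finset ι))
    (by positivity : 0 ≤ 32 * A₂ ^ 2 * μσ ^ 2)
  have h2 : μσ ^ 2 ≤ mean Finset.univ (fun g => σ g ^ 2) := mean_sq_le
  have h3 := mul_le_mul_of_nonneg_left h2 (by positivity : 0 ≤ 32 * A₂ ^ 2)
  linarith

end PooledZero

section NPL
variable {n d G : ℕ}

/-! ### NPL fixed points and NPL estimators -/

lemma mean_coe_univ {ι : Type*} (C : Finset ι) (f : ι → ℝ) :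
    mean (Finset.univ : Finset C) (fun g => f g) = mean C f := by
  unfold mean
  rw [Finset.sum_coe_sort C f, Finset.card_univ, Fintype.card_coe]

lemma pooledNLL_eq (D : Fin G → GroupData n d) (C : Finset (Fin G)) (μ : Fin G → ℝ) (θ : Slope d)
    (P : Fin G → Fin n → ℝ) :
    pooledNLL D C μ θ P = mean C fun g => groupNLL (D g) (μ g) θ (P g) := rfl

lemma norm_scoreDeriv_le {D : GroupData n d} {B r : ℝ} (hD : IsRegularData B D) (hr0 : 0 ≤ r)
    (hr : r < 1) {z : Param d} (hz : |z.2 0| ≤ 4 * r) :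
    ‖scoreDeriv D z‖ ≤ ccpLip d B r * (indexBound d B + 1) := by
  have hL := two_le_ccpLip (d := d) hD.reg hr0 hr
  have hB := two_le_indexBound (d := d) hD.reg.one_le
  refine ContinuousLinearMap.opNorm_le_bound _ (by positivity) fun u => ?_
  have hu := norm_nonneg u
  refine ContinuousLinearMap.opNorm_le_bound _ (by positivity) fun w => ?_
  have hw := norm_nonneg w
  have hv := norm_ccpDeriv_le hD.reg hr0 hr hz u
  rw [scoreDeriv_apply, peerNoise_apply, Real.norm_eq_abs]
  have h1 : |mean Finset.univ (fun i => ccpDeriv D.X D.F z u i *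
      indexCLM D.X D.F (ccp D.X D.F z.1 z.2) i w)|
      ≤ ccpLip d B r * ‖u‖ * (indexBound d B * ‖w‖) := by
    refine abs_mean_le (fun i _ => ?_) (by positivity)
    rw [abs_mul]
    exact mul_le_mul ((abs_le_norm _ i).trans hv)
      (hD.reg.abs_indexCLM_le (norm_ccp_le (abs_lt_four hr hz)) i w) (abs_nonneg _) (by positivity)
  have h2 : |mean Finset.univ (fun i => (D.Y i - ccp D.X D.F z.1 z.2 i) *
      peerAvg D.F (ccpDeriv D.X D.F z u) i)| ≤ 1 * (ccpLip d B r * ‖u‖) := by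
    refine abs_mean_le (fun i _ => ?_) (by positivity)
    rw [abs_mul]
    exact mul_le_mul (abs_residual_le hD hr hz i) ((abs_peerAvg_le_norm _ _ i).trans hv)
      (abs_nonneg _) zero_le_one
  refine (abs_sub _ _).trans ?_
  rw [abs_mul]
  have h3 := mul_le_mul h2 (abs_snd_apply_le w 0) (abs_nonneg _) (by positivity)
  linarith

lemma continuous_groupNLL (D : GroupData n d) (θ : Slope d) (P : Fin n → ℝ) :
    Continuous fun μ => groupNLL D μ θ P := by
  have h : Continuous fun z : Param d => groupNLL D z.1 z.2 P :=
    continuous_iff_continuousAt.2 fun z => (hasFDerivAt_groupNLL D P z).continuousAt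
  have h2 : Continuous fun μ : ℝ => ((μ, θ) : Param d) := continuous_id.prodMk continuous_const
  change Continuous ((fun z : Param d => groupNLL D z.1 z.2 P) ∘ fun μ : ℝ => ((μ, θ) : Param d))
  exact h.comp h2

lemma fixedEffect_spec {A : Set ℝ} (hA : IsCompact A) (hne : A.Nonempty) (D : GroupData n d)
    (θ : Slope d) (P : Fin n → ℝ) :
    fixedEffect A D θ P ∈ A ∧
      ∀ ν ∈ A, groupNLL D (fixedEffect A D θ P) θ P ≤ groupNLL D ν θ P := by
  obtain ⟨μ, hμ, hmin⟩ := hA.exists_isMinOn hne (continuous_groupNLL D θ P).continuousOn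
  exact Classical.epsilon_spec
    (p := fun μ => μ ∈ A ∧ ∀ ν ∈ A, groupNLL D μ θ P ≤ groupNLL D ν θ P) ⟨μ, hμ, hmin⟩

lemma profileNLL_eq (A : Set ℝ) (D : GroupData n d) (θ : Slope d) (P : Fin n → ℝ) :
    profileNLL A D θ P = groupNLL D (fixedEffect A D θ P) θ P := rfl

section FixedPoint
variable {A : Set ℝ} {Θ : Set (Slope d)} {D : Fin G → GroupData n d} {C : Finset (Fin G)}
  {μ : Fin G → ℝ} {θ : Slope d} {P : Fin G → Fin n → ℝ}

lemma IsNPLFixedPoint.eq_ccp (h : IsNPLFixedPoint A Θ D C μ θ P) (hpeer : ∀ θ ∈ Θ, |θ 0| < 4)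
    {g : Fin G} (hg : g ∈ C) : P g = ccp (D g).X (D g).F (μ g) θ :=
  PeerEffects.eq_ccp (hpeer θ h.mem_Θ) (h.fixed g hg)

lemma IsNPLFixedPoint.pooledNLL_eq (h : IsNPLFixedPoint A Θ D C μ θ P)
    (hpeer : ∀ θ ∈ Θ, |θ 0| < 4) :
    pooledNLL D C μ θ P = mean C fun g => eqNLL (D g) (μ g, θ) := by
  rw [PeerEffects.pooledNLL_eq]
  exact mean_congr fun g hg => by rw [h.eq_ccp hpeer hg]; rfl

lemma IsNPLFixedPoint.groupNLL_le (h : IsNPLFixedPoint A Θ D C μ θ P) {g : Fin G} (hg : g ∈ C)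
    {ν : ℝ} (hν : ν ∈ A) : groupNLL (D g) (μ g) θ (P g) ≤ groupNLL (D g) ν θ (P g) := by
  have h1 := h.isMin (Function.update μ g ν) θ (fun g' hg' => by
    by_cases e : g' = g
    · subst e; simpa using hν
    · simpa [e] using h.mem_A g' hg') h.mem_Θ
  unfold pooledNLL at h1
  have hcard : (0 : ℝ) < 1 / (C.card : ℝ) := by
    have : 0 < C.card := Finset.card_pos.2 ⟨g, hg⟩
    positivity
  have h2 := le_of_mul_le_mul_left h1 hcard
  rw [← Finset.add_sum_erase _ _ hg, ← Finset.add_sum_erase _ _ hg] at h2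
  have h3 : ∑ x ∈ C.erase g, groupNLL (D x) (Function.update μ g ν x) θ (P x)
      = ∑ x ∈ C.erase g, groupNLL (D x) (μ x) θ (P x) :=
    Finset.sum_congr rfl fun x hx => by rw [Function.update_of_ne (Finset.ne_of_mem_erase hx)]
  rw [h3, Function.update_self] at h2
  linarith

/-- At an NPL fixed point, profiling out the fixed effect reproduces the likelihood at the
equilibrium. -/
lemma IsNPLFixedPoint.profileNLL_eq (h : IsNPLFixedPoint A Θ D C μ θ P) (hA : IsCompact A)
    (hpeer : ∀ θ ∈ Θ, |θ 0| < 4) {g : Fin G} (hg : g ∈ C) :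
    profileNLL A (D g) θ (P g) = eqNLL (D g) (μ g, θ) := by
  have hs := fixedEffect_spec hA ⟨_, h.mem_A g hg⟩ (D g) θ (P g)
  have e : eqNLL (D g) (μ g, θ) = groupNLL (D g) (μ g) θ (P g) := by
    rw [h.eq_ccp hpeer hg]; rfl
  rw [e, PeerEffects.profileNLL_eq]
  exact le_antisymm (hs.2 _ (h.mem_A g hg)) (h.groupNLL_le hg hs.1)

end FixedPoint

lemma Bounds.Good.le_scoreDeriv {b : Bounds d} {D : GroupData n d} {z₀ : Param d}
    (h : b.Good D z₀) : b.c₀ * (1 - b.r) ≤ scoreDeriv D z₀ (1, 0) (1, 0) :=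
  le_scoreDeriv_fixedEffect h.n_pos b.r_lt_one h.adm.peer b.c₀_pos.le fun i =>
    b.le_sigmoidDeriv _ (h.abs_index_le (norm_ccp_le h.adm.lt_four) h.adm i)

lemma Bounds.Good.nplJacobian_eq {b : Bounds d} {D : GroupData n d} {z₀ : Param d}
    (h : b.Good D z₀) : nplJacobian D z₀ = scoreDeriv D z₀ :=
  PeerEffects.nplJacobian_eq h.data b.r_nonneg b.r_lt_one b.s_pos fun z hz => (h.ball z hz).peer

/-- Groups with a common true slope have an NPL fixed point whose likelihood exceeds the likelihood
at the truth by no more than a multiple of the mean squared sampling error. It is a zero of the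
pooled score near the truth; the likelihood is convex in the parameters for given choice
probabilities, so that such a zero solves the minimization problem over the whole parameter
space. -/
theorem exists_nplFixedPoint (b : Bounds d) {η : ℝ} (hη : 0 < η) :
    ∃ τ > 0, ∃ K > 0, ∀ (n G : ℕ) (A : Set ℝ) (Θ : Set (Slope d)) (D : Fin G → GroupData n d)
      (C : Finset (Fin G)) (μ₀ : Fin G → ℝ) (θ₀ : Slope d), (∀ θ ∈ Θ, |θ 0| < 4) → C.Nonempty →
      (∀ g ∈ C, b.Good (D g) (μ₀ g, θ₀)) →
      (∀ g ∈ C, ∀ z : Param d, ‖z - (μ₀ g, θ₀)‖ ≤ b.s → z.1 ∈ A ∧ z.2 ∈ Θ) →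
      (∀ u : Slope d, ∃ w : Slope d, ‖w‖ ≤ 1 ∧
        η * ‖u‖ ≤ concentratedJacobian D C μ₀ θ₀ u w) →
      (∀ g ∈ C, noise (D g) (μ₀ g, θ₀) ≤ τ) →
      ∃ μ θ P, IsNPLFixedPoint A Θ D C μ θ P ∧ pooledNLL D C μ θ P ≤
        mean C (fun g => eqNLL (D g) (μ₀ g, θ₀)) + K * mean C (fun g => noise (D g) (μ₀ g, θ₀) ^ 2)
    := by
  have hr1 := b.r_lt_one
  have hL := b.ccpLip_ge
  have hB := b.indexBound_ge
  have hQ := ccpQuad_nonneg (d := d) (B := b.B) b.r_lt_one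
  have hq : 0 < scoreQuad d b.B b.r := by unfold scoreQuad; positivity
  have hU : 0 < b.upperConst := by unfold Bounds.upperConst; positivity
  obtain ⟨τ, hτ, K, hK, H⟩ := exists_pooled_zero (V := Slope d)
    (m := b.c₀ * (1 - b.r)) (K := ccpLip d b.B b.r * (indexBound d b.B + 1)) (η := η)
    (q := scoreQuad d b.B b.r) (s₀ := b.s) (mul_pos b.c₀_pos (by linarith)) (by positivity) hη hq
    b.s_pos
  refine ⟨τ, hτ, b.upperConst * K + 1, by positivity,
    fun n G A Θ D C μ₀ θ₀ hpeer hC hgood hint hconc hnoise => ?_⟩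
  obtain ⟨a, u, hau, hz1, hz2, hmean⟩ := H C
    (fun g δ => nplScore (D g) ((μ₀ g, θ₀) + δ)) (fun g => scoreDeriv (D g) (μ₀ g, θ₀))
    (fun g => (hgood g g.2).le_scoreDeriv)
    (fun g => norm_scoreDeriv_le (hgood g g.2).data b.r_nonneg b.r_lt_one (hgood g g.2).adm.peer)
    (fun u => by
      obtain ⟨w, hw, hwη⟩ := hconc u
      refine ⟨w, hw, hwη.trans (le_of_eq ?_)⟩
      rw [mean_coe_univ C (fun g => scoreDeriv (D g) (μ₀ g, θ₀) (0, u) (0, w)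
        - scoreDeriv (D g) (μ₀ g, θ₀) (1, 0) (0, w) *
          ((scoreDeriv (D g) (μ₀ g, θ₀) (1, 0) (1, 0))⁻¹ *
            scoreDeriv (D g) (μ₀ g, θ₀) (0, u) (1, 0)))]
      exact mean_congr fun g hg => by rw [(hgood g hg).nplJacobian_eq])
    (fun g t z z' ht hz hz' => by
      have := norm_nplScore_sub_sub_le (z₀ := (μ₀ g, θ₀)) (z := (μ₀ g, θ₀) + z)
        (z' := (μ₀ g, θ₀) + z') (s := t) (hgood g g.2).data b.r_nonneg b.r_lt_one
        (hgood g g.2).adm.peer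
        ((hgood g g.2).ball _ (by rw [add_sub_cancel_left]; exact hz.trans ht)).peer
        ((hgood g g.2).ball _ (by rw [add_sub_cancel_left]; exact hz'.trans ht)).peer
        (by rwa [add_sub_cancel_left]) (by rwa [add_sub_cancel_left])
      rwa [add_sub_add_left_eq_sub] at this)
    (fun g => by
      rw [add_zero]
      have := hnoise g g.2
      unfold noise at this
      linarith [norm_nonneg (peerNoise (D g) (μ₀ g, θ₀))])
  classical
  set δ : Fin G → ℝ × Slope d := fun g => (if h : g ∈ C then a ⟨g, h⟩ else 0, u) with hδ
  have hδC : ∀ g (hg : g ∈ C), δ g = (a ⟨g, hg⟩, u) := fun g hg => by simp [hδ, hg]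
  set z : Fin G → Param d := fun g => (μ₀ g, θ₀) + δ g with hz
  have hzle : ∀ g ∈ C, ‖z g - (μ₀ g, θ₀)‖ ≤ b.s := fun g hg => by
    simp only [hz, add_sub_cancel_left]
    rw [hδC g hg]; exact hau ⟨g, hg⟩
  have hz2' : ∀ g, (z g).2 = θ₀ + u := fun g => by simp [hz, hδ]
  have hzeta : ∀ g, ((z g).1, θ₀ + u) = z g := fun g => by rw [← hz2' g]
  have hfix : IsNPLFixedPoint A Θ D C (fun g => (z g).1) (θ₀ + u)
      (fun g => ccp (D g).X (D g).F (z g).1 (z g).2) := by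
    have hmem : ∀ g ∈ C, (z g).1 ∈ A ∧ θ₀ + u ∈ Θ := fun g hg => by
      have := hint g hg (z g) (hzle g hg)
      rwa [hz2'] at this
    refine ⟨fun g hg => (hmem g hg).1, (hmem hC.choose hC.choose_spec).2,
      fun ν θ' hν hθ' => ?_, fun g hg => ?_⟩
    · rw [pooledNLL_eq, pooledNLL_eq]
      -- the score vanishes in the direction of each fixed effect, and on average in the directions
      -- of the common slope
      have h0 : mean C (fun g => nplScore (D g) (z g) ((ν g, θ') - z g)) = 0 := by
        have h1 : mean C (fun g => nplScore (D g) (z g) ((ν g, θ') - z g))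
            = mean C (fun g => nplScore (D g) (z g) (0, θ' - (θ₀ + u))) := by
          refine mean_congr fun g hg => ?_
          have e : ((ν g, θ') : Param d) - z g
              = (ν g - (z g).1) • ((1, 0) : Param d) + (0, θ' - (θ₀ + u)) := by
            rw [← hz2' g]; ext <;> simp
          have e2 : nplScore (D g) (z g) (1, 0) = 0 := by
            have := hz1 ⟨g, hg⟩
            rwa [← hδC g hg] at this
          rw [e, map_add, map_smul, e2, smul_zero, zero_add]
        rw [h1, ← mean_coe_univ]
        refine Eq.trans ?_ (hz2 (θ' - (θ₀ + u)))
        exact mean_congr fun g _ => by simp only [hz, hδC g g.2]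
      have h2 : mean C (fun g => groupNLL (D g) (z g).1 (θ₀ + u)
            (ccp (D g).X (D g).F (z g).1 (z g).2) + nplScore (D g) (z g) ((ν g, θ') - z g))
          ≤ mean C (fun g => groupNLL (D g) (ν g) θ' (ccp (D g).X (D g).F (z g).1 (z g).2)) := by
        refine mean_mono fun g _ => ?_
        have := groupNLL_tangent_le (D g) (ccp (D g).X (D g).F (z g).1 (z g).2) (ν g, θ') (z g)
        rw [nplScore_eq, ← hz2' g]
        exact this
      rw [mean_add, h0, add_zero] at h2
      exact h2
    · have := ccp_eq (X := (D g).X) (F := (D g).F) (z g).1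
        ((hgood g hg).ball (z g) (hzle g hg)).lt_four
      rw [← hz2' g]
      exact this
  refine ⟨_, _, _, hfix, ?_⟩
  rw [hfix.pooledNLL_eq hpeer]
  have h1 : mean C (fun g => eqNLL (D g) ((z g).1, θ₀ + u)) ≤ mean C (fun g =>
      eqNLL (D g) (μ₀ g, θ₀) + (b.upperConst * ‖δ g‖ ^ 2 + noise (D g) (μ₀ g, θ₀) ^ 2)) := by
    refine mean_mono fun g hg => ?_
    have := (hgood g hg).eqNLL_upper ((hgood g hg).ball (z g) (hzle g hg))
    rw [hzeta]
    have e : z g - (μ₀ g, θ₀) = δ g := by simp [hz]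
    rw [e] at this
    linarith
  have h2 : mean C (fun g => ‖δ g‖ ^ 2) ≤ K * mean C (fun g => noise (D g) (μ₀ g, θ₀) ^ 2) := by
    rw [← mean_coe_univ C (fun g => ‖δ g‖ ^ 2),
      ← mean_coe_univ C (fun g => noise (D g) (μ₀ g, θ₀) ^ 2)]
    calc mean (Finset.univ : Finset C) (fun g => ‖δ g‖ ^ 2)
        = mean Finset.univ (fun g => ‖(a g, u)‖ ^ 2) :=
          mean_congr fun g _ => by rw [hδC g g.2]
      _ ≤ _ := hmean
      _ ≤ _ := mul_le_mul_of_nonneg_left (mean_mono fun g _ => ?_) hK.le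
    rw [add_zero]
    refine pow_le_pow_left₀ (norm_nonneg _) ?_ 2
    unfold noise
    linarith [norm_nonneg (peerNoise (D g) (μ₀ g, θ₀))]
  rw [mean_add, mean_add, mean_const_mul] at h1
  have h3 := mul_le_mul_of_nonneg_left h2 hU.le
  linarith

/-- Invertibility of the Jacobian of the score of a group implies invertibility of its concentrated
version (a Schur complement). -/
lemma concentrated_singleton {b : Bounds d} {D : Fin G → GroupData n d} {g : Fin G}
    {μ₀ : Fin G → ℝ} {θ₀ : Slope d} (h : b.Good (D g) (μ₀ g, θ₀)) {η : ℝ} (hη : 0 < η)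
    (hM : ∀ u, η * ‖u‖ ≤ ‖scoreDeriv (D g) (μ₀ g, θ₀) u‖) (u : Slope d) :
    ∃ w : Slope d, ‖w‖ ≤ 1 ∧ η / 2 * ‖u‖ ≤ concentratedJacobian D {g} μ₀ θ₀ u w := by
  set M := scoreDeriv (D g) (μ₀ g, θ₀) with hMdef
  have hα : 0 < M (1, 0) (1, 0) :=
    (mul_pos b.c₀_pos (by linarith [b.r_lt_one])).trans_le h.le_scoreDeriv
  have hH : ∀ w, concentratedJacobian D {g} μ₀ θ₀ u w
      = M (0, u) (0, w) - M (1, 0) (0, w) * ((M (1, 0) (1, 0))⁻¹ * M (0, u) (1, 0)) := fun w => by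
    simp only [concentratedJacobian, Finset.card_singleton, Finset.sum_singleton,
      h.nplJacobian_eq, ← hMdef]
    norm_num
  rcases eq_or_ne u 0 with rfl | hu
  · exact ⟨0, by simp, by
      rw [hH, show ((0 : ℝ), (0 : Slope d)) = (0 : Param d) from rfl, map_zero]; simp⟩
  -- the change of the fixed effect that keeps its equation satisfied when the slope changes by `u`
  set a := -((M (1, 0) (1, 0))⁻¹ * M (0, u) (1, 0)) with ha
  have hsplit : M (a, u) = a • M (1, 0) + M (0, u) := by
    rw [← map_smul, ← map_add]; congr 1; ext <;> simp
  have h1 : ∀ x : Param d, M (a, u) x = concentratedJacobian D {g} μ₀ θ₀ u x.2 := fun x => by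
    have e : x = x.1 • ((1, 0) : Param d) + (0, x.2) := by ext <;> simp
    have e1 : M (a, u) (1, 0) = 0 := by
      rw [hsplit]
      simp only [_root_.add_apply, _root_.smul_apply, smul_eq_mul, ha]
      field_simp
      ring
    rw [e, map_add, map_smul, e1, smul_zero, zero_add, hH, hsplit]
    simp only [_root_.add_apply, _root_.smul_apply, smul_eq_mul, ha]
    simp
    ring
  have hupos : 0 < ‖u‖ := norm_pos_iff.2 hu
  have hnorm : η / 2 * ‖u‖ < ‖M (a, u)‖ := by
    have h2 := hM (a, u)
    have h3 : ‖u‖ ≤ ‖((a, u) : Param d)‖ := norm_snd_le (a, u)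
    have h4 := mul_le_mul_of_nonneg_left h3 hη.le
    have h5 : 0 < η * ‖u‖ := by positivity
    linarith
  obtain ⟨x, hx1, hx⟩ := (M (a, u)).exists_lt_apply_of_lt_opNorm hnorm
  rw [h1, Real.norm_eq_abs] at hx
  have hx2 : ‖x.2‖ ≤ 1 := (norm_snd_le x).trans hx1.le
  rcases le_total 0 (concentratedJacobian D {g} μ₀ θ₀ u x.2) with h0 | h0
  · exact ⟨x.2, hx2, by rw [abs_of_nonneg h0] at hx; exact hx.le⟩
  · refine ⟨-x.2, by rwa [norm_neg], ?_⟩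
    have e := h1 (-x)
    rw [map_neg, h1] at e
    rw [abs_of_nonpos h0, e] at hx
    exact hx.le

/-- Consistency of the first step: the choice probabilities of an NPL estimator of a single group
are the equilibrium choice probabilities of a parameter whose squared distance to the truth is
bounded by the squared sampling error. -/
theorem exists_firstStep (b : Bounds d) {η : ℝ} (hη : 0 < η) :
    ∃ τ > 0, ∃ K > 0, ∀ (n G : ℕ) (A : Set ℝ) (Θ : Set (Slope d)) (D : Fin G → GroupData n d)
      (g : Fin G) (z₀ : Param d) (κ : ℝ), (∀ θ ∈ Θ, |θ 0| < 4) → b.Good (D g) z₀ →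
      (∀ z : Param d, ‖z - z₀‖ ≤ b.s → z.1 ∈ A ∧ z.2 ∈ Θ) →
      (∀ z : Param d, z.1 ∈ A → z.2 ∈ Θ → b.Admissible z ∧
        |noiseRem (D g) z₀ z| ≤ b.lowerConst / 4 * ‖z - z₀‖ ^ 2 + κ) →
      (∀ u, η * ‖u‖ ≤ ‖scoreDeriv (D g) z₀ u‖) → noise (D g) z₀ ≤ τ →
      ∀ μ θ P, IsNPLEstimator A Θ D {g} μ θ P →
        ∃ z, b.Admissible z ∧ P g = ccp (D g).X (D g).F z.1 z.2 ∧
          ‖z - z₀‖ ^ 2 ≤ K * (noise (D g) z₀ ^ 2 + κ) := by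
  obtain ⟨τ, hτ, K, hK, H⟩ := exists_nplFixedPoint b (half_pos hη)
  have hc := b.lowerConst_pos
  refine ⟨τ, hτ, (K + 4 / b.lowerConst + 4) / b.lowerConst, by positivity,
    fun n G A Θ D g z₀ κ hpeer hgood hint hZ hM hnoise μ θ P hP => ?_⟩
  have hgood' : b.Good (D g) ((fun _ : Fin G => z₀.1) g, z₀.2) := hgood
  obtain ⟨μ', θ', P', hfix, hle⟩ := H n G A Θ D {g} (fun _ => z₀.1) z₀.2 hpeer
    (Finset.singleton_nonempty g) (by simpa using hgood) (by simpa using hint)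
    (concentrated_singleton hgood' hη hM) (by simpa using hnoise)
  have hmem : g ∈ ({g} : Finset (Fin G)) := Finset.mem_singleton_self g
  have hbest := hP.best μ' θ' P' hfix
  rw [hP.fixedPoint.pooledNLL_eq hpeer] at hbest
  have hs : ∀ f : Fin G → ℝ, mean {g} f = f g := fun f => by simp [mean]
  rw [hs] at hbest hle
  rw [hs] at hle
  obtain ⟨hadm, hrem⟩ := hZ (μ g, θ) (hP.fixedPoint.mem_A g hmem) hP.fixedPoint.mem_Θ
  refine ⟨(μ g, θ), hadm, hP.fixedPoint.eq_ccp hpeer hmem, ?_⟩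
  have hlow := hgood.eqNLL_lower hadm hrem
  have hκ : 0 ≤ κ := by
    have h0 := (hZ z₀ (hint z₀ (by simpa using b.s_pos.le)).1
      (hint z₀ (by simpa using b.s_pos.le)).2).2
    rw [sub_self, norm_zero] at h0
    have := abs_nonneg (noiseRem (D g) z₀ z₀)
    linarith
  have hσ := sq_nonneg (noise (D g) z₀)
  rw [div_mul_eq_mul_div, le_div_iff₀ hc]
  change eqNLL (D g) (μ g, θ) ≤ _ at hbest
  change _ ≤ eqNLL (D g) z₀ + K * noise (D g) z₀ ^ 2 at hle
  have h3 : 0 ≤ (K + 4 / b.lowerConst) * κ := by positivity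
  nlinarith

end NPL

section Lasso
variable {n d G : ℕ}

/-! ### Profile likelihoods at the first-step choice probabilities -/

/-- The score at the truth, evaluated at choice probabilities close to the true ones, is bounded by
the sampling error and the distance of the choice probabilities. -/
lemma Bounds.Good.abs_score_le {b : Bounds d} {D : GroupData n d} {z₀ : Param d}
    (hgood : b.Good D z₀) {P : Fin n → ℝ} {a : ℝ} (hPn : ‖P‖ ≤ 1)
    (hPP : ‖P - ccp D.X D.F z₀.1 z₀.2‖ ≤ a) (w : Param d) :
    |score D P z₀ w| ≤ (noise D z₀ + (indexBound d b.B + 1) * a) * ‖w‖ := by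
  have hw := norm_nonneg w
  have hB := b.indexBound_ge
  have ha : 0 ≤ a := (norm_nonneg _).trans hPP
  set P₀ := ccp D.X D.F z₀.1 z₀.2 with hP₀
  set Bz := indexBound d b.B
  have e1 : score D P z₀ w = nplScore D z₀ w + mean Finset.univ (fun i =>
      (Real.sigmoid (indexCLM D.X D.F P i z₀) - Real.sigmoid (indexCLM D.X D.F P₀ i z₀))
        * indexCLM D.X D.F P i w + (P₀ i - D.Y i) * (w.2 0 * peerAvg D.F (P - P₀) i)) := by
    rw [nplScore_eq, score_apply, score_apply, ← mean_add]
    refine mean_congr fun i _ => ?_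
    rw [← indexCLM_sub_ccp D.X, hP₀, ccp_apply hgood.adm.lt_four, ← hP₀]
    ring
  have e2 : |mean Finset.univ (fun i =>
      (Real.sigmoid (indexCLM D.X D.F P i z₀) - Real.sigmoid (indexCLM D.X D.F P₀ i z₀))
        * indexCLM D.X D.F P i w + (P₀ i - D.Y i) * (w.2 0 * peerAvg D.F (P - P₀) i))|
      ≤ (Bz + 1) * a * ‖w‖ := by
    refine abs_mean_le (fun i _ => ?_) (by positivity)
    have hpa := (abs_peerAvg_le_norm D.F (P - P₀) i).trans hPP
    have f1 : |Real.sigmoid (indexCLM D.X D.F P i z₀)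
        - Real.sigmoid (indexCLM D.X D.F P₀ i z₀)| ≤ a := by
      refine (abs_sigmoid_sub_le _ _).trans ?_
      rw [indexCLM_sub_ccp, abs_mul]
      have := mul_le_mul hgood.adm.lt_four.le hpa (abs_nonneg _) (by norm_num)
      linarith
    have f2 := hgood.data.reg.abs_indexCLM_le hPn i w
    have f3 : |P₀ i - D.Y i| ≤ 1 := by
      rw [abs_sub_comm]; exact abs_residual_le hgood.data b.r_lt_one hgood.adm.peer i
    have f4 : |w.2 0 * peerAvg D.F (P - P₀) i| ≤ ‖w‖ * a := by
      rw [abs_mul]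
      exact mul_le_mul (abs_snd_apply_le w 0) hpa (abs_nonneg _) hw
    refine (abs_add_le _ _).trans ?_
    rw [abs_mul, abs_mul]
    have f5 := mul_le_mul f1 f2 (abs_nonneg _) ha
    have f6 := mul_le_mul f3 f4 (abs_nonneg _) zero_le_one
    linarith
  have e3 : |nplScore D z₀ w| ≤ noise D z₀ * ‖w‖ :=
    ((nplScore D z₀).le_opNorm w).trans (mul_le_mul_of_nonneg_right
      (by unfold noise; linarith [norm_nonneg (peerNoise D z₀)]) hw)
  rw [e1]
  refine (abs_add_le _ _).trans ?_
  linarith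

/-- The design condition survives a small perturbation of the choice probabilities. -/
lemma Bounds.Good.design_perturbed {b : Bounds d} {D : GroupData n d} {z₀ : Param d}
    (hgood : b.Good D z₀) {P : Fin n → ℝ} {a : ℝ}
    (hPP : ‖P - ccp D.X D.F z₀.1 z₀.2‖ ≤ a) (ha : a ^ 2 ≤ b.c₁ / 4) (u : Param d) :
    b.c₁ / 4 * ‖u‖ ^ 2 ≤ mean Finset.univ (fun i => indexCLM D.X D.F P i u ^ 2) := by
  have f1 := hgood.design u
  set P₀ := ccp D.X D.F z₀.1 z₀.2 with hP₀
  have f2 : mean Finset.univ (fun i => indexCLM D.X D.F P₀ i u ^ 2)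
      ≤ mean Finset.univ (fun i => 2 * indexCLM D.X D.F P i u ^ 2 + 2 * (‖u‖ * a) ^ 2) := by
    refine mean_mono fun i _ => ?_
    have f3 : |u.2 0 * peerAvg D.F (P - P₀) i| ≤ ‖u‖ * a := by
      rw [abs_mul]
      exact mul_le_mul (abs_snd_apply_le _ 0) ((abs_peerAvg_le_norm D.F _ i).trans hPP)
        (abs_nonneg _) (norm_nonneg _)
    rw [← indexCLM_sub_ccp D.X] at f3
    have f4 := pow_le_pow_left₀ (abs_nonneg _) f3 2
    rw [sq_abs] at f4
    nlinarith [sq_nonneg (2 * indexCLM D.X D.F P i u - indexCLM D.X D.F P₀ i u)]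
  rw [mean_add, mean_const_mul] at f2
  have f5 := mean_const_le (s := (Finset.univ : Finset (Fin n)))
    (by positivity : 0 ≤ 2 * (‖u‖ * a) ^ 2)
  have f6 := mul_le_mul_of_nonneg_left ha (sq_nonneg ‖u‖)
  have f7 : (‖u‖ * a) ^ 2 = ‖u‖ ^ 2 * a ^ 2 := by ring
  rw [f7] at f5 f2
  linarith

/-- Quadratic growth of the pseudo likelihood at perturbed choice probabilities. -/
lemma Bounds.Good.groupNLL_growth {b : Bounds d} {D : GroupData n d} {z₀ : Param d}
    (hgood : b.Good D z₀) {P : Fin n → ℝ} {a c₂ : ℝ} (hPn : ‖P‖ ≤ 1)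
    (hPP : ‖P - ccp D.X D.F z₀.1 z₀.2‖ ≤ a) (ha : a ^ 2 ≤ b.c₁ / 4)
    (hc₂ : c₂ = b.c₀ * b.c₁ / 16) {y : Param d} (hy : b.Admissible y) :
    groupNLL D z₀.1 z₀.2 P + c₂ * ‖y - z₀‖ ^ 2
      - (noise D z₀ ^ 2 + ((indexBound d b.B + 1) * a) ^ 2) / (2 * c₂) ≤ groupNLL D y.1 y.2 P := by
  have hc0 := b.c₀_pos
  have hc1 := b.c₁_pos
  have hc₂0 : 0 < c₂ := by rw [hc₂]; positivity
  have h5 := groupNLL_lower D (P := P) (z := y) (z' := z₀) b.le_sigmoidDeriv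
    (hgood.abs_index_le hPn hy) (hgood.abs_index_le hPn hgood.adm)
  have h6 := hgood.design_perturbed hPP ha (y - z₀)
  have h7 := (abs_le.1 (hgood.abs_score_le hPn hPP (y - z₀))).1
  have h8 : b.c₀ / 2 * (b.c₁ / 4 * ‖y - z₀‖ ^ 2) = 2 * c₂ * ‖y - z₀‖ ^ 2 := by rw [hc₂]; ring
  have h9 := mul_le_mul_of_nonneg_left h6 (by linarith : 0 ≤ b.c₀ / 2)
  generalize noise D z₀ = σ at *
  generalize (indexBound d b.B + 1) * a = t at *
  generalize ‖y - z₀‖ = x at *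
  have h10 : (σ + t) * x ≤ c₂ * x ^ 2 + (σ ^ 2 + t ^ 2) / (2 * c₂) := by
    have f1 : c₂ * x ^ 2 + (σ ^ 2 + t ^ 2) / (2 * c₂) - (σ + t) * x
        = ((2 * c₂ * x - (σ + t)) ^ 2 + (σ - t) ^ 2) / (4 * c₂) := by
      field_simp; ring
    have : 0 ≤ ((2 * c₂ * x - (σ + t)) ^ 2 + (σ - t) ^ 2) / (4 * c₂) := by positivity
    linarith
  linarith

/-- The pseudo likelihood at perturbed choice probabilities, at the true fixed effect. -/
lemma Bounds.Good.groupNLL_true_fixedEffect_le {b : Bounds d} {D : GroupData n d} {z₀ : Param d}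
    (hgood : b.Good D z₀) {P : Fin n → ℝ} {a : ℝ} (hPn : ‖P‖ ≤ 1)
    (hPP : ‖P - ccp D.X D.F z₀.1 z₀.2‖ ≤ a) (θ : Slope d) :
    groupNLL D z₀.1 θ P ≤ groupNLL D z₀.1 z₀.2 P
      + (noise D z₀ + (indexBound d b.B + 1) * a) * ‖θ - z₀.2‖
      + indexBound d b.B ^ 2 * ‖θ - z₀.2‖ ^ 2 := by
  have hB := b.indexBound_ge
  have h5 := groupNLL_upper D P (z₀.1, θ) z₀
  set w : Param d := (z₀.1, θ) - z₀ with hw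
  have hwn : ‖w‖ = ‖θ - z₀.2‖ := by
    have : w = (0, θ - z₀.2) := by rw [hw]; ext <;> simp
    rw [this]; simp [Prod.norm_def]
  have h6 := (abs_le.1 (hgood.abs_score_le hPn hPP w)).2
  have h7 : mean Finset.univ (fun i => indexCLM D.X D.F P i w ^ 2)
      ≤ (indexBound d b.B * ‖w‖) ^ 2 := by
    refine mean_le (fun i _ => ?_) (by positivity)
    rw [← sq_abs]
    exact pow_le_pow_left₀ (abs_nonneg _) (hgood.data.reg.abs_indexCLM_le hPn i w) 2
  rw [hwn] at h6 h7
  have h8 : 0 ≤ (indexBound d b.B * ‖θ - z₀.2‖) ^ 2 := sq_nonneg _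
  rw [mul_pow] at h7 h8
  change groupNLL D z₀.1 θ P ≤ _ at h5
  linarith

/-- The profile likelihood at the first-step choice probabilities grows quadratically around the
true slope, up to the squared sampling error. -/
theorem exists_profile_bounds (b : Bounds d) {η : ℝ} (hη : 0 < η) :
    ∃ τ > 0, ∃ c > 0, ∃ K > 0, ∀ (n G : ℕ) (A : Set ℝ) (Θ : Set (Slope d))
      (D : Fin G → GroupData n d) (g : Fin G) (z₀ : Param d) (κ : ℝ), IsCompact A →
      (∀ θ ∈ Θ, |θ 0| < 4) → b.Good (D g) z₀ →
      (∀ z : Param d, ‖z - z₀‖ ≤ b.s → z.1 ∈ A ∧ z.2 ∈ Θ) →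
      (∀ z : Param d, z.1 ∈ A → z.2 ∈ Θ → b.Admissible z ∧
        |noiseRem (D g) z₀ z| ≤ b.lowerConst / 4 * ‖z - z₀‖ ^ 2 + κ) →
      (∀ u, η * ‖u‖ ≤ ‖scoreDeriv (D g) z₀ u‖) → noise (D g) z₀ ≤ τ → κ ≤ τ →
      ∀ μ θ P, IsNPLEstimator A Θ D {g} μ θ P → ∃ W, ∀ θ' ∈ Θ,
        W + c * ‖θ' - z₀.2‖ ^ 2 - K * (noise (D g) z₀ ^ 2 + κ) ≤ profileNLL A (D g) θ' (P g) ∧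
        profileNLL A (D g) θ' (P g) ≤ W + K * (‖θ' - z₀.2‖ + ‖θ' - z₀.2‖ ^ 2) := by
  obtain ⟨τ₁, hτ₁, K₁, hK₁, H⟩ := exists_firstStep b hη
  have hL := b.ccpLip_ge
  have hB := b.indexBound_ge
  have hc0 := b.c₀_pos
  have hc1 := b.c₁_pos
  set L := ccpLip d b.B b.r
  set Bz := indexBound d b.B
  set Ls := L * (Bz + 1) with hLs
  have hLs0 : 0 < Ls := by positivity
  -- the first-step error `e` satisfies `L ^ 2 * e ^ 2 ≤ c₁ / 4` and `e ≤ 1` for noise below `τ`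
  set τ := min (min τ₁ 1) (min (1 / (2 * K₁)) (b.c₁ / (8 * K₁ * L ^ 2))) with hτ
  set c₂ := b.c₀ * b.c₁ / 16 with hc₂
  have hc₂0 : 0 < c₂ := by positivity
  refine ⟨τ, by positivity, c₂, hc₂0, (1 + Ls ^ 2 * K₁) / (2 * c₂) + (1 + Ls + Bz ^ 2),
    by positivity, fun n G A Θ D g z₀ κ hA hpeer hgood hint hZ hM hnoise hκτ μ θ P hP => ?_⟩
  have h1 : τ ≤ τ₁ := (min_le_left _ _).trans (min_le_left _ _)
  have h2 : τ ≤ 1 := (min_le_left _ _).trans (min_le_right _ _)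
  have h3 : τ ≤ 1 / (2 * K₁) := (min_le_right _ _).trans (min_le_left _ _)
  have h4 : τ ≤ b.c₁ / (8 * K₁ * L ^ 2) := (min_le_right _ _).trans (min_le_right _ _)
  obtain ⟨z, hz, hPz, hze⟩ := H n G A Θ D g z₀ κ hpeer hgood hint hZ hM (hnoise.trans h1) μ θ P hP
  have hz0mem := hint z₀ (by simpa using b.s_pos.le)
  have hκ : 0 ≤ κ := by
    have h0 := (hZ z₀ hz0mem.1 hz0mem.2).2
    rw [sub_self, norm_zero] at h0
    have := abs_nonneg (noiseRem (D g) z₀ z₀)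
    linarith
  set σ := noise (D g) z₀ with hσ
  have hσ0 : 0 ≤ σ := noise_nonneg _ _
  set e := ‖z - z₀‖ with he
  have he0 : 0 ≤ e := norm_nonneg _
  have hs2 : σ ^ 2 + κ ≤ 2 * τ := by nlinarith
  have he1 : e ≤ 1 := by
    have h5 := mul_le_mul_of_nonneg_left (hs2.trans (mul_le_mul_of_nonneg_left h3 zero_le_two))
      hK₁.le
    have h6 : K₁ * (2 * (1 / (2 * K₁))) = 1 := by field_simp
    nlinarith
  have heL : L ^ 2 * e ^ 2 ≤ b.c₁ / 4 := by
    have h5 := mul_le_mul_of_nonneg_left (hs2.trans (mul_le_mul_of_nonneg_left h4 zero_le_two))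
      hK₁.le
    have h6 : L ^ 2 * (K₁ * (2 * (b.c₁ / (8 * K₁ * L ^ 2)))) = b.c₁ / 4 := by field_simp; norm_num
    rw [← h6]
    exact mul_le_mul_of_nonneg_left (hze.trans h5) (sq_nonneg L)
  set P₀ := ccp (D g).X (D g).F z₀.1 z₀.2 with hP₀
  have hPn : ‖P g‖ ≤ 1 := by rw [hPz]; exact norm_ccp_le hz.lt_four
  have hPP : ‖P g - P₀‖ ≤ L * e := by
    rw [hPz]
    exact norm_ccp_sub_le hgood.data.reg b.r_nonneg b.r_lt_one hz.peer hgood.adm.peer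
  have hPP2 : (L * e) ^ 2 ≤ b.c₁ / 4 := by rw [mul_pow]; exact heL
  refine ⟨groupNLL (D g) z₀.1 z₀.2 (P g), fun θ' hθ' => ?_⟩
  obtain ⟨hμ, hmin⟩ := fixedEffect_spec hA ⟨_, hz0mem.1⟩ (D g) θ' (P g)
  rw [profileNLL_eq]
  constructor
  · have h5 := hgood.groupNLL_growth hPn hPP hPP2 hc₂
      (y := (fixedEffect A (D g) θ' (P g), θ')) (hZ _ hμ hθ').1
    refine le_trans ?_ h5
    have h11 : ‖θ' - z₀.2‖ ^ 2 ≤ ‖((fixedEffect A (D g) θ' (P g), θ') : Param d) - z₀‖ ^ 2 :=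
      pow_le_pow_left₀ (norm_nonneg _)
        (norm_snd_le (((fixedEffect A (D g) θ' (P g), θ') : Param d) - z₀)) 2
    have h12 : (σ ^ 2 + ((Bz + 1) * (L * e)) ^ 2) / (2 * c₂)
        ≤ (1 + Ls ^ 2 * K₁) / (2 * c₂) * (σ ^ 2 + κ) := by
      rw [div_mul_eq_mul_div]
      refine div_le_div_of_nonneg_right ?_ (by positivity)
      have f1 := mul_le_mul_of_nonneg_left hze (sq_nonneg Ls)
      have f2 : ((Bz + 1) * (L * e)) ^ 2 = Ls ^ 2 * e ^ 2 := by rw [hLs]; ring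
      rw [f2]
      linarith
    have h13 : 0 ≤ (1 + Ls + Bz ^ 2) * (σ ^ 2 + κ) := by positivity
    have h14 := mul_le_mul_of_nonneg_left h11 hc₂0.le
    linarith
  · refine (hmin z₀.1 hz0mem.1).trans ((hgood.groupNLL_true_fixedEffect_le hPn hPP θ').trans ?_)
    have hx := norm_nonneg (θ' - z₀.2)
    generalize ‖θ' - z₀.2‖ = x at hx ⊢
    have h8 : (σ + (Bz + 1) * (L * e)) * x ≤ (1 + Ls) * x := by
      refine mul_le_mul_of_nonneg_right ?_ hx
      have f1 : (Bz + 1) * (L * e) = Ls * e := by rw [hLs]; ring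
      have f2 := mul_le_mul_of_nonneg_left he1 hLs0.le
      linarith
    have h9 : 0 ≤ (1 + Ls ^ 2 * K₁) / (2 * c₂) * (x + x ^ 2) := by positivity
    have h10 : 0 ≤ (1 + Ls) * x ^ 2 + Bz ^ 2 * x := by positivity
    linarith

/-! ### Classification by the C-Lasso -/

lemma exists_separation {ι V : Type*} [Finite ι] [NormedAddCommGroup V] {v : ι → V}
    (hv : Function.Injective v) : ∃ δ > 0, ∀ k l, k ≠ l → δ ≤ ‖v k - v l‖ := by
  have := Fintype.ofFinite ι
  classical
  by_cases h : ((Finset.univ : Finset (ι × ι)).filter fun p => p.1 ≠ p.2).Nonempty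
  · obtain ⟨p, hp, hmin⟩ := Finset.exists_min_image _ (fun p : ι × ι => ‖v p.1 - v p.2‖) h
    refine ⟨‖v p.1 - v p.2‖, norm_pos_iff.2 (sub_ne_zero.2 fun e => ?_), fun k l hkl =>
      hmin (k, l) (by simpa using hkl)⟩
    exact (Finset.mem_filter.1 hp).2 (hv e)
  · refine ⟨1, one_pos, fun k l hkl => absurd ⟨(k, l), ?_⟩ h⟩
    simpa using hkl

/-- A mean of nonnegative numbers that is small forces some member of each non-negligible cluster to
be small. -/
lemma exists_le_of_mean_le {K₀ : ℕ} {k₀ : Fin G → Fin K₀} {c a : ℝ} (hG : 0 < G) (hc : 0 < c)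
    {l : Fin K₀} (hl : c * G ≤ (cluster k₀ l).card) {f : Fin G → ℝ} (hf : ∀ g, 0 ≤ f g)
    (ha : mean Finset.univ f ≤ a) : ∃ g, k₀ g = l ∧ f g ≤ a / c := by
  have hG' : (0 : ℝ) < G := by exact_mod_cast hG
  have hcard : (0 : ℝ) < (cluster k₀ l).card := (by positivity : 0 < c * G).trans_le hl
  have hne : (cluster k₀ l).Nonempty := Finset.card_pos.1 (by exact_mod_cast hcard)
  by_contra! hcon
  have h1 : (cluster k₀ l).card * (a / c) < ∑ g ∈ cluster k₀ l, f g := by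
    rw [← nsmul_eq_mul, ← Finset.sum_const]
    exact Finset.sum_lt_sum_of_nonempty hne fun g hg => hcon g (Finset.mem_filter.1 hg).2
  have h2 : ∑ g ∈ cluster k₀ l, f g ≤ ∑ g, f g :=
    Finset.sum_le_sum_of_subset_of_nonneg (Finset.subset_univ _) fun g _ _ => hf g
  have h3 : ∑ g, f g ≤ G * a := by
    unfold mean at ha
    rw [Finset.card_univ, Fintype.card_fin, one_div, inv_mul_le_iff₀ hG'] at ha
    exact ha
  have ha0 : 0 ≤ a := (mean_nonneg fun g _ => hf g).trans ha
  have h4 : G * a ≤ (cluster k₀ l).card * (a / c) := by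
    rw [mul_div_assoc', le_div_iff₀ hc]
    nlinarith
  linarith

lemma classoObjective_eq {A : Set ℝ} {ρ : ℝ} {D : Fin G → GroupData n d} {P : Fin G → Fin n → ℝ}
    {K : ℕ} (θ : Fin G → Slope d) (v : Fin K → Slope d) :
    classoObjective A ρ D P θ v = mean Finset.univ fun g =>
      profileNLL A (D g) (θ g) (P g) + ρ * ∏ k, ‖θ g - v k‖ := by
  rw [mean_add, mean_const_mul]
  simp only [classoObjective, mean, Finset.card_univ, Fintype.card_fin]
  ring

/-- With the true number of clusters, the C-Lasso classifies all groups correctly, up to a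
permutation of the labels. Comparison with the truth shows that the penalty is small on average,
which places a center close to every true slope; the optimality of a single slope then keeps it
close to its center. -/
theorem exists_classification {K₀ : ℕ} {v₀ : Fin K₀ → Slope d} (hv₀ : Function.Injective v₀)
    {c K cm : ℝ} (hc : 0 < c) (hK : 0 < K) (hcm : 0 < cm) :
    ∃ τ > 0, ∀ (n G : ℕ) (A : Set ℝ) (Θ : Set (Slope d)) (D : Fin G → GroupData n d)
      (P : Fin G → Fin n → ℝ) (ρ : ℝ) (k₀ : Fin G → Fin K₀) (W s : Fin G → ℝ), 0 < G → 0 < ρ →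
      (∀ l, v₀ l ∈ Θ) →
      (∀ g, ∀ θ ∈ Θ, W g + c * ‖θ - v₀ (k₀ g)‖ ^ 2 - s g ≤ profileNLL A (D g) θ (P g) ∧
        profileNLL A (D g) θ (P g)
          ≤ W g + K * (‖θ - v₀ (k₀ g)‖ + ‖θ - v₀ (k₀ g)‖ ^ 2)) →
      (∀ g, s g ≤ τ) → mean Finset.univ s ≤ τ → mean Finset.univ s ≤ τ * ρ →
      (∀ l, cm * G ≤ (cluster k₀ l).card) →
      ∀ θ v cl, IsCLasso A Θ ρ D P θ v → IsNearest θ v cl →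
        ∃ e : Fin K₀ ≃ Fin K₀, ∀ g, cl g = e (k₀ g) := by
  obtain ⟨δ, hδ, hsep⟩ := exists_separation hv₀
  -- `ε` bounds the distance of the centers to the true slopes
  set ε := min (min 1 (δ / 8)) (c * (δ / 4) ^ 2 / (4 * K)) with hε
  have hε0 : 0 < ε := by positivity
  have hε1 : ε ≤ 1 := (min_le_left _ _).trans (min_le_left _ _)
  have hε2 : ε ≤ δ / 8 := (min_le_left _ _).trans (min_le_right _ _)
  have hε3 : K * (ε + ε ^ 2) ≤ c * (δ / 4) ^ 2 / 2 := by
    have h1 : ε ≤ c * (δ / 4) ^ 2 / (4 * K) := min_le_right _ _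
    rw [le_div_iff₀ (by positivity)] at h1
    have h2 : ε ^ 2 ≤ ε := by nlinarith
    have h3 := mul_le_mul_of_nonneg_left h2 hK.le
    linarith
  -- a group with squared distance and penalty at most `ω` has its own slope within `ε / 2` of the
  -- truth and of some center
  set ω := min ((ε / 2) ^ 2) ((ε / 2) ^ K₀ / 2) with hω
  have hω0 : 0 < ω := by positivity
  set τ := min (c * (δ / 4) ^ 2 / 2) (ω * cm / (1 + 1 / c)) with hτ
  have hτ0 : 0 < τ := by positivity
  refine ⟨τ, hτ0, fun n G A Θ D P ρ k₀ W s hG hρ hvΘ hQ hsτ hs1 hs2 hprop θ v cl hmin hnear => ?_⟩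
  have hτ1 : τ ≤ c * (δ / 4) ^ 2 / 2 := min_le_left _ _
  have hτ2 : (τ + τ / c) / cm ≤ ω := by
    have h1 : τ ≤ ω * cm / (1 + 1 / c) := min_le_right _ _
    rw [le_div_iff₀ (by positivity)] at h1
    rw [div_le_iff₀ hcm]
    calc τ + τ / c = τ * (1 + 1 / c) := by ring
      _ ≤ _ := h1
  set pen : Fin G → ℝ := fun g => ∏ k, ‖θ g - v k‖ with hpen
  have hpen0 : ∀ g, 0 ≤ pen g := fun g => Finset.prod_nonneg fun k _ => norm_nonneg _
  set q : Fin G → ℝ := fun g => ‖θ g - v₀ (k₀ g)‖ ^ 2 with hq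
  have hcomp : c * mean Finset.univ q + ρ * mean Finset.univ pen ≤ mean Finset.univ s := by
    have h1 := hmin.isMin (fun g => v₀ (k₀ g)) v₀ (fun g => hvΘ _) hvΘ
    rw [classoObjective_eq, classoObjective_eq] at h1
    have h2 : mean Finset.univ (fun g => W g + (c * q g - s g + ρ * pen g))
        ≤ mean Finset.univ (fun g => profileNLL A (D g) (θ g) (P g) + ρ * ∏ k, ‖θ g - v k‖) :=
      mean_mono fun g _ => by
        have := (hQ g (θ g) (hmin.mem_θ g)).1
        simp only [hq, hpen]
        linarith
    have h3 : mean Finset.univ (fun g => profileNLL A (D g) (v₀ (k₀ g)) (P g)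
        + ρ * ∏ k, ‖v₀ (k₀ g) - v₀ k‖) ≤ mean Finset.univ W :=
      mean_mono fun g _ => by
        have h4 := (hQ g (v₀ (k₀ g)) (hvΘ _)).2
        have h5 : ∏ k, ‖v₀ (k₀ g) - v₀ k‖ = 0 :=
          Finset.prod_eq_zero (Finset.mem_univ (k₀ g)) (by simp)
        rw [h5]
        simp only [sub_self, norm_zero] at h4
        linarith
    have h6 := h2.trans (h1.trans h3)
    rw [mean_add, mean_add, mean_sub, mean_const_mul, mean_const_mul] at h6
    linarith
  have hq0 : 0 ≤ mean Finset.univ q := mean_nonneg fun g _ => sq_nonneg _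
  have hp0 : 0 ≤ mean Finset.univ pen := mean_nonneg fun g _ => hpen0 g
  have hqτ : mean Finset.univ q ≤ τ / c := by
    rw [le_div_iff₀ hc]; nlinarith
  have hpτ : mean Finset.univ pen ≤ τ := by
    by_contra! hcon
    nlinarith [mul_nonneg hc.le hq0, mul_lt_mul_of_pos_left hcon hρ]
  -- some group of each true cluster has a small error and a small penalty, and a product is small
  -- only if one of its factors is
  have hclose : ∀ l, ∃ k, ‖v₀ l - v k‖ < ε := by
    intro l
    obtain ⟨g, hg, hle⟩ := exists_le_of_mean_le hG hcm (hprop l) (f := fun g => pen g + q g)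
      (fun g => add_nonneg (hpen0 g) (sq_nonneg _)) (a := τ + τ / c)
      (by rw [mean_add]; exact add_le_add hpτ hqτ)
    have h1 := hle.trans hτ2
    have h2 : ‖θ g - v₀ l‖ ≤ ε / 2 := by
      have h3 : ‖θ g - v₀ l‖ ^ 2 ≤ (ε / 2) ^ 2 := by
        have : q g ≤ (ε / 2) ^ 2 := by
          have := min_le_left ((ε / 2) ^ 2) ((ε / 2) ^ K₀ / 2)
          linarith [hpen0 g]
        simp only [hq] at this
        rwa [hg] at this
      exact (pow_le_pow_iff_left₀ (norm_nonneg _) (by positivity) two_ne_zero).1 h3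
    have h4 : ∃ k, ‖θ g - v k‖ < ε / 2 := by
      by_contra! hcon
      have h5 : (ε / 2) ^ K₀ ≤ pen g := by
        have := Finset.prod_le_prod (s := Finset.univ) (f := fun _ : Fin K₀ => ε / 2)
          (g := fun k => ‖θ g - v k‖) (fun _ _ => by positivity) (fun k _ => hcon k)
        rw [Finset.prod_const, Finset.card_univ, Fintype.card_fin] at this
        exact this
      have h6 := min_le_right ((ε / 2) ^ 2) ((ε / 2) ^ K₀ / 2)
      have h7 : 0 < (ε / 2) ^ K₀ := by positivity
      have h8 : 0 ≤ q g := sq_nonneg _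
      linarith
    obtain ⟨k, hk⟩ := h4
    refine ⟨k, ?_⟩
    have h5 := norm_sub_le_norm_sub_add_norm_sub (v₀ l) (θ g) (v k)
    rw [norm_sub_rev (v₀ l) (θ g)] at h5
    linarith
  choose f hf using hclose
  have hinj : Function.Injective f := by
    intro l l' hll
    by_contra hne
    have h1 := hsep l l' hne
    have h2 := norm_sub_le_norm_sub_add_norm_sub (v₀ l) (v (f l)) (v₀ l')
    have h3 := hf l'
    rw [← hll, norm_sub_rev] at h3
    linarith [hf l]
  refine ⟨Equiv.ofBijective f (Finite.injective_iff_bijective.1 hinj), fun g => ?_⟩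
  rw [Equiv.ofBijective_apply]
  have hθg : ‖θ g - v₀ (k₀ g)‖ ≤ δ / 4 := by
    have h1 := hmin.isMin (Function.update θ g (v (f (k₀ g)))) v (fun g' => by
      by_cases e : g' = g
      · subst e; simpa using hmin.mem_v _
      · simpa [e] using hmin.mem_θ g') hmin.mem_v
    rw [classoObjective_eq, classoObjective_eq] at h1
    unfold mean at h1
    have hcard : (0 : ℝ) < 1 / ((Finset.univ : Finset (Fin G)).card : ℝ) := by
      rw [Finset.card_univ, Fintype.card_fin]
      have : (0 : ℝ) < G := by exact_mod_cast hG
      positivity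
    have h2 := le_of_mul_le_mul_left h1 hcard
    rw [← Finset.add_sum_erase _ _ (Finset.mem_univ g),
      ← Finset.add_sum_erase _ _ (Finset.mem_univ g)] at h2
    have h3 : ∑ x ∈ Finset.univ.erase g, (profileNLL A (D x)
        (Function.update θ g (v (f (k₀ g))) x) (P x)
        + ρ * ∏ k, ‖Function.update θ g (v (f (k₀ g))) x - v k‖)
        = ∑ x ∈ Finset.univ.erase g, (profileNLL A (D x) (θ x) (P x)
          + ρ * ∏ k, ‖θ x - v k‖) :=
      Finset.sum_congr rfl fun x hx => by rw [Function.update_of_ne (Finset.ne_of_mem_erase hx)]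
    have h4 : ∏ k, ‖v (f (k₀ g)) - v k‖ = 0 :=
      Finset.prod_eq_zero (Finset.mem_univ (f (k₀ g))) (by simp)
    rw [h3, Function.update_self, h4, mul_zero] at h2
    have h5 := (hQ g (θ g) (hmin.mem_θ g)).1
    have h6 := (hQ g (v (f (k₀ g))) (hmin.mem_v _)).2
    have h7 : ‖v (f (k₀ g)) - v₀ (k₀ g)‖ ≤ ε := by rw [norm_sub_rev]; exact (hf _).le
    have h8 : K * (‖v (f (k₀ g)) - v₀ (k₀ g)‖ + ‖v (f (k₀ g)) - v₀ (k₀ g)‖ ^ 2)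
        ≤ K * (ε + ε ^ 2) := by gcongr
    have h9 : 0 ≤ ρ * ∏ k, ‖θ g - v k‖ := mul_nonneg hρ.le (hpen0 g)
    have h10 : c * ‖θ g - v₀ (k₀ g)‖ ^ 2 ≤ c * (δ / 4) ^ 2 := by linarith [hsτ g]
    have h11 := le_of_mul_le_mul_left h10 hc
    exact (pow_le_pow_iff_left₀ (norm_nonneg _) (by positivity) two_ne_zero).1 h11
  obtain ⟨l', hl'⟩ := (Finite.injective_iff_bijective.1 hinj).2 (cl g)
  by_contra hne
  have hll : k₀ g ≠ l' := fun e => hne (by rw [e, hl'])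
  have h1 := hsep _ _ hll
  have h2 := hnear g (f (k₀ g))
  rw [← hl'] at h2
  have h3 := norm_sub_le_norm_sub_add_norm_sub (θ g) (v₀ (k₀ g)) (v (f (k₀ g)))
  have h4 := norm_sub_le_norm_sub_add_norm_sub (v₀ (k₀ g)) (θ g) (v₀ l')
  have h5 := norm_sub_le_norm_sub_add_norm_sub (θ g) (v (f l')) (v₀ l')
  have h6 := hf l'
  rw [norm_sub_rev] at h6
  rw [norm_sub_rev (v₀ (k₀ g)) (θ g)] at h4
  linarith [hf (k₀ g)]

end Lasso

section Selection
variable {n d G : ℕ}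

/-! ### The information criterion -/

lemma sum_cluster {K : ℕ} (cl : Fin G → Fin K) (f : Fin G → ℝ) :
    ∑ k, ∑ g ∈ cluster cl k, f g = ∑ g, f g :=
  Finset.sum_fiberwise Finset.univ cl f

lemma infoCriterion_eq {A : Set ℝ} {lam : ℝ} {D : Fin G → GroupData n d} {K : ℕ}
    (cl : Fin G → Fin K) (θ : Fin K → Slope d) (P : Fin G → Fin n → ℝ) :
    infoCriterion A lam D cl θ P
      = mean Finset.univ (fun g => profileNLL A (D g) (θ (cl g)) (P g)) + lam * (d + 1) * K := by
  have h : ∑ k, ∑ g ∈ cluster cl k, ∑ i,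
      unitNLL (D g) (P g) (θ k) (fixedEffect A (D g) (θ k) (P g)) i
      = ∑ g, ∑ i, unitNLL (D g) (P g) (θ (cl g)) (fixedEffect A (D g) (θ (cl g)) (P g)) i := by
    rw [← sum_cluster cl]
    refine Finset.sum_congr rfl fun k _ => Finset.sum_congr rfl fun g hg => ?_
    rw [(Finset.mem_filter.1 hg).2]
  unfold infoCriterion
  rw [h]
  simp only [mean, profileNLL, Finset.card_univ, Fintype.card_fin]
  rw [← Finset.mul_sum]
  ring

/-- Means over all groups can be compared cluster by cluster. -/
lemma mean_univ_mono_of_cluster {K : ℕ} (cl : Fin G → Fin K) {f h : Fin G → ℝ}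
    (H : ∀ k, mean (cluster cl k) f ≤ mean (cluster cl k) h) :
    mean Finset.univ f ≤ mean Finset.univ h := by
  unfold mean
  refine mul_le_mul_of_nonneg_left ?_ (by positivity)
  rw [← sum_cluster cl f, ← sum_cluster cl h]
  refine Finset.sum_le_sum fun k _ => ?_
  rcases (cluster cl k).eq_empty_or_nonempty with h0 | h0
  · rw [h0]; simp
  · have h1 := H k
    unfold mean at h1
    have : 0 < (cluster cl k).card := Finset.card_pos.2 h0
    exact le_of_mul_le_mul_left h1 (by positivity)

/-- On the event that all sampling errors are small, the information criterion selects the true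
number of clusters. With too few clusters, some true slope is far from all estimates and the
likelihood deteriorates by a constant; with too many, the likelihood improves by less than the
penalty. -/
theorem exists_selection (b : Bounds d) {η : ℝ} (hη : 0 < η) {K₀ : ℕ} {v₀ : Fin K₀ → Slope d}
    (hv₀ : Function.Injective v₀) {cm : ℝ} (hcm : 0 < cm) :
    ∃ τ > 0, ∀ (n G : ℕ) (A : Set ℝ) (Θ : Set (Slope d)) (D : Fin G → GroupData n d)
      (k₀ : Fin G → Fin K₀) (μ₀ : Fin G → ℝ) (ρ lam κ ω : ℝ) (Kmax K : ℕ), 0 < G → 0 < ρ → 0 < lam →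
      IsCompact A → (∀ θ ∈ Θ, |θ 0| < 4) →
      (∀ g, b.Good (D g) (μ₀ g, v₀ (k₀ g))) →
      (∀ g, ∀ z : Param d, ‖z - (μ₀ g, v₀ (k₀ g))‖ ≤ b.s → z.1 ∈ A ∧ z.2 ∈ Θ) →
      (∀ g, ∀ z : Param d, z.1 ∈ A → z.2 ∈ Θ → b.Admissible z ∧
        |noiseRem (D g) (μ₀ g, v₀ (k₀ g)) z|
          ≤ b.lowerConst / 4 * ‖z - (μ₀ g, v₀ (k₀ g))‖ ^ 2 + κ) →
      (∀ g u, η * ‖u‖ ≤ ‖scoreDeriv (D g) (μ₀ g, v₀ (k₀ g)) u‖) →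
      (∀ k, ∀ u : Slope d, ∃ w : Slope d, ‖w‖ ≤ 1 ∧
        η * ‖u‖ ≤ concentratedJacobian D (cluster k₀ k) μ₀ (v₀ k) u w) →
      (∀ k, cm * G ≤ (cluster k₀ k).card) →
      (∀ g, noise (D g) (μ₀ g, v₀ (k₀ g)) ≤ τ) → 0 ≤ κ → κ ≤ τ → lam ≤ τ →
      ω ≤ 1 → ω ≤ ρ → ω ≤ lam →
      mean Finset.univ (fun g => noise (D g) (μ₀ g, v₀ (k₀ g)) ^ 2) + κ ≤ τ * ω →
      K₀ ∈ Finset.Icc 1 Kmax → IsSelected A Θ ρ lam D Kmax K → K = K₀ := by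
  obtain ⟨τ₁, hτ₁, c₁, hc₁, K₁, hK₁, H1⟩ := exists_profile_bounds b hη
  obtain ⟨τ₂, hτ₂, H2⟩ := exists_classification hv₀ hc₁ hK₁ hcm
  obtain ⟨τ₃, hτ₃, K₃, hK₃, H3⟩ := exists_nplFixedPoint b hη
  obtain ⟨δ, hδ, hsep⟩ := exists_separation hv₀
  have hlc := b.lowerConst_pos
  -- `Cs` collects the constants of the sampling errors in the lower and the upper bound for the
  -- criterion; `t5` excludes too many clusters and `t6` excludes too few
  set Cs := 4 / b.lowerConst + 4 + K₃ with hCs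
  have hCs0 : 0 < Cs := by positivity
  set τ := min (min (min τ₁ τ₃) (min 1 (τ₂ / (2 * K₁))))
    (min (1 / (2 * Cs)) (b.lowerConst * cm * (δ / 4) ^ 2 / (Cs + (d + 1) * K₀))) with hτ
  have hτ0 : 0 < τ := by positivity
  have t1 : τ ≤ τ₁ := (min_le_left _ _).trans ((min_le_left _ _).trans (min_le_left _ _))
  have t2 : τ ≤ τ₃ := (min_le_left _ _).trans ((min_le_left _ _).trans (min_le_right _ _))
  have t3 : τ ≤ 1 := (min_le_left _ _).trans ((min_le_right _ _).trans (min_le_left _ _))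
  have t4 : K₁ * (2 * τ) ≤ τ₂ := by
    have : τ ≤ τ₂ / (2 * K₁) :=
      (min_le_left _ _).trans ((min_le_right _ _).trans (min_le_right _ _))
    rw [le_div_iff₀ (by positivity)] at this
    linarith
  have t5 : Cs * τ < 1 := by
    have : τ ≤ 1 / (2 * Cs) := (min_le_right _ _).trans (min_le_left _ _)
    rw [le_div_iff₀ (by positivity)] at this
    linarith
  have t6 : τ * (Cs + (d + 1) * K₀) ≤ b.lowerConst * cm * (δ / 4) ^ 2 := by
    have : τ ≤ b.lowerConst * cm * (δ / 4) ^ 2 / (Cs + (d + 1) * K₀) :=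
      (min_le_right _ _).trans (min_le_right _ _)
    rwa [le_div_iff₀ (by positivity)] at this
  refine ⟨τ, hτ0, fun n G A Θ D k₀ μ₀ ρ lam κ ω Kmax K hG hρ hlam hA hpeer hgood hint hZ hM hconc
    hprop hnoise hκ0 hκ hlamτ hω1 hωρ hωl hmean hK₀ hsel => ?_⟩
  clear_value τ
  set N : Fin G → ℝ := fun g => noise (D g) (μ₀ g, v₀ (k₀ g)) ^ 2 with hN
  set L₀ : ℝ := mean Finset.univ fun g => eqNLL (D g) (μ₀ g, v₀ (k₀ g)) with hL₀
  have hN0 : 0 ≤ mean Finset.univ N := mean_nonneg fun g _ => sq_nonneg _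
  have huniv : (Finset.univ : Finset (Fin G)).Nonempty := ⟨⟨0, hG⟩, Finset.mem_univ _⟩
  have hvΘ : ∀ l, v₀ l ∈ Θ := by
    intro l
    have hG' : (0 : ℝ) < G := by exact_mod_cast hG
    have hpos : (0 : ℝ) < (cluster k₀ l).card := (by positivity : 0 < cm * G).trans_le (hprop l)
    obtain ⟨g, hg⟩ := Finset.card_pos.1 (by exact_mod_cast hpos : 0 < (cluster k₀ l).card)
    have := (hint g (μ₀ g, v₀ (k₀ g)) (by simpa using b.s_pos.le)).2
    rwa [(Finset.mem_filter.1 hg).2] at this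
  obtain ⟨P, IC, hP, hIC, hK, hmin⟩ := hsel
  -- a lower bound for the criterion, for any classification
  have hlower : ∀ (K : ℕ) (cl : Fin G → Fin K) (μ' : Fin G → ℝ) (θ' : Fin K → Slope d)
      (P' : Fin G → Fin n → ℝ), (∀ k, IsNPLEstimator A Θ D (cluster cl k) μ' (θ' k) P') →
      L₀ + b.lowerConst * mean Finset.univ (fun g => ‖θ' (cl g) - v₀ (k₀ g)‖ ^ 2)
        - (4 / b.lowerConst * mean Finset.univ N + 4 * κ) + lam * (d + 1) * K
        ≤ infoCriterion A lam D cl θ' P' := by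
    intro K cl μ' θ' P' hest
    rw [infoCriterion_eq]
    have h1 : mean Finset.univ (fun g => (eqNLL (D g) (μ₀ g, v₀ (k₀ g))
        + b.lowerConst * ‖θ' (cl g) - v₀ (k₀ g)‖ ^ 2) - (4 / b.lowerConst * N g + 4 * κ))
        ≤ mean Finset.univ (fun g => profileNLL A (D g) (θ' (cl g)) (P' g)) := by
      refine mean_mono fun g _ => ?_
      have hfix := (hest (cl g)).fixedPoint
      have hg : g ∈ cluster cl (cl g) := Finset.mem_filter.2 ⟨Finset.mem_univ _, rfl⟩
      rw [hfix.profileNLL_eq hA hpeer hg]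
      obtain ⟨hadm, hrem⟩ := hZ g (μ' g, θ' (cl g)) (hfix.mem_A g hg) hfix.mem_Θ
      have h2 := (hgood g).eqNLL_lower hadm hrem
      have h3 : ‖θ' (cl g) - v₀ (k₀ g)‖ ^ 2
          ≤ ‖((μ' g, θ' (cl g)) : Param d) - (μ₀ g, v₀ (k₀ g))‖ ^ 2 :=
        pow_le_pow_left₀ (norm_nonneg _)
          (norm_snd_le (((μ' g, θ' (cl g)) : Param d) - (μ₀ g, v₀ (k₀ g)))) 2
      have h4 := mul_le_mul_of_nonneg_left h3 hlc.le
      simp only [hN]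
      linarith
    rw [mean_sub, mean_add, mean_add, mean_const_mul, mean_const_mul, mean_const huniv] at h1
    linarith
  -- an upper bound for the criterion at the true number of clusters
  have hupper : IC K₀ ≤ L₀ + K₃ * mean Finset.univ N + lam * (d + 1) * K₀ := by
    obtain ⟨θ, v, cl, μ', θ', P', hlasso, hnear, hest, hval⟩ := hIC K₀ hK₀
    have hprof : ∀ g, ∃ W, ∀ θ ∈ Θ,
        W + c₁ * ‖θ - v₀ (k₀ g)‖ ^ 2 - K₁ * (N g + κ) ≤ profileNLL A (D g) θ (P g) ∧
        profileNLL A (D g) θ (P g)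
          ≤ W + K₁ * (‖θ - v₀ (k₀ g)‖ + ‖θ - v₀ (k₀ g)‖ ^ 2) := by
      intro g
      obtain ⟨μ, θ, hnpl⟩ := hP g
      exact H1 n G A Θ D g (μ₀ g, v₀ (k₀ g)) κ hA hpeer (hgood g) (hint g) (hZ g) (hM g)
        ((hnoise g).trans t1) (hκ.trans t1) μ θ P hnpl
    choose W hW using hprof
    have hms : mean Finset.univ (fun g => K₁ * (N g + κ)) = K₁ * (mean Finset.univ N + κ) := by
      rw [mean_const_mul, mean_add, mean_const huniv]
    have hτω : ∀ x, ω ≤ x → 0 ≤ x → K₁ * (mean Finset.univ N + κ) ≤ τ₂ * x := by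
      intro x hx hx0
      calc K₁ * (mean Finset.univ N + κ) ≤ K₁ * (τ * ω) := mul_le_mul_of_nonneg_left hmean hK₁.le
        _ ≤ K₁ * (τ * x) := by gcongr
        _ = (K₁ * τ) * x := by ring
        _ ≤ τ₂ * x := mul_le_mul_of_nonneg_right (by nlinarith) hx0
    obtain ⟨e, he⟩ := H2 n G A Θ D P ρ k₀ W (fun g => K₁ * (N g + κ)) hG hρ hvΘ hW
      (fun g => by
        refine le_trans (mul_le_mul_of_nonneg_left ?_ hK₁.le) t4
        have h1 := hnoise g
        have h2 := noise_nonneg (D g) (μ₀ g, v₀ (k₀ g))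
        have h3 : N g ≤ τ := by
          simp only [hN]
          nlinarith
        linarith)
      (by rw [hms]; simpa using hτω 1 hω1 zero_le_one) (by rw [hms]; exact hτω ρ hωρ hρ.le)
      hprop θ v cl hlasso hnear
    have hcl : ∀ l, cluster cl (e l) = cluster k₀ l := by
      intro l
      unfold cluster
      refine Finset.filter_congr fun g _ => ?_
      rw [he g]
      exact e.injective.eq_iff
    rw [hval, infoCriterion_eq]
    have h1 : mean Finset.univ (fun g => profileNLL A (D g) (θ' (cl g)) (P' g))
        ≤ mean Finset.univ (fun g => eqNLL (D g) (μ₀ g, v₀ (k₀ g)) + K₃ * N g) := by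
      refine mean_univ_mono_of_cluster k₀ fun l => ?_
      have hk : ∀ g ∈ cluster k₀ l, k₀ g = l := fun g hg => (Finset.mem_filter.1 hg).2
      have hest' := hest (e l)
      rw [hcl] at hest'
      have hne : (cluster k₀ l).Nonempty := by
        have hG' : (0 : ℝ) < G := by exact_mod_cast hG
        have hpos : (0 : ℝ) < (cluster k₀ l).card := (by positivity : 0 < cm * G).trans_le (hprop l)
        exact Finset.card_pos.1 (by exact_mod_cast hpos)
      obtain ⟨μ₁, θ₁, P₁, hfix, hle⟩ := H3 n G A Θ D (cluster k₀ l) μ₀ (v₀ l) hpeer hne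
        (fun g hg => by have := hgood g; rwa [hk g hg] at this)
        (fun g hg => by have := hint g; rwa [hk g hg] at this) (hconc l)
        (fun g hg => by have := (hnoise g).trans t2; rwa [hk g hg] at this)
      have h2 := (hest'.best _ _ _ hfix).trans hle
      rw [hest'.fixedPoint.pooledNLL_eq hpeer] at h2
      rw [mean_add, mean_const_mul]
      have h3 : mean (cluster k₀ l) (fun g => profileNLL A (D g) (θ' (cl g)) (P' g))
          = mean (cluster k₀ l) (fun g => eqNLL (D g) (μ' g, θ' (e l))) :=
        mean_congr fun g hg => by
          rw [he g, hk g hg, hest'.fixedPoint.profileNLL_eq hA hpeer hg]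
      have h4 : mean (cluster k₀ l) (fun g => eqNLL (D g) (μ₀ g, v₀ (k₀ g)))
          = mean (cluster k₀ l) (fun g => eqNLL (D g) (μ₀ g, v₀ l)) :=
        mean_congr fun g hg => by rw [hk g hg]
      have h5 : mean (cluster k₀ l) N
          = mean (cluster k₀ l) (fun g => noise (D g) (μ₀ g, v₀ l) ^ 2) :=
        mean_congr fun g hg => by simp only [hN]; rw [hk g hg]
      rw [h3, h4, h5]
      exact h2
    rw [mean_add, mean_const_mul] at h1
    linarith
  obtain ⟨θ, v, cl, μ', θ', P', -, -, hest, hval⟩ := hIC K hK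
  have h1 := hlower K cl μ' θ' P' hest
  rw [← hval] at h1
  have h2 := hmin K₀ hK₀
  set M := mean Finset.univ (fun g => ‖θ' (cl g) - v₀ (k₀ g)‖ ^ 2) with hM'
  have hM0 : 0 ≤ M := mean_nonneg fun g _ => sq_nonneg _
  have h3 : b.lowerConst * M + lam * (d + 1) * K ≤ Cs * (τ * ω) + lam * (d + 1) * K₀ := by
    have h4 := mul_le_mul_of_nonneg_left hmean hCs0.le
    have h5 : 4 / b.lowerConst * mean Finset.univ N + 4 * κ + K₃ * mean Finset.univ N
        ≤ Cs * (mean Finset.univ N + κ) := by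
      have : 0 ≤ 4 / b.lowerConst * κ + 4 * mean Finset.univ N + K₃ * κ := by positivity
      rw [hCs]
      linarith
    linarith
  refine le_antisymm ?_ ?_
  · by_contra! hlt
    have h4 : (K₀ : ℝ) + 1 ≤ K := by exact_mod_cast hlt
    have h5 := mul_le_mul_of_nonneg_left h4 (by positivity : 0 ≤ lam * (d + 1))
    have h6 : Cs * (τ * ω) ≤ Cs * τ * lam := by
      rw [mul_assoc]; gcongr
    have h7 : Cs * τ * lam < 1 * lam := mul_lt_mul_of_pos_right t5 hlam
    have h8 : 0 ≤ b.lowerConst * M := by positivity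
    have h9 : 0 ≤ lam * d := by positivity
    linarith
  · have h4 : b.lowerConst * M ≤ b.lowerConst * (cm * (δ / 4) ^ 2) := by
      have h5 : Cs * (τ * ω) ≤ Cs * τ := by
        have := mul_le_mul_of_nonneg_left hω1 (by positivity : 0 ≤ Cs * τ)
        linarith
      have h6 : lam * ((d + 1) * K₀) ≤ τ * ((d + 1) * K₀) := by gcongr
      have h7 : 0 ≤ lam * (d + 1) * K := by positivity
      linarith
    have h5 := le_of_mul_le_mul_left h4 hlc
    -- every true slope is close to an estimate, and no estimate is close to two true slopes
    have h6 : ∀ l, ∃ k, ‖θ' k - v₀ l‖ ≤ δ / 4 := by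
      intro l
      obtain ⟨g, hg, hle⟩ := exists_le_of_mean_le hG hcm (hprop l)
        (f := fun g => ‖θ' (cl g) - v₀ (k₀ g)‖ ^ 2) (fun g => sq_nonneg _) h5
      rw [mul_div_cancel_left₀ _ hcm.ne', hg] at hle
      exact ⟨cl g, (pow_le_pow_iff_left₀ (norm_nonneg _) (by positivity) two_ne_zero).1 hle⟩
    choose f hf using h6
    have hinj : Function.Injective f := by
      intro l l' hll
      by_contra hne
      have h7 := hsep l l' hne
      have h8 := norm_sub_le_norm_sub_add_norm_sub (v₀ l) (θ' (f l)) (v₀ l')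
      have h9 := hf l'
      rw [← hll] at h9
      have h10 := hf l
      rw [norm_sub_rev] at h10
      linarith
    simpa using Fintype.card_le_of_injective f hinj

end Selection

section Residuals
variable {n d G : ℕ}

/-! ### Measurability in the public information -/

section Measurability
variable {α : Type*} [MeasurableSpace α] {X : α → Fin n → Fin d → ℝ}
  {F : α → Fin n → Fin n → Bool} {P : α → Fin n → ℝ}

lemma measurable_peerAvg (hF : Measurable F) (hP : Measurable P) :
    Measurable fun x => peerAvg (F x) (P x) := by
  refine measurable_pi_lambda _ fun i => ?_
  simp only [peerAvg_eq]
  refine Finset.measurable_sum _ fun j _ => Measurable.mul ?_ (measurable_pi_iff.1 hP j)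
  have h : Measurable fun F : Fin n → Fin n → Bool => peerWeight F i j := measurable_of_countable _
  exact h.comp hF

lemma measurable_indexCLM (hX : Measurable X) (hF : Measurable F) (hP : Measurable P) (z : Param d)
    (i : Fin n) : Measurable fun x => indexCLM (X x) (F x) (P x) i z := by
  simp only [indexCLM_apply, index]
  refine Measurable.add_const (Measurable.add ?_ ?_) _
  · exact (measurable_pi_iff.1 (measurable_peerAvg hF hP) i).mul_const _
  · refine Finset.measurable_sum _ fun j _ => Measurable.mul_const ?_ _
    exact measurable_pi_iff.1 (measurable_pi_iff.1 hX i) j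

lemma measurable_bestResponse (hX : Measurable X) (hF : Measurable F) (hP : Measurable P)
    (z : Param d) : Measurable fun x => bestResponse (X x) (F x) z.1 z.2 (P x) := by
  refine measurable_pi_lambda _ fun i => ?_
  simp only [bestResponse, index_eq]
  exact continuous_sigmoid.measurable.comp (measurable_indexCLM hX hF hP _ i)

/-- Equilibrium choice probabilities are limits of iterated best responses. -/
lemma measurable_ccp (hX : Measurable X) (hF : Measurable F) {z : Param d} (hz : |z.2 0| < 4) :
    Measurable fun x => ccp (X x) (F x) z.1 z.2 := by
  refine measurable_of_tendsto_metrizable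
    (f := fun k x => (bestResponse (X x) (F x) z.1 z.2)^[k] 0) (fun k => ?_)
    (tendsto_pi_nhds.2 fun x => tendsto_iterate_ccp z.1 hz)
  induction k with
  | zero => exact measurable_const
  | succ k ih =>
    simp only [Function.iterate_succ_apply']
    exact measurable_bestResponse hX hF ih z

lemma measurable_ccpDeriv (hX : Measurable X) (hF : Measurable F) {z : Param d}
    (hz : |z.2 0| < 4) (u : Param d) : Measurable fun x => ccpDeriv (X x) (F x) z u := by
  refine measurable_of_tendsto_metrizable
    (f := fun k x => (linResponse (X x) (F x) z u)^[k] 0) (fun k => ?_)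
    (tendsto_pi_nhds.2 fun x => tendsto_iterate_ccpDeriv hz u)
  have hccp := measurable_ccp hX hF hz
  induction k with
  | zero => exact measurable_const
  | succ k ih =>
    simp only [Function.iterate_succ_apply']
    refine measurable_pi_lambda _ fun i => ?_
    simp only [linResponse, slopeAt]
    refine Measurable.mul ?_ (Measurable.add ?_ ?_)
    · exact continuous_sigmoidDeriv.measurable.comp (measurable_indexCLM hX hF hccp _ i)
    · exact measurable_indexCLM hX hF hccp _ i
    · exact (measurable_pi_iff.1 (measurable_peerAvg hF ih) i).const_mul _

end Measurability

/-! ### Concentration of weighted means of residuals -/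

section Concentration
variable {Ω : Type*} [MeasurableSpace Ω] {Pr : Measure Ω}

lemma measure_lt_eq_sigmoid {e : Ω → ℝ}
    (hlaw : ∀ t, Pr {ω | e ω ≤ t} = ENNReal.ofReal (Real.sigmoid t)) (t : ℝ) :
    Pr {ω | e ω < t} = ENNReal.ofReal (Real.sigmoid t) := by
  refine le_antisymm ?_ ?_
  · rw [← hlaw]; exact measure_mono fun ω (h : e ω < t) => h.le
  · have h1 : Tendsto (fun s => ENNReal.ofReal (Real.sigmoid s)) (𝓝[<] t)
        (𝓝 (ENNReal.ofReal (Real.sigmoid t))) :=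
      ((ENNReal.continuous_ofReal.comp continuous_sigmoid).tendsto t).mono_left nhdsWithin_le_nhds
    refine le_of_tendsto h1 ?_
    filter_upwards [self_mem_nhdsWithin] with s hs
    rw [← hlaw]
    exact measure_mono fun ω (h : e ω ≤ s) => lt_of_le_of_lt h hs

lemma hasSubgaussianMGF_mono {Y : Ω → ℝ} {c c' : NNReal} (h : HasSubgaussianMGF Y c Pr)
    (hc : c ≤ c') : HasSubgaussianMGF Y c' Pr where
  integrable_exp_mul := h.integrable_exp_mul
  mgf_le t := (h.mgf_le t).trans (Real.exp_le_exp.2 (by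
    have : (c : ℝ) ≤ c' := by exact_mod_cast hc
    gcongr))

variable [IsProbabilityMeasure Pr]

/-- Conditioning on the first of two independent random elements: a bound that holds for each of
its values holds on average. -/
lemma lintegral_le_of_indepFun {α β : Type*} [MeasurableSpace α] [MeasurableSpace β] {f : Ω → α}
    {g : Ω → β} (hf : Measurable f) (hg : Measurable g) (hfg : IndepFun f g Pr)
    {h : α × β → ENNReal} (hh : Measurable h) {c : ENNReal}
    (hc : ∀ x, ∫⁻ ω, h (x, g ω) ∂Pr ≤ c) : ∫⁻ ω, h (f ω, g ω) ∂Pr ≤ c := by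
  have h1 := (indepFun_iff_map_prod_eq_prod_map_map hf.aemeasurable hg.aemeasurable).1 hfg
  have h2 : ∫⁻ ω, h (f ω, g ω) ∂Pr = ∫⁻ p, h p ∂(Pr.map fun ω => (f ω, g ω)) :=
    (lintegral_map hh (hf.prodMk hg)).symm
  have : IsProbabilityMeasure (Pr.map f) := Measure.isProbabilityMeasure_map hf.aemeasurable
  rw [h2, h1, lintegral_prod _ hh.aemeasurable]
  calc ∫⁻ x, ∫⁻ y, h (x, y) ∂(Pr.map g) ∂(Pr.map f) ≤ ∫⁻ _, c ∂(Pr.map f) := by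
        refine lintegral_mono fun x => ?_
        have h3 : ∫⁻ y, h (x, y) ∂(Pr.map g) = ∫⁻ ω, h (x, g ω) ∂Pr :=
          lintegral_map (hh.comp measurable_prodMk_left) hg
        rw [h3]
        exact hc x
    _ = c := by simp

lemma measure_le_of_indepFun {α β : Type*} [MeasurableSpace α] [MeasurableSpace β] {f : Ω → α}
    {g : Ω → β} (hf : Measurable f) (hg : Measurable g) (hfg : IndepFun f g Pr)
    {T : Set (α × β)} (hT : MeasurableSet T) {c : ENNReal}
    (hc : ∀ x, Pr {ω | (x, g ω) ∈ T} ≤ c) : Pr {ω | (f ω, g ω) ∈ T} ≤ c := by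
  have h := lintegral_le_of_indepFun hf hg hfg (h := T.indicator 1)
    (measurable_one.indicator hT) (c := c) fun x => by
      have h1 : MeasurableSet {ω | (x, g ω) ∈ T} := (measurable_prodMk_left.comp hg) hT
      have : ∫⁻ ω, T.indicator (1 : α × β → ENNReal) (x, g ω) ∂Pr = Pr {ω | (x, g ω) ∈ T} := by
        rw [← lintegral_indicator_one h1]; rfl
      rw [this]; exact hc x
  have h1 : MeasurableSet {ω | (f ω, g ω) ∈ T} := (hf.prodMk hg) hT
  rwa [show ∫⁻ ω, T.indicator (1 : α × β → ENNReal) (f ω, g ω) ∂Pr = Pr {ω | (f ω, g ω) ∈ T} by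
    rw [← lintegral_indicator_one h1]; rfl] at h

/-- The deviation of a binary choice with threshold `t` from its probability. -/
noncomputable def residual (e t : ℝ) : ℝ := (if e < t then 1 else 0) - Real.sigmoid t

lemma measurable_residual {α : Type*} [MeasurableSpace α] {e t : α → ℝ} (he : Measurable e)
    (ht : Measurable t) : Measurable fun x => residual (e x) (t x) :=
  (Measurable.ite (measurableSet_lt he ht) measurable_const measurable_const).sub
    (continuous_sigmoid.measurable.comp ht)

lemma hasSubgaussianMGF_residual {e : Ω → ℝ} (he : Measurable e)
    (hlaw : ∀ t, Pr {ω | e ω ≤ t} = ENNReal.ofReal (Real.sigmoid t)) (t : ℝ) :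
    HasSubgaussianMGF (fun ω => residual (e ω) t) (1 / 4) Pr := by
  have hm : MeasurableSet {ω | e ω < t} := he measurableSet_Iio
  have hσ := Real.sigmoid_pos t
  have h := hasSubgaussianMGF_of_mem_Icc_of_integral_eq_zero (μ := Pr)
    (X := fun ω => residual (e ω) t) (a := -Real.sigmoid t) (b := 1 - Real.sigmoid t)
    (measurable_residual he measurable_const).aemeasurable
    (ae_of_all _ fun ω => by
      simp only [residual, Set.mem_Icc]
      split_ifs <;> constructor <;> linarith) (by
      have e1 : (fun ω => residual (e ω) t)
          = fun ω => {ω | e ω < t}.indicator (fun _ => (1 : ℝ)) ω - Real.sigmoid t := by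
        funext ω
        simp [residual, Set.indicator_apply]
      rw [e1, integral_sub ((integrable_const _).indicator hm) (integrable_const _),
        integral_indicator_const _ hm, measureReal_def, measure_lt_eq_sigmoid hlaw]
      simp [hσ.le])
  have hc : (‖1 - Real.sigmoid t - -Real.sigmoid t‖₊ / 2) ^ 2 = (1 / 4 : NNReal) := by
    rw [show 1 - Real.sigmoid t - -Real.sigmoid t = 1 by ring, nnnorm_one, div_pow]
    norm_num
  rwa [hc] at h

/-- A mean of independent residuals with weights bounded by `M` is sub-Gaussian with variance proxy
`M ^ 2 / (4 * n)`. -/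
lemma hasSubgaussianMGF_mean_residual {e : Ω → Fin n → ℝ} (he : Measurable e)
    (hlaw : ∀ i t, Pr {ω | e ω i ≤ t} = ENNReal.ofReal (Real.sigmoid t))
    (hind : iIndepFun (fun i ω => e ω i) Pr) (t a : Fin n → ℝ) {M : ℝ}
    (ha : ∀ i, |a i| ≤ M) :
    HasSubgaussianMGF (fun ω => mean Finset.univ fun i => residual (e ω i) (t i) * a i)
      (M ^ 2 / (4 * n)).toNNReal Pr := by
  have h1 : ∀ i ∈ (Finset.univ : Finset (Fin n)), HasSubgaussianMGF
      (fun ω => (a i / n) * residual (e ω i) (t i))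
      ((NNReal.mk ((a i / n) ^ 2) (sq_nonneg _)) * (1 / 4)) Pr := fun i _ =>
    (hasSubgaussianMGF_residual (measurable_pi_iff.1 he i) (hlaw i) (t i)).const_mul (a i / n)
  have h2 : iIndepFun (fun i ω => (a i / n) * residual (e ω i) (t i)) Pr :=
    hind.comp (fun i x => (a i / n) * residual x (t i))
      fun i => (measurable_residual measurable_id measurable_const).const_mul _
  have h3 := HasSubgaussianMGF.sum_of_iIndepFun h2 h1
  have e1 : (fun ω => mean Finset.univ fun i => residual (e ω i) (t i) * a i)
      = fun ω => ∑ i, (a i / n) * residual (e ω i) (t i) := by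
    funext ω
    rw [mean, Finset.mul_sum, Finset.card_univ, Fintype.card_fin]
    exact Finset.sum_congr rfl fun i _ => by ring
  rw [e1]
  refine hasSubgaussianMGF_mono h3 ?_
  rw [← NNReal.coe_le_coe, Real.coe_toNNReal _ (by positivity), NNReal.coe_sum]
  calc ∑ i, ((NNReal.mk ((a i / n) ^ 2) (sq_nonneg _) * (1 / 4) : NNReal) : ℝ)
      ≤ ∑ _i : Fin n, M ^ 2 / (4 * (n : ℝ) ^ 2) := by
        refine Finset.sum_le_sum fun i _ => ?_
        have h4 : a i ^ 2 ≤ M ^ 2 := by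
          rw [← sq_abs]; exact pow_le_pow_left₀ (abs_nonneg _) (ha i) 2
        have h5 : ((NNReal.mk ((a i / n) ^ 2) (sq_nonneg _) * (1 / 4) : NNReal) : ℝ)
            = a i ^ 2 / (4 * (n : ℝ) ^ 2) := by
          push_cast
          change (a i / n) ^ 2 * (1 / 4) = _
          rw [div_pow]; ring
        rw [h5]
        gcongr
    _ = M ^ 2 / (4 * n) := by
        rw [Finset.sum_const, Finset.card_univ, Fintype.card_fin, nsmul_eq_mul]
        rcases eq_or_ne (n : ℝ) 0 with h0 | h0
        · simp [h0]
        · field_simp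

/-- A sub-Gaussian variable has second moment at most eight times its variance proxy. -/
lemma lintegral_sq_le_of_hasSubgaussianMGF {Y : Ω → ℝ} {c : NNReal}
    (h : HasSubgaussianMGF Y c Pr) :
    ∫⁻ ω, ENNReal.ofReal (Y ω ^ 2) ∂Pr ≤ ENNReal.ofReal (8 * c) := by
  rcases eq_or_ne c 0 with rfl | hc
  · have h0 : Y =ᵐ[Pr] 0 := h.ae_eq_zero_of_hasSubgaussianMGF_zero
    have h1 : ∫⁻ ω, ENNReal.ofReal (Y ω ^ 2) ∂Pr = ∫⁻ _, 0 ∂Pr :=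
      lintegral_congr_ae (h0.mono fun ω hω => by simp [hω])
    rw [h1]; simp
  have hc0 : (0 : ℝ) < c := NNReal.coe_pos.2 (pos_iff_ne_zero.2 hc)
  -- `x ^ 2 ≤ 2 * (exp (s * x) + exp (-s * x)) / s ^ 2` is integrated with `s ^ 2 = 1 / c`
  set s := 1 / Real.sqrt c with hs
  have hs2 : s ^ 2 = 1 / c := by rw [hs, div_pow, Real.sq_sqrt hc0.le, one_pow]
  have hi : Integrable (fun ω => Y ω ^ 2) Pr := (h.memLp 2).integrable_sq
  rw [← ofReal_integral_eq_lintegral_ofReal hi (ae_of_all _ fun ω => sq_nonneg _)]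
  refine ENNReal.ofReal_le_ofReal ?_
  have h1 : ∀ x : ℝ, x ^ 2 ≤ 2 * c * (Real.exp (s * x) + Real.exp (-s * x)) := by
    intro x
    have h2 := Real.quadratic_le_exp_of_nonneg (abs_nonneg (s * x))
    have h3 : Real.exp |s * x| ≤ Real.exp (s * x) + Real.exp (-s * x) := by
      rcases abs_cases (s * x) with ⟨h, -⟩ | ⟨h, -⟩ <;> rw [h]
      · linarith [Real.exp_pos (-s * x)]
      · rw [neg_mul]; linarith [Real.exp_pos (s * x)]
    have h4 : |s * x| ^ 2 ≤ 2 * Real.exp |s * x| := by linarith [abs_nonneg (s * x)]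
    rw [sq_abs, mul_pow, hs2, one_div, inv_mul_le_iff₀ hc0] at h4
    nlinarith
  have hs' : c * s ^ 2 / 2 = 1 / 2 := by rw [hs2]; field_simp
  calc ∫ ω, Y ω ^ 2 ∂Pr ≤ ∫ ω, 2 * c * (Real.exp (s * Y ω) + Real.exp (-s * Y ω)) ∂Pr :=
        integral_mono hi (((h.integrable_exp_mul s).add (h.integrable_exp_mul (-s))).const_mul _)
          fun ω => h1 (Y ω)
    _ = 2 * c * (mgf Y Pr s + mgf Y Pr (-s)) := by
        rw [integral_const_mul, integral_add (h.integrable_exp_mul s) (h.integrable_exp_mul (-s))]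
        rfl
    _ ≤ 2 * c * (Real.exp (1 / 2) + Real.exp (1 / 2)) := by
        refine mul_le_mul_of_nonneg_left (add_le_add ?_ ?_) (by positivity)
        · exact (h.mgf_le s).trans_eq (by rw [hs'])
        · exact (h.mgf_le (-s)).trans_eq (by rw [neg_sq, hs'])
    _ ≤ 8 * c := by
        have h2 : Real.exp (1 / 2) ^ 2 ≤ 2 ^ 2 := by
          rw [← Real.exp_nat_mul]
          have := Real.exp_one_lt_d9
          norm_num
          linarith
        have h3 := (pow_le_pow_iff_left₀ (Real.exp_pos _).le zero_le_two two_ne_zero).1 h2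
        nlinarith

lemma measure_abs_ge_le_of_hasSubgaussianMGF {Y : Ω → ℝ} {c : NNReal}
    (h : HasSubgaussianMGF Y c Pr) {s : ℝ} (hs : 0 ≤ s) :
    Pr {ω | s ≤ |Y ω|} ≤ ENNReal.ofReal (2 * Real.exp (-s ^ 2 / (2 * c))) := by
  have h1 := h.measure_ge_le hs
  have h2 := h.neg.measure_ge_le hs
  have h3 : {ω | s ≤ |Y ω|} ⊆ {ω | s ≤ Y ω} ∪ {ω | s ≤ (-Y) ω} := fun ω hω => by
    rcases le_abs.1 (show s ≤ |Y ω| from hω) with h | h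
    · exact Or.inl h
    · exact Or.inr h
  refine (measure_mono h3).trans ((measure_union_le _ _).trans ?_)
  rw [two_mul, ENNReal.ofReal_add (Real.exp_pos _).le (Real.exp_pos _).le]
  refine add_le_add ?_ ?_
  · rw [← ofReal_measureReal]; exact ENNReal.ofReal_le_ofReal h1
  · rw [← ofReal_measureReal]; exact ENNReal.ofReal_le_ofReal h2

variable {α : Type*} {t a : α → Fin n → ℝ} {M : ℝ}

/-- The mean of the residuals of a group, with thresholds and weights that are functions of the
public information. -/
noncomputable def residualMean (t a : α → Fin n → ℝ) (x : α) (e : Fin n → ℝ) : ℝ :=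
  mean Finset.univ fun i => residual (e i) (t x i) * a x i

/-- The weights, set to zero if they exceed a bound. -/
noncomputable def truncated (M : ℝ) (a : α → Fin n → ℝ) (x : α) (i : Fin n) : ℝ :=
  if |a x i| ≤ M then a x i else 0

lemma abs_truncated_le (hM : 0 ≤ M) (x : α) (i : Fin n) : |truncated M a x i| ≤ M := by
  unfold truncated
  split_ifs with h
  · exact h
  · simpa using hM

lemma residualMean_truncated {x : α} (h : ∀ i, |a x i| ≤ M) (e : Fin n → ℝ) :
    residualMean t (truncated M a) x e = residualMean t a x e :=
  mean_congr fun i _ => by unfold truncated; rw [if_pos (h i)]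

variable [MeasurableSpace α] {f : Ω → α} {e : Ω → Fin n → ℝ}

lemma measurable_residualMean (ht : Measurable t) (ha : Measurable a) :
    Measurable fun p : α × (Fin n → ℝ) => residualMean t a p.1 p.2 := by
  unfold residualMean mean
  refine Measurable.const_mul (Finset.measurable_sum _ fun i _ => Measurable.mul ?_ ?_) _
  · exact measurable_residual (measurable_pi_iff.1 measurable_snd i)
      ((measurable_pi_iff.1 ht i).comp measurable_fst)
  · exact (measurable_pi_iff.1 ha i).comp measurable_fst

lemma measurable_truncated (ha : Measurable a) : Measurable (truncated M a) := by
  refine measurable_pi_lambda _ fun i => ?_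
  have h := measurable_pi_iff.1 ha i
  exact Measurable.ite (measurableSet_le (continuous_abs.measurable.comp h) measurable_const) h
    measurable_const

variable (hf : Measurable f) (he : Measurable e) (hfe : IndepFun f e Pr)
  (hlaw : ∀ i t, Pr {ω | e ω i ≤ t} = ENNReal.ofReal (Real.sigmoid t))
  (hind : iIndepFun (fun i ω => e ω i) Pr) (ht : Measurable t) (ha : Measurable a) (hM : 0 ≤ M)
  (hae : ∀ᵐ ω ∂Pr, ∀ i, |a (f ω) i| ≤ M)
include hf he hfe hlaw hind ht ha hM hae

/-- Hoeffding's inequality conditionally on the public information. -/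
lemma measure_residualMean_gt_le (hn : 0 < n) {s : ℝ} (hs : 0 < s) :
    Pr {ω | s * M < |residualMean t a (f ω) (e ω)|}
      ≤ ENNReal.ofReal (2 * Real.exp (-(2 * s ^ 2 * n))) := by
  have h1 : Pr {ω | s * M < |residualMean t a (f ω) (e ω)|}
      = Pr {ω | s * M < |residualMean t (truncated M a) (f ω) (e ω)|} := by
    refine measure_congr ?_
    filter_upwards [hae] with ω hω
    apply propext
    change s * M < |residualMean t a (f ω) (e ω)| ↔ s * M < _
    rw [residualMean_truncated hω]
  rw [h1]
  have hn' : (0 : ℝ) < n := by exact_mod_cast hn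
  refine measure_le_of_indepFun hf he hfe
    (T := {p | s * M < |residualMean t (truncated M a) p.1 p.2|})
    (measurableSet_lt measurable_const
      (continuous_abs.measurable.comp (measurable_residualMean ht (measurable_truncated ha))))
    fun x => ?_
  have h2 := hasSubgaussianMGF_mean_residual he hlaw hind (t x) (truncated M a x)
    (abs_truncated_le hM x)
  rcases hM.eq_or_lt with rfl | hM0
  · have h3 : {ω | (x, e ω) ∈ {p | s * 0 < |residualMean t (truncated 0 a) p.1 p.2|}} = ∅ := by
      refine Set.eq_empty_of_forall_notMem fun ω hω => ?_
      have h4 : residualMean t (truncated 0 a) x (e ω) = 0 := by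
        unfold residualMean mean
        rw [Finset.sum_eq_zero, mul_zero]
        intro i _
        rw [abs_nonpos_iff.1 (abs_truncated_le le_rfl x i), mul_zero]
      change s * 0 < |residualMean t (truncated 0 a) x (e ω)| at hω
      rw [h4] at hω
      simp at hω
    rw [h3]; simp
  · refine (measure_mono fun ω hω => ?_).trans ((measure_abs_ge_le_of_hasSubgaussianMGF h2
      (s := s * M) (by positivity)).trans (ENNReal.ofReal_le_ofReal (le_of_eq ?_)))
    · exact le_of_lt (show s * M < _ from hω)
    · rw [Real.coe_toNNReal _ (by positivity)]
      congr 2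
      field_simp
      ring

lemma lintegral_residualMean_sq_le :
    ∫⁻ ω, ENNReal.ofReal (residualMean t a (f ω) (e ω) ^ 2) ∂Pr
      ≤ ENNReal.ofReal (2 * M ^ 2 / n) := by
  have h1 : ∫⁻ ω, ENNReal.ofReal (residualMean t a (f ω) (e ω) ^ 2) ∂Pr
      = ∫⁻ ω, ENNReal.ofReal (residualMean t (truncated M a) (f ω) (e ω) ^ 2) ∂Pr := by
    refine lintegral_congr_ae ?_
    filter_upwards [hae] with ω hω
    rw [residualMean_truncated hω]
  rw [h1]
  refine lintegral_le_of_indepFun hf he hfe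
    (h := fun p => ENNReal.ofReal (residualMean t (truncated M a) p.1 p.2 ^ 2))
    ((measurable_residualMean ht (measurable_truncated ha)).pow_const 2).ennreal_ofReal
    fun x => ?_
  refine (lintegral_sq_le_of_hasSubgaussianMGF (hasSubgaussianMGF_mean_residual he hlaw hind (t x)
    (truncated M a x) (abs_truncated_le hM x))).trans (ENNReal.ofReal_le_ofReal (le_of_eq ?_))
  rw [Real.coe_toNNReal _ (by positivity)]
  rcases eq_or_ne (n : ℝ) 0 with h0 | h0
  · simp [h0]
  · field_simp
    ring

end Concentration

end Residuals

section SamplingErrors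
variable {n d G : ℕ}

/-! ### Coordinates and grids in the parameter space -/

/-- The coordinates of a parameter; `none` stands for the fixed effect. -/
def coord (z : Param d) : Option (Fin (d + 1)) → ℝ
  | none => z.1
  | some j => z.2 j

/-- The standard basis of the parameter space. -/
noncomputable def basisVec : Option (Fin (d + 1)) → Param d
  | none => (1, 0)
  | some j => (0, EuclideanSpace.single j 1)

lemma norm_basisVec (m : Option (Fin (d + 1))) : ‖(basisVec m : Param d)‖ = 1 := by
  cases m <;> simp [basisVec, Prod.norm_def]

lemma abs_coord_le (z : Param d) (m : Option (Fin (d + 1))) : |coord z m| ≤ ‖z‖ := by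
  cases m with
  | none => exact norm_fst_le z
  | some j => exact abs_snd_apply_le z j

lemma sum_coord_smul_basisVec (z : Param d) : ∑ m, coord z m • basisVec m = z := by
  rw [Fintype.sum_option]
  simp only [coord, basisVec]
  have h : ∑ j, z.2 j • ((0, EuclideanSpace.single j 1) : Param d) = (0, z.2) := by
    refine Prod.ext ?_ ?_
    · simp [Prod.fst_sum]
    · rw [Prod.snd_sum]
      ext k
      simp [Finset.sum_apply, Pi.single_apply]
  rw [h]
  refine Prod.ext ?_ ?_ <;> simp

lemma norm_le_sum_abs_coord (z : Param d) : ‖z‖ ≤ ∑ m, |coord z m| := by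
  conv_lhs => rw [← sum_coord_smul_basisVec z]
  refine (norm_sum_le _ _).trans (Finset.sum_le_sum fun m _ => ?_)
  rw [norm_smul, norm_basisVec, mul_one, Real.norm_eq_abs]

lemma opNorm_le_sum_abs_basisVec (l : Param d →L[ℝ] ℝ) : ‖l‖ ≤ ∑ m, |l (basisVec m)| := by
  refine l.opNorm_le_bound (Finset.sum_nonneg fun m _ => abs_nonneg _) fun z => ?_
  conv_lhs => rw [← sum_coord_smul_basisVec z]
  rw [map_sum, Finset.sum_mul]
  refine (norm_sum_le _ _).trans (Finset.sum_le_sum fun m _ => ?_)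
  rw [map_smul, smul_eq_mul, norm_mul, mul_comm, Real.norm_eq_abs, Real.norm_eq_abs]
  exact mul_le_mul_of_nonneg_left (abs_coord_le z m) (abs_nonneg _)

/-- A bounded set of parameters has nets of mesh of order `1 / N` with polynomially many points. -/
lemma exists_net {Z : Set (Param d)} {R : ℝ} (hZ : ∀ z ∈ Z, ‖z‖ ≤ R) :
    ∃ K > 0, ∀ N : ℕ, 0 < N → ∃ T : Finset (Param d), (∀ y ∈ T, y ∈ Z) ∧
      (T.card : ℝ) ≤ K * (N : ℝ) ^ (d + 2) ∧ ∀ z ∈ Z, ∃ y ∈ T, ‖z - y‖ ≤ (d + 2) / N := by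
  classical
  refine ⟨(2 * (⌈R⌉₊ : ℝ) + 3) ^ (d + 2), by positivity, fun N hN => ?_⟩
  have hN' : (0 : ℝ) < N := by exact_mod_cast hN
  -- points are put into the same cell if their scaled coordinates have equal integer parts
  let cell : Param d → Option (Fin (d + 1)) → ℤ := fun z m => ⌊N * coord z m⌋
  let M : ℕ := ⌈R⌉₊ * N + 1
  let box : Finset (Option (Fin (d + 1)) → ℤ) :=
    Fintype.piFinset fun _ => Finset.Icc (-(M : ℤ)) M
  have hbox : ∀ z ∈ Z, cell z ∈ box := by
    intro z hz
    refine Fintype.mem_piFinset.2 fun m => ?_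
    have h1 := (abs_coord_le z m).trans ((hZ z hz).trans (Nat.le_ceil R))
    have h2 : |(N : ℝ) * coord z m| ≤ ⌈R⌉₊ * N := by
      rw [abs_mul, Nat.abs_cast, mul_comm]
      exact mul_le_mul_of_nonneg_right h1 hN'.le
    obtain ⟨h3, h4⟩ := abs_le.1 h2
    rw [Finset.mem_Icc]
    constructor
    · rw [Int.le_floor]; push_cast [M]; linarith
    · refine Int.floor_le_iff.2 ?_
      push_cast [M]; linarith
  have hrep : ∀ c : Option (Fin (d + 1)) → ℤ, ∃ y : Param d,
      (∃ z ∈ Z, cell z = c) → y ∈ Z ∧ cell y = c := by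
    intro c
    by_cases h : ∃ z ∈ Z, cell z = c
    · obtain ⟨z, hz⟩ := h; exact ⟨z, fun _ => hz⟩
    · exact ⟨0, fun h' => absurd h' h⟩
  choose rep hrep using hrep
  refine ⟨(box.filter fun c => ∃ z ∈ Z, cell z = c).image rep, ?_, ?_, ?_⟩
  · intro y hy
    obtain ⟨c, hc, rfl⟩ := Finset.mem_image.1 hy
    exact (hrep c (Finset.mem_filter.1 hc).2).1
  · have h1 : ((box.filter fun c => ∃ z ∈ Z, cell z = c).image rep).card ≤ box.card :=
      Finset.card_image_le.trans (Finset.card_filter_le _ _)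
    have h2 : box.card = (2 * M + 1) ^ (d + 2) := by
      rw [Fintype.card_piFinset]
      simp only [Finset.prod_const, Finset.card_univ, Fintype.card_option, Fintype.card_fin,
        Int.card_Icc]
      congr 1
      omega
    have h3 : ((2 * M + 1 : ℕ) : ℝ) ≤ (2 * (⌈R⌉₊ : ℝ) + 3) * N := by
      have : (1 : ℝ) ≤ N := by exact_mod_cast hN
      push_cast [M]; linarith
    calc ((((box.filter fun c => ∃ z ∈ Z, cell z = c).image rep).card : ℕ) : ℝ)
        ≤ ((box.card : ℕ) : ℝ) := by exact_mod_cast h1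
      _ = ((2 * M + 1 : ℕ) : ℝ) ^ (d + 2) := by rw [h2]; push_cast; rfl
      _ ≤ ((2 * (⌈R⌉₊ : ℝ) + 3) * N) ^ (d + 2) := by gcongr
      _ = _ := mul_pow _ _ _
  · intro z hz
    have h1 := hrep (cell z) ⟨z, hz, rfl⟩
    refine ⟨rep (cell z), Finset.mem_image_of_mem _ (Finset.mem_filter.2
      ⟨hbox z hz, z, hz, rfl⟩), ?_⟩
    refine (norm_le_sum_abs_coord _).trans ?_
    have h2 : ∀ m, |coord (z - rep (cell z)) m| ≤ 1 / N := by
      intro m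
      have h3 : ⌊(N : ℝ) * coord z m⌋ = ⌊(N : ℝ) * coord (rep (cell z)) m⌋ :=
        (congrFun h1.2 m).symm
      have h4 := (Int.abs_sub_lt_one_of_floor_eq_floor h3).le
      have h5 : coord (z - rep (cell z)) m = coord z m - coord (rep (cell z)) m := by
        cases m <;> simp [coord]
      rw [← mul_sub, abs_mul, Nat.abs_cast] at h4
      rw [h5, le_div_iff₀ hN', mul_comm]
      exact h4
    refine (Finset.sum_le_sum fun m _ => h2 m).trans (le_of_eq ?_)
    rw [Finset.sum_const, Finset.card_univ, Fintype.card_option, Fintype.card_fin, nsmul_eq_mul]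
    push_cast; ring

/-! ### The sampling errors of a group -/

/-- Covariates and friendships of a group. -/
abbrev PublicInfo (n d : ℕ) := (Fin n → Fin d → ℝ) × (Fin n → Fin n → Bool)

/-- The index of an individual at the true parameter, in equilibrium. -/
noncomputable def threshold (z : Param d) (x : PublicInfo n d) (i : Fin n) : ℝ :=
  indexCLM x.1 x.2 (ccp x.1 x.2 z.1 z.2) i z

/-- The weights of the residuals in the sampling errors of a group: in the score (`true`) and in
the peer noise (`false`), in each direction of the basis. -/
noncomputable def noiseWeight (z : Param d) (m : Option (Fin (d + 1)) × Bool) (x : PublicInfo n d)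
    (i : Fin n) : ℝ :=
  if m.2 then indexCLM x.1 x.2 (ccp x.1 x.2 z.1 z.2) i (basisVec m.1)
  else peerAvg x.2 (ccpDeriv x.1 x.2 z (basisVec m.1)) i

/-- The weights of the residuals in the sampling error of the linearization. -/
noncomputable def remWeight (z₀ z : Param d) (x : PublicInfo n d) : Fin n → ℝ :=
  peerAvg x.2 (ccp x.1 x.2 z.1 z.2 - ccp x.1 x.2 z₀.1 z₀.2 - ccpDeriv x.1 x.2 z₀ (z - z₀))

lemma measurable_threshold {z : Param d} (hz : |z.2 0| < 4) :
    Measurable (threshold (n := n) z) :=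
  measurable_pi_lambda _ fun i => measurable_indexCLM measurable_fst measurable_snd
    (measurable_ccp measurable_fst measurable_snd hz) z i

lemma measurable_noiseWeight {z : Param d} (hz : |z.2 0| < 4) (m : Option (Fin (d + 1)) × Bool) :
    Measurable (noiseWeight (n := n) z m) := by
  refine measurable_pi_lambda _ fun i => ?_
  unfold noiseWeight
  split_ifs
  · exact measurable_indexCLM measurable_fst measurable_snd
      (measurable_ccp measurable_fst measurable_snd hz) _ i
  · exact measurable_pi_iff.1 (measurable_peerAvg measurable_snd
      (measurable_ccpDeriv measurable_fst measurable_snd hz _)) i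

lemma measurable_remWeight {z₀ z : Param d} (hz₀ : |z₀.2 0| < 4) (hz : |z.2 0| < 4) :
    Measurable (remWeight (n := n) z₀ z) :=
  measurable_peerAvg measurable_snd (((measurable_ccp measurable_fst measurable_snd hz).sub
    (measurable_ccp measurable_fst measurable_snd hz₀)).sub
      (measurable_ccpDeriv measurable_fst measurable_snd hz₀ _))

/-- The data of a group generated by the game with parameter `z`. -/
noncomputable abbrev sampleData (z : Param d) (x : PublicInfo n d) (e : Fin n → ℝ) :
    GroupData n d :=
  gameData x.1 x.2 e z.1 z.2

lemma sampleData_residual {z : Param d} (hz : |z.2 0| < 4) (x : PublicInfo n d) (e : Fin n → ℝ)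
    (i : Fin n) : (sampleData z x e).Y i - ccp x.1 x.2 z.1 z.2 i
      = residual (e i) (threshold z x i) := by
  rw [ccp_apply hz]
  simp only [sampleData, gameData, index_eq, residual, threshold]
  rfl

lemma noiseRem_eq_residualMean {z₀ : Param d} (hz₀ : |z₀.2 0| < 4) (z : Param d)
    (x : PublicInfo n d) (e : Fin n → ℝ) :
    noiseRem (sampleData z₀ x e) z₀ z = residualMean (threshold z₀) (remWeight z₀ z) x e :=
  mean_congr fun i _ => by rw [← sampleData_residual hz₀]; rfl

lemma noise_le_sum_residualMean {z : Param d} (hz : |z.2 0| < 4) (x : PublicInfo n d)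
    (e : Fin n → ℝ) : noise (sampleData z x e) z
      ≤ ∑ m, |residualMean (threshold z) (noiseWeight z m) x e| := by
  rw [Fintype.sum_prod_type]
  simp only [Fintype.sum_bool]
  rw [Finset.sum_add_distrib]
  refine add_le_add ?_ ?_
  · refine (opNorm_le_sum_abs_basisVec _).trans (Finset.sum_le_sum fun m _ => le_of_eq ?_)
    rw [nplScore_apply _ hz, ← abs_neg, neg_eq_neg_one_mul, ← mean_const_mul]
    congr 1
    refine mean_congr fun i _ => ?_
    rw [← sampleData_residual hz]
    simp only [noiseWeight, if_true]
    change -1 * ((ccp x.1 x.2 z.1 z.2 i - _) * indexCLM x.1 x.2 (ccp x.1 x.2 z.1 z.2) i _) = _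
    ring
  · refine (opNorm_le_sum_abs_basisVec _).trans (Finset.sum_le_sum fun m _ => le_of_eq ?_)
    rw [peerNoise_apply]
    congr 1
    refine mean_congr fun i _ => ?_
    rw [← sampleData_residual hz]
    simp [noiseWeight, gameData]

lemma isRegularData_sampleData {B : ℝ} {x : PublicInfo n d} (hx : IsRegular B x.1 x.2)
    (z : Param d) (e : Fin n → ℝ) : IsRegularData B (sampleData z x e) where
  reg := hx
  mem_Icc i := by
    simp only [sampleData, gameData]
    split_ifs <;> simp

lemma abs_noiseWeight_le {B r : ℝ} {x : PublicInfo n d} (hx : IsRegular B x.1 x.2) (hr0 : 0 ≤ r)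
    (hr : r < 1) {z : Param d} (hz : |z.2 0| ≤ 4 * r) (m : Option (Fin (d + 1)) × Bool)
    (i : Fin n) : |noiseWeight z m x i| ≤ indexBound d B + ccpLip d B r := by
  have hB := two_le_indexBound (d := d) hx.one_le
  have hL := two_le_ccpLip (d := d) hx hr0 hr
  unfold noiseWeight
  split_ifs
  · have := hx.abs_indexCLM_le (norm_ccp_le (X := x.1) (F := x.2) (abs_lt_four hr hz)) i
      (basisVec m.1)
    rw [norm_basisVec] at this
    linarith
  · have := (abs_peerAvg_le_norm x.2 _ i).trans (norm_ccpDeriv_le hx hr0 hr hz (basisVec m.1))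
    rw [norm_basisVec] at this
    linarith

lemma abs_remWeight_le {B r : ℝ} {x : PublicInfo n d} (hx : IsRegular B x.1 x.2) (hr0 : 0 ≤ r)
    (hr : r < 1) {z₀ z : Param d} (hz₀ : |z₀.2 0| ≤ 4 * r) (hz : |z.2 0| ≤ 4 * r) (i : Fin n) :
    |remWeight z₀ z x i| ≤ ccpQuad d B r * ‖z - z₀‖ ^ 2 := by
  refine ((abs_peerAvg_le_norm x.2 _ i).trans (norm_ccp_sub_sub_le hx hr0 hr hz₀ hz hz₀
    le_rfl (by simp : ‖z₀ - z₀‖ ≤ ‖z - z₀‖))).trans (le_of_eq ?_)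
  ring

lemma abs_noiseRem_sub_le {B r : ℝ} {D : GroupData n d} (hD : IsRegularData B D) (hr0 : 0 ≤ r)
    (hr : r < 1) {z₀ z y : Param d} (hz₀ : |z₀.2 0| ≤ 4 * r) (hz : |z.2 0| ≤ 4 * r)
    (hy : |y.2 0| ≤ 4 * r) :
    |noiseRem D z₀ z - noiseRem D z₀ y| ≤ 2 * ccpLip d B r * ‖z - y‖ := by
  have hL := two_le_ccpLip (d := d) hD.reg hr0 hr
  unfold noiseRem
  rw [← mean_sub]
  refine abs_mean_le (fun i _ => ?_) (by positivity)
  rw [← mul_sub, ← peerAvg_sub, abs_mul]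
  have e1 : ccp D.X D.F z.1 z.2 - ccp D.X D.F z₀.1 z₀.2 - ccpDeriv D.X D.F z₀ (z - z₀)
      - (ccp D.X D.F y.1 y.2 - ccp D.X D.F z₀.1 z₀.2 - ccpDeriv D.X D.F z₀ (y - z₀))
      = (ccp D.X D.F z.1 z.2 - ccp D.X D.F y.1 y.2) - ccpDeriv D.X D.F z₀ (z - y) := by
    simp only [map_sub]; abel
  rw [e1]
  have h1 := norm_ccp_sub_le hD.reg hr0 hr hz hy
  have h2 := norm_ccpDeriv_le hD.reg hr0 hr hz₀ (z - y)
  have h3 := (abs_peerAvg_le_norm D.F _ i).trans (norm_sub_le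
    (ccp D.X D.F z.1 z.2 - ccp D.X D.F y.1 y.2) (ccpDeriv D.X D.F z₀ (z - y)))
  have h4 := mul_le_mul (abs_residual_le hD hr hz₀ i) h3 (abs_nonneg _) zero_le_one
  linarith

/-! ### Probability bounds for the sampling errors -/

section Sample
variable {Ω : Type*} [MeasurableSpace Ω]

/-- The public and the private information of a group: the private information is i.i.d. standard
logistic and independent of the public information, which is regular. -/
structure IsGroupSample (Pr : Measure Ω) (B : ℝ) (f : Ω → PublicInfo n d) (e : Ω → Fin n → ℝ) :
    Prop where
  measurable_pub : Measurable f
  measurable_priv : Measurable e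
  indep : IndepFun f e Pr
  law : ∀ i t, Pr {ω | e ω i ≤ t} = ENNReal.ofReal (Real.sigmoid t)
  iIndep : iIndepFun (fun i ω => e ω i) Pr
  regular : ∀ᵐ ω ∂Pr, IsRegular B (f ω).1 (f ω).2

variable (Pr : Measure Ω) [IsProbabilityMeasure Pr]

/-- The squared sampling error is of order `1 / n` in mean. The sampling error is dominated by a
measurable function, to which Markov's inequality applies. -/
theorem exists_noise_sq_bound (d : ℕ) {B r : ℝ} (hB : 1 ≤ B) (hr0 : 0 ≤ r) (hr : r < 1) :
    ∃ K > 0, ∀ (n : ℕ) (z : Param d) (f : Ω → PublicInfo n d) (e : Ω → Fin n → ℝ),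
      IsGroupSample Pr B f e → |z.2 0| ≤ 4 * r →
      ∃ T : Ω → ℝ, Measurable T ∧ (∀ ω, noise (sampleData z (f ω) (e ω)) z ^ 2 ≤ T ω) ∧
        ∫⁻ ω, ENNReal.ofReal (T ω) ∂Pr ≤ ENNReal.ofReal (K / n) := by
  have hI := two_le_indexBound (d := d) hB
  set M := indexBound d B + ccpLip d B r with hM
  have hM0 : 0 ≤ ccpLip d B r := by
    unfold ccpLip
    exact div_nonneg (by linarith) (by linarith)
  have hM1 : 0 < M := by linarith
  let I := Option (Fin (d + 1)) × Bool
  let N : ℝ := ((Finset.univ : Finset I).card : ℝ)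
  have hN : 0 < N := Nat.cast_pos.2 (Finset.card_pos.2 Finset.univ_nonempty)
  refine ⟨N * N * (2 * M ^ 2), by positivity, fun n z f e hs hz => ?_⟩
  have hz4 := abs_lt_four hr hz
  obtain ⟨S, hS⟩ : ∃ S : I → Ω → ℝ,
      S = fun m ω => residualMean (threshold z) (noiseWeight z m) (f ω) (e ω) := ⟨_, rfl⟩
  have hmeas : ∀ m, Measurable (S m) := fun m => by
    rw [hS]
    exact (measurable_residualMean (measurable_threshold hz4) (measurable_noiseWeight hz4 m)).comp
      (hs.measurable_pub.prodMk hs.measurable_priv)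
  have hle : ∀ ω, noise (sampleData z (f ω) (e ω)) z ≤ ∑ m, |S m ω| := fun ω => by
    rw [hS]; exact noise_le_sum_residualMean hz4 (f ω) (e ω)
  have hsq : ∀ m, ∫⁻ ω, ENNReal.ofReal (S m ω ^ 2) ∂Pr
      ≤ ENNReal.ofReal (2 * M ^ 2 / n) := fun m => by
    rw [hS]
    exact lintegral_residualMean_sq_le hs.measurable_pub hs.measurable_priv hs.indep hs.law
      hs.iIndep (measurable_threshold hz4) (measurable_noiseWeight hz4 m) hM1.le
      (hs.regular.mono fun ω hω i => abs_noiseWeight_le hω hr0 hr hz m i)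
  clear hS
  have hmeas' : ∀ m, Measurable fun ω => ENNReal.ofReal (S m ω ^ 2) := fun m =>
    ((hmeas m).pow_const 2).ennreal_ofReal
  refine ⟨fun ω => N * ∑ m, S m ω ^ 2,
    (Finset.measurable_sum _ fun m _ => (hmeas m).pow_const 2).const_mul _, fun ω => ?_, ?_⟩
  · have h1 := pow_le_pow_left₀ (noise_nonneg _ _) (hle ω) 2
    refine h1.trans ((sq_sum_le_card_mul_sum_sq (s := Finset.univ)).trans (le_of_eq ?_))
    simp only [sq_abs]
    rfl
  · have h1 : ∀ ω, ENNReal.ofReal (N * ∑ m, S m ω ^ 2)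
        = ENNReal.ofReal N * ∑ m, ENNReal.ofReal (S m ω ^ 2) := fun ω => by
      rw [ENNReal.ofReal_mul hN.le, ENNReal.ofReal_sum_of_nonneg fun m _ => sq_nonneg _]
    simp only [h1]
    rw [lintegral_const_mul _ (Finset.measurable_sum _ fun m _ => hmeas' m),
      lintegral_finsetSum _ fun m _ => hmeas' m]
    have h2 : ∑ m, ∫⁻ ω, ENNReal.ofReal (S m ω ^ 2) ∂Pr ≤ ENNReal.ofReal (N * (2 * M ^ 2 / n)) := by
      refine (Finset.sum_le_sum fun m _ => hsq m).trans (le_of_eq ?_)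
      rw [Finset.sum_const, nsmul_eq_mul, ← ENNReal.ofReal_natCast,
        ← ENNReal.ofReal_mul (Nat.cast_nonneg _)]
    calc ENNReal.ofReal N * ∑ m, ∫⁻ ω, ENNReal.ofReal (S m ω ^ 2) ∂Pr
        ≤ ENNReal.ofReal N * ENNReal.ofReal (N * (2 * M ^ 2 / n)) := by gcongr
      _ = ENNReal.ofReal (N * N * (2 * M ^ 2) / n) := by
        rw [← ENNReal.ofReal_mul hN.le]
        congr 1
        ring

/-- The sampling error exceeds a given level with exponentially small probability. -/
theorem exists_noise_tail (d : ℕ) {B r τ : ℝ} (hB : 1 ≤ B) (hr0 : 0 ≤ r) (hr : r < 1)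
    (hτ : 0 < τ) :
    ∃ K > 0, ∃ c > 0, ∀ (n : ℕ) (z : Param d) (f : Ω → PublicInfo n d) (e : Ω → Fin n → ℝ), 0 < n →
      IsGroupSample Pr B f e → |z.2 0| ≤ 4 * r →
      Pr {ω | ¬ noise (sampleData z (f ω) (e ω)) z ≤ τ}
        ≤ ENNReal.ofReal (K * Real.exp (-(c * n))) := by
  have hI := two_le_indexBound (d := d) hB
  set M := indexBound d B + ccpLip d B r with hM
  have hM0 : 0 ≤ ccpLip d B r := by
    unfold ccpLip
    exact div_nonneg (by linarith) (by linarith)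
  have hM1 : 0 < M := by linarith
  let I := Option (Fin (d + 1)) × Bool
  let N : ℝ := ((Finset.univ : Finset I).card : ℝ)
  have hN : 0 < N := Nat.cast_pos.2 (Finset.card_pos.2 Finset.univ_nonempty)
  refine ⟨N * 2, by positivity, 2 * (τ / (N * M)) ^ 2, by positivity, fun n z f e hn hs hz => ?_⟩
  have hz4 := abs_lt_four hr hz
  have h1 : {ω | ¬ noise (sampleData z (f ω) (e ω)) z ≤ τ} ⊆ ⋃ m ∈ (Finset.univ : Finset I),
      {ω | τ / (N * M) * M < |residualMean (threshold z) (noiseWeight z m) (f ω) (e ω)|} := by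
    intro ω hω
    by_contra hcon
    simp only [Set.mem_iUnion, not_exists, Set.mem_ofPred_eq, not_lt] at hcon
    refine hω ((noise_le_sum_residualMean hz4 (f ω) (e ω)).trans
      ((Finset.sum_le_sum fun m hm => hcon m hm).trans (le_of_eq ?_)))
    rw [Finset.sum_const, nsmul_eq_mul]
    change N * _ = τ
    field_simp
  refine (measure_mono h1).trans ((measure_biUnion_finset_le _ _).trans ?_)
  have h2 : ∀ m : I, Pr {ω | τ / (N * M) * M
      < |residualMean (threshold z) (noiseWeight z m) (f ω) (e ω)|}
      ≤ ENNReal.ofReal (2 * Real.exp (-(2 * (τ / (N * M)) ^ 2 * n))) := fun m =>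
    measure_residualMean_gt_le hs.measurable_pub hs.measurable_priv hs.indep hs.law hs.iIndep
      (measurable_threshold hz4) (measurable_noiseWeight hz4 m) hM1.le
      (hs.regular.mono fun ω hω i => abs_noiseWeight_le hω hr0 hr hz m i) hn (by positivity)
  refine (Finset.sum_le_sum fun m _ => h2 m).trans (le_of_eq ?_)
  rw [Finset.sum_const, nsmul_eq_mul, ← ENNReal.ofReal_natCast,
    ← ENNReal.ofReal_mul (Nat.cast_nonneg _), mul_assoc N]

/-- The sampling error of the linearization is dominated by a small multiple of the squared distance
to the truth, uniformly over a bounded set of parameters and up to a term of order `1 / n`, outside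
an event of exponentially small probability: Hoeffding's inequality applies at the points of a
net. -/
theorem exists_noiseRem_tail {B r R q : ℝ} (hB : 1 ≤ B) (hr0 : 0 ≤ r) (hr : r < 1) (hq : 0 < q)
    {Z : Set (Param d)} (hZ : ∀ z ∈ Z, |z.2 0| ≤ 4 * r ∧ ‖z‖ ≤ R) :
    ∃ L > 0, ∃ K > 0, ∃ c > 0, ∀ (n : ℕ) (z₀ : Param d) (f : Ω → PublicInfo n d)
      (e : Ω → Fin n → ℝ), 0 < n → IsGroupSample Pr B f e → |z₀.2 0| ≤ 4 * r →
      Pr {ω | ¬ ∀ z ∈ Z, |noiseRem (sampleData z₀ (f ω) (e ω)) z₀ z| ≤ q * ‖z - z₀‖ ^ 2 + L / n}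
        ≤ ENNReal.ofReal (K * (n : ℝ) ^ (d + 2) * Real.exp (-(c * n))) := by
  obtain ⟨K, hK, hnet⟩ := exists_net (fun z hz => (hZ z hz).2)
  have hQ := ccpQuad_nonneg (d := d) (B := B) hr
  have hI := two_le_indexBound (d := d) hB
  have hL0 : 0 ≤ ccpLip d B r := by
    unfold ccpLip
    exact div_nonneg (by linarith) (by linarith)
  set t := q / (2 * (ccpQuad d B r + 1)) with ht
  have ht0 : 0 < t := by positivity
  have htQ : t * ccpQuad d B r ≤ q / 2 := by
    rw [ht, div_mul_eq_mul_div, div_le_div_iff₀ (by positivity) two_pos]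
    nlinarith
  refine ⟨q * (d + 2) ^ 2 + 2 * ccpLip d B r * (d + 2), by positivity, K * 2, by positivity,
    2 * t ^ 2, by positivity, fun n z₀ f e hn hs hz₀ => ?_⟩
  obtain ⟨T, hTZ, hTcard, hT⟩ := hnet n hn
  have hn' : (1 : ℝ) ≤ n := by exact_mod_cast hn
  have hz4 := abs_lt_four hr hz₀
  set bad : Param d → Set Ω := fun y => {ω | t * (ccpQuad d B r * ‖y - z₀‖ ^ 2)
    < |residualMean (threshold z₀) (remWeight z₀ y) (f ω) (e ω)|} with hbad
  have h1 : {ω | ¬ ∀ z ∈ Z, |noiseRem (sampleData z₀ (f ω) (e ω)) z₀ z| ≤ q * ‖z - z₀‖ ^ 2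
      + (q * (d + 2) ^ 2 + 2 * ccpLip d B r * (d + 2)) / n}
      ⊆ {ω | ¬ IsRegular B (f ω).1 (f ω).2} ∪ ⋃ y ∈ T, bad y := by
    intro ω hω
    by_contra hcon
    rw [Set.mem_union, not_or] at hcon
    obtain ⟨hreg, hcon⟩ := hcon
    have hreg : IsRegular B (f ω).1 (f ω).2 := not_not.1 hreg
    simp only [hbad, Set.mem_iUnion, not_exists, Set.mem_ofPred_eq, not_lt] at hcon
    refine hω fun z hz => ?_
    obtain ⟨y, hyT, hzy⟩ := hT z hz
    have h2 := hcon y hyT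
    rw [← noiseRem_eq_residualMean hz4] at h2
    have h3 := abs_noiseRem_sub_le (isRegularData_sampleData hreg z₀ (e ω)) hr0 hr hz₀
      (hZ z hz).1 (hZ y (hTZ y hyT)).1
    have h4 : ‖y - z₀‖ ^ 2 ≤ 2 * ‖z - z₀‖ ^ 2 + 2 * ‖z - y‖ ^ 2 := by
      have h5 := norm_sub_le_norm_sub_add_norm_sub y z z₀
      rw [norm_sub_rev y z] at h5
      have h6 := pow_le_pow_left₀ (norm_nonneg _) h5 2
      nlinarith [sq_nonneg (‖z - y‖ - ‖z - z₀‖)]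
    have h5 : ‖z - y‖ ^ 2 ≤ (d + 2) ^ 2 / n := by
      refine (pow_le_pow_left₀ (norm_nonneg _) hzy 2).trans ?_
      rw [div_pow]
      exact div_le_div_of_nonneg_left (by positivity) (by positivity) (by nlinarith)
    have h6 : |noiseRem (sampleData z₀ (f ω) (e ω)) z₀ z|
        ≤ |noiseRem (sampleData z₀ (f ω) (e ω)) z₀ y| + 2 * ccpLip d B r * ‖z - y‖ := by
      have := abs_sub_abs_le_abs_sub (noiseRem (sampleData z₀ (f ω) (e ω)) z₀ z)
        (noiseRem (sampleData z₀ (f ω) (e ω)) z₀ y)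
      linarith
    have h7 : t * (ccpQuad d B r * ‖y - z₀‖ ^ 2)
        ≤ q / 2 * (2 * ‖z - z₀‖ ^ 2 + 2 * ((d + 2) ^ 2 / n)) := by
      rw [← mul_assoc]
      exact mul_le_mul htQ (by linarith) (by positivity) (by positivity)
    have h8 := mul_le_mul_of_nonneg_left hzy (by positivity : 0 ≤ 2 * ccpLip d B r)
    have h9 : (q * (d + 2) ^ 2 + 2 * ccpLip d B r * (d + 2)) / n
        = q * (((d : ℝ) + 2) ^ 2 / n) + 2 * ccpLip d B r * ((d + 2) / n) := by ring
    rw [h9]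
    linarith
  have h2 : Pr {ω | ¬ IsRegular B (f ω).1 (f ω).2} = 0 := hs.regular
  have h3 : ∀ y ∈ T, Pr (bad y) ≤ ENNReal.ofReal (2 * Real.exp (-(2 * t ^ 2 * n))) := fun y hy =>
    measure_residualMean_gt_le hs.measurable_pub hs.measurable_priv hs.indep hs.law hs.iIndep
      (measurable_threshold hz4) (measurable_remWeight hz4 (abs_lt_four hr (hZ y (hTZ y hy)).1))
      (by positivity)
      (hs.regular.mono fun ω hω i => abs_remWeight_le hω hr0 hr hz₀ (hZ y (hTZ y hy)).1 i) hn ht0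
  calc _ ≤ Pr {ω | ¬ IsRegular B (f ω).1 (f ω).2} + Pr (⋃ y ∈ T, bad y) :=
        (measure_mono h1).trans (measure_union_le _ _)
    _ ≤ ∑ y ∈ T, Pr (bad y) := by rw [h2, zero_add]; exact measure_biUnion_finset_le _ _
    _ ≤ ∑ _y ∈ T, ENNReal.ofReal (2 * Real.exp (-(2 * t ^ 2 * n))) := Finset.sum_le_sum h3
    _ = ENNReal.ofReal (T.card * (2 * Real.exp (-(2 * t ^ 2 * n)))) := by
        rw [Finset.sum_const, nsmul_eq_mul, ← ENNReal.ofReal_natCast,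
          ← ENNReal.ofReal_mul (by positivity)]
    _ ≤ _ := by
        refine ENNReal.ofReal_le_ofReal ?_
        have := mul_le_mul_of_nonneg_right hTcard
          (by positivity : 0 ≤ 2 * Real.exp (-(2 * t ^ 2 * n)))
        linarith

end Sample

end SamplingErrors

section Limits
variable {n d : ℕ}

/-! ### Rates and probabilities of the exceptional events -/

lemma tendsto_groups_mul_exp {G : ℕ → ℕ} {cG : ℝ}
    (hG : Tendsto (fun n : ℕ => (G n : ℝ) / (n : ℝ)) atTop (𝓝 cG)) {K c : ℝ}
    (hc : 0 < c) (p : ℕ) :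
    Tendsto (fun n : ℕ => ENNReal.ofReal (G n * (K * (n : ℝ) ^ p * Real.exp (-(c * n))))) atTop
      (𝓝 0) := by
  rw [← ENNReal.ofReal_zero]
  refine ENNReal.tendsto_ofReal ?_
  have h1 : Tendsto (fun n : ℕ => c * (n : ℝ)) atTop atTop :=
    tendsto_natCast_atTop_atTop.const_mul_atTop hc
  have h2 := (Real.tendsto_pow_mul_exp_neg_atTop_nhds_zero (p + 1)).comp h1
  have h3 := (hG.mul h2).const_mul (K / c ^ (p + 1))
  rw [mul_zero, mul_zero] at h3
  refine h3.congr' ?_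
  filter_upwards [eventually_gt_atTop 0] with n hn
  have hn' : (n : ℝ) ≠ 0 := by exact_mod_cast hn.ne'
  simp only [Function.comp_apply]
  field_simp
  ring

lemma tendsto_mul_min_atTop {ρ lam : ℕ → ℝ}
    (hρn : Tendsto (fun n : ℕ => (n : ℝ) * ρ n / Real.log n) atTop atTop) (hρ : ∀ n, 0 < ρ n)
    (hlam : ∀ n, 0 < lam n)
    (hlamn : Tendsto (fun n : ℕ => lam n + ((n : ℝ) * lam n)⁻¹) atTop (𝓝 0)) :
    Tendsto (fun n : ℕ => (n : ℝ) * min 1 (min (ρ n) (lam n))) atTop atTop := by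
  have h1 : Tendsto (fun n : ℕ => (n : ℝ) * ρ n) atTop atTop := by
    refine tendsto_atTop_mono' _ ?_ hρn
    have h := (Real.tendsto_log_atTop.comp tendsto_natCast_atTop_atTop).eventually_ge_atTop 1
    filter_upwards [h] with n hn
    exact div_le_self (mul_nonneg n.cast_nonneg (hρ n).le) hn
  have h2 : Tendsto (fun n : ℕ => (n : ℝ) * lam n) atTop atTop := by
    have h3 : Tendsto (fun n : ℕ => ((n : ℝ) * lam n)⁻¹) atTop (𝓝 0) :=
      squeeze_zero (fun n => inv_nonneg.2 (mul_nonneg n.cast_nonneg (hlam n).le))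
        (fun n => le_add_of_nonneg_left (hlam n).le) hlamn
    have h4 : Tendsto (fun n : ℕ => ((n : ℝ) * lam n)⁻¹) atTop (𝓝[>] 0) := by
      refine tendsto_nhdsWithin_iff.2 ⟨h3, ?_⟩
      filter_upwards [eventually_gt_atTop 0] with n hn
      have : (0 : ℝ) < n := by exact_mod_cast hn
      exact inv_pos.2 (mul_pos this (hlam n))
    refine h4.inv_tendsto_nhdsGT_zero.congr fun n => ?_
    simp only [Pi.inv_apply, inv_inv]
  rw [tendsto_atTop] at h1 h2 ⊢
  intro x
  filter_upwards [h1 x, h2 x, tendsto_natCast_atTop_atTop.eventually_ge_atTop x] with n a1 a2 a3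
  rw [mul_min_of_nonneg _ _ n.cast_nonneg, mul_min_of_nonneg _ _ n.cast_nonneg, mul_one]
  exact le_min a3 (le_min a1 a2)

section Events
variable {Ω : Type*} [MeasurableSpace Ω] {Pr : Measure Ω}

lemma measure_not_forall_le {ι : Type*} [Fintype ι] {p : ι → Ω → Prop} {c : ℝ}
    (h : ∀ g, Pr {ω | ¬ p g ω} ≤ ENNReal.ofReal c) :
    Pr {ω | ¬ ∀ g, p g ω} ≤ ENNReal.ofReal (Fintype.card ι * c) := by
  have h1 : {ω | ¬ ∀ g, p g ω} ⊆ ⋃ g ∈ (Finset.univ : Finset ι), {ω | ¬ p g ω} := fun ω hω => by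
    obtain ⟨g, hg⟩ := not_forall.1 hω
    exact Set.mem_biUnion (Finset.mem_univ g) hg
  refine (measure_mono h1).trans ((measure_biUnion_finset_le _ _).trans
    ((Finset.sum_le_sum fun g _ => h g).trans (le_of_eq ?_)))
  rw [Finset.sum_const, nsmul_eq_mul, ← ENNReal.ofReal_natCast,
    ← ENNReal.ofReal_mul (Nat.cast_nonneg _)]
  rfl

lemma tendsto_measure_not_and {p q : ℕ → Ω → Prop}
    (hp : Tendsto (fun n => Pr {ω | ¬ p n ω}) atTop (𝓝 0))
    (hq : Tendsto (fun n => Pr {ω | ¬ q n ω}) atTop (𝓝 0)) :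
    Tendsto (fun n => Pr {ω | ¬ (p n ω ∧ q n ω)}) atTop (𝓝 0) := by
  have h := hp.add hq
  rw [add_zero] at h
  refine tendsto_of_tendsto_of_tendsto_of_le_of_le tendsto_const_nhds h (fun n => zero_le)
    fun n => (measure_mono fun ω hω => ?_).trans (measure_union_le _ _)
  exact not_and_or.1 hω

lemma tendsto_measure_not_of_imp {p q : ℕ → Ω → Prop}
    (hp : Tendsto (fun n => Pr {ω | ¬ p n ω}) atTop (𝓝 0))
    (h : ∀ᶠ n in atTop, ∀ᵐ ω ∂Pr, p n ω → q n ω) :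
    Tendsto (fun n => Pr {ω | ¬ q n ω}) atTop (𝓝 0) := by
  refine tendsto_of_tendsto_of_tendsto_of_le_of_le' tendsto_const_nhds hp
    (Eventually.of_forall fun n => zero_le) ?_
  filter_upwards [h] with n hn
  refine measure_mono_ae ?_
  filter_upwards [hn] with ω hω
  exact mt hω

variable [IsProbabilityMeasure Pr] {G : ℕ → ℕ} {cG B r : ℝ} {z₀ : ∀ n, Fin (G n) → Param d}
  {f : ∀ n, Fin (G n) → Ω → PublicInfo n d} {e : ∀ n, Fin (G n) → Ω → Fin n → ℝ}

/-- With probability tending to one, the sampling errors of all groups are small. -/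
lemma tendsto_measure_noise (hGn : Tendsto (fun n : ℕ => (G n : ℝ) / (n : ℝ)) atTop (𝓝 cG))
    (hB : 1 ≤ B) (hr0 : 0 ≤ r) (hr : r < 1) (hs : ∀ n g, IsGroupSample Pr B (f n g) (e n g))
    (hz : ∀ n g, |(z₀ n g).2 0| ≤ 4 * r) {τ : ℝ} (hτ : 0 < τ) :
    Tendsto (fun n => Pr {ω | ¬ ∀ g, noise (sampleData (z₀ n g) (f n g ω) (e n g ω)) (z₀ n g) ≤ τ})
      atTop (𝓝 0) := by
  obtain ⟨K, hK, c, hc, H⟩ := exists_noise_tail Pr d hB hr0 hr hτ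
  refine tendsto_of_tendsto_of_tendsto_of_le_of_le' tendsto_const_nhds
    (tendsto_groups_mul_exp (K := K) hGn hc 0) (Eventually.of_forall fun n => zero_le) ?_
  filter_upwards [eventually_gt_atTop 0] with n hn
  have h := measure_not_forall_le (Pr := Pr) fun g =>
    H n (z₀ n g) (f n g) (e n g) hn (hs n g) (hz n g)
  rw [Fintype.card_fin] at h
  rwa [pow_zero, mul_one]

/-- With probability tending to one, the linearization of the choice probabilities is accurate
uniformly over groups and parameters. -/
lemma tendsto_measure_noiseRem (hGn : Tendsto (fun n : ℕ => (G n : ℝ) / (n : ℝ)) atTop (𝓝 cG))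
    (hB : 1 ≤ B) (hr0 : 0 ≤ r) (hr : r < 1) (hs : ∀ n g, IsGroupSample Pr B (f n g) (e n g))
    (hz : ∀ n g, |(z₀ n g).2 0| ≤ 4 * r) {q R : ℝ} (hq : 0 < q) {Z : Set (Param d)}
    (hZ : ∀ z ∈ Z, |z.2 0| ≤ 4 * r ∧ ‖z‖ ≤ R) :
    ∃ L > 0, Tendsto (fun n : ℕ => Pr {ω | ¬ ∀ g, ∀ z ∈ Z,
      |noiseRem (sampleData (z₀ n g) (f n g ω) (e n g ω)) (z₀ n g) z|
        ≤ q * ‖z - z₀ n g‖ ^ 2 + L / n}) atTop (𝓝 0) := by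
  obtain ⟨L, hL, K, hK, c, hc, H⟩ := exists_noiseRem_tail Pr hB hr0 hr hq hZ
  refine ⟨L, hL, tendsto_of_tendsto_of_tendsto_of_le_of_le' tendsto_const_nhds
    (tendsto_groups_mul_exp (K := K) hGn hc (d + 2)) (Eventually.of_forall fun n => zero_le) ?_⟩
  filter_upwards [eventually_gt_atTop 0] with n hn
  have h := measure_not_forall_le (Pr := Pr) fun g =>
    H n (z₀ n g) (f n g) (e n g) hn (hs n g) (hz n g)
  rwa [Fintype.card_fin] at h

/-- The mean squared sampling error is of smaller order than any `x n` with `n * x n → ∞`. -/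
lemma tendsto_measure_mean_noise_sq (hG : ∀ n, 0 < G n)
    (hB : 1 ≤ B) (hr0 : 0 ≤ r) (hr : r < 1) (hs : ∀ n g, IsGroupSample Pr B (f n g) (e n g))
    (hz : ∀ n g, |(z₀ n g).2 0| ≤ 4 * r) {x : ℕ → ℝ}
    (hx : Tendsto (fun n : ℕ => (n : ℝ) * x n) atTop atTop) :
    Tendsto (fun n => Pr {ω | ¬ mean Finset.univ (fun g =>
      noise (sampleData (z₀ n g) (f n g ω) (e n g ω)) (z₀ n g) ^ 2) ≤ x n}) atTop (𝓝 0) := by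
  obtain ⟨K, hK, H⟩ := exists_noise_sq_bound Pr d hB hr0 hr
  have hlim : Tendsto (fun n : ℕ => ENNReal.ofReal (K / (n * x n))) atTop (𝓝 0) := by
    rw [← ENNReal.ofReal_zero]
    exact ENNReal.tendsto_ofReal (hx.const_div_atTop K)
  refine tendsto_of_tendsto_of_tendsto_of_le_of_le' tendsto_const_nhds hlim
    (Eventually.of_forall fun n => zero_le) ?_
  filter_upwards [eventually_gt_atTop 0, hx.eventually_gt_atTop 0] with n hn hxn
  have hn' : (0 : ℝ) < n := by exact_mod_cast hn
  have hx0 : 0 < x n := pos_of_mul_pos_right hxn hn'.le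
  have hG' : (0 : ℝ) < G n := by exact_mod_cast hG n
  choose T hT1 hT2 hT3 using fun g => H n (z₀ n g) (f n g) (e n g) (hs n g) (hz n g)
  have hT0 : ∀ g ω, 0 ≤ T g ω := fun g ω => (sq_nonneg _).trans (hT2 g ω)
  have hsum : Measurable fun ω => ∑ g, ENNReal.ofReal (T g ω) :=
    Finset.measurable_sum _ fun g _ => (hT1 g).ennreal_ofReal
  have hsub : {ω | ¬ mean Finset.univ (fun g =>
      noise (sampleData (z₀ n g) (f n g ω) (e n g ω)) (z₀ n g) ^ 2) ≤ x n}
      ⊆ {ω | ENNReal.ofReal (G n * x n) ≤ ∑ g, ENNReal.ofReal (T g ω)} := by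
    intro ω hω
    have h1 : x n < mean Finset.univ fun g => T g ω :=
      (not_le.1 hω).trans_le (mean_mono fun g _ => hT2 g ω)
    change ENNReal.ofReal (G n * x n) ≤ ∑ g, ENNReal.ofReal (T g ω)
    rw [← ENNReal.ofReal_sum_of_nonneg fun g _ => hT0 g ω]
    refine ENNReal.ofReal_le_ofReal ?_
    unfold mean at h1
    rw [Finset.card_univ, Fintype.card_fin, one_div, lt_inv_mul_iff₀ hG'] at h1
    exact h1.le
  have hpos : 0 < G n * x n := mul_pos hG' hx0
  have hint : ∫⁻ ω, ∑ g, ENNReal.ofReal (T g ω) ∂Pr ≤ ENNReal.ofReal (G n * (K / n)) := by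
    rw [lintegral_finsetSum _ fun g _ => (hT1 g).ennreal_ofReal]
    refine (Finset.sum_le_sum fun g _ => hT3 g).trans (le_of_eq ?_)
    rw [Finset.sum_const, nsmul_eq_mul, ← ENNReal.ofReal_natCast,
      ← ENNReal.ofReal_mul (Nat.cast_nonneg _), Finset.card_univ, Fintype.card_fin]
  refine (measure_mono hsub).trans ((meas_ge_le_lintegral_div hsum.aemeasurable
    (ENNReal.ofReal_pos.2 hpos).ne' ENNReal.ofReal_ne_top).trans
      ((ENNReal.div_le_div_right hint _).trans (le_of_eq ?_)))
  rw [← ENNReal.ofReal_div_of_pos hpos]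
  congr 1
  field_simp

end Events

/-! ### The parameter space -/

lemma exists_peer_bound {Θ : Set (Slope d)} (hΘ : IsCompact Θ) (hpeer : ∀ θ ∈ Θ, |θ 0| < 4) :
    ∃ r, 0 ≤ r ∧ r < 1 ∧ ∀ θ ∈ Θ, |θ 0| ≤ 4 * r := by
  rcases Θ.eq_empty_or_nonempty with rfl | hne
  · exact ⟨0, le_rfl, one_pos, fun θ hθ => absurd hθ (Set.notMem_empty θ)⟩
  have hcont : Continuous fun θ : Slope d => |θ 0| :=
    continuous_abs.comp (EuclideanSpace.proj (𝕜 := ℝ) (0 : Fin (d + 1))).continuous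
  obtain ⟨θ, hθ, hmax⟩ := hΘ.exists_isMaxOn hne hcont.continuousOn
  refine ⟨|θ 0| / 4, by positivity, by linarith [hpeer θ hθ], fun θ' hθ' => ?_⟩
  have : |θ' 0| ≤ |θ 0| := hmax hθ'
  linarith

lemma exists_norm_bound {A : Set ℝ} {Θ : Set (Slope d)} (hA : IsCompact A) (hΘ : IsCompact Θ) :
    ∃ R, 0 ≤ R ∧ ∀ z : Param d, z.1 ∈ A → z.2 ∈ Θ → ‖z‖ ≤ R := by
  obtain ⟨R, hR⟩ := (hA.prod hΘ).isBounded.exists_norm_le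
  exact ⟨max R 0, le_max_right _ _, fun z h1 h2 => (hR z ⟨h1, h2⟩).trans (le_max_left _ _)⟩

lemma exists_interior_radius {Θ : Set (Slope d)} {K₀ : ℕ} {v₀ : Fin K₀ → Slope d}
    (hv : ∀ k, v₀ k ∈ interior Θ) : ∃ s > 0, ∀ k, Metric.closedBall (v₀ k) s ⊆ Θ := by
  obtain ⟨s, hs, hsub⟩ := (Set.finite_range v₀).isCompact.exists_cthickening_subset_open
    isOpen_interior (Set.range_subset_iff.2 hv)
  exact ⟨s, hs, fun k => (Metric.closedBall_subset_cthickening (Set.mem_range_self k) s).trans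
    (hsub.trans interior_subset)⟩

end Limits

end PeerEffects

theorem mainTheorem3
    {Ω : Type*} [MeasurableSpace Ω] (Pr : Measure Ω) [IsProbabilityMeasure Pr]
    (d : ℕ)
    -- number of groups, as a function of the group size
    (G : ℕ → ℕ) (hG : ∀ n, 0 < G n)
    (cG : ℝ) (hGn : Tendsto (fun n : ℕ => (G n : ℝ) / (n : ℝ)) atTop (𝓝 cG))
    -- compact parameter spaces; peer effects are moderate
    (A : Set ℝ) (hA : IsCompact A) (Θ : Set (Slope d)) (hΘ : IsCompact Θ)
    (hpeer : ∀ θ ∈ Θ, |θ 0| < 4)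
    -- latent clusters, none of which vanishes, with distinct true slopes
    (K₀ : ℕ) (k₀ : ∀ n, Fin (G n) → Fin K₀)
    (cK : Fin K₀ → ℝ) (hcK : ∀ k, 0 < cK k)
    (hprop : ∀ k, Tendsto (fun n : ℕ => ((cluster (k₀ n) k).card : ℝ) / (G n : ℝ)) atTop
      (𝓝 (cK k)))
    (v₀ : Fin K₀ → Slope d) (hv₀ : Function.Injective v₀)
    -- true fixed effects; the true parameters are (uniformly) interior
    (μ₀ : ∀ n, Fin (G n) → ℝ)
    (hμ₀ : ∃ r > 0, ∀ n g, Metric.closedBall (μ₀ n g) r ⊆ A)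
    (hv₀_int : ∀ k, v₀ k ∈ interior Θ)
    -- public information: bounded covariates, friendships without self links and with bounded
    -- influence
    (X : ∀ n, Ω → Fin (G n) → Fin n → Fin d → ℝ) (hX : ∀ n, Measurable (X n))
    (F : ∀ n, Ω → Fin (G n) → Fin n → Fin n → Bool) (hF : ∀ n, Measurable (F n))
    (C : ℝ) (hXC : ∀ n, ∀ᵐ ω ∂Pr, ∀ g i, ‖X n ω g i‖ ≤ C)
    (hself : ∀ n, ∀ᵐ ω ∂Pr, ∀ g i, F n ω g i i = false)
    (hFC : ∀ n, ∀ᵐ ω ∂Pr, ∀ g j,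
      ∑ i, (numFriends (F n ω g) i : ℝ)⁻¹ * (if F n ω g i j = true then 1 else 0) ≤ C)
    -- private information: i.i.d. standard logistic, independent of the public information
    (ε : ∀ n, Ω → Fin (G n) → Fin n → ℝ) (hε : ∀ n, Measurable (ε n))
    (hε_law : ∀ n g i t, Pr {ω | ε n ω g i ≤ t} = ENNReal.ofReal (Real.sigmoid t))
    (hε_indep : ∀ n, iIndepFun (fun (q : Fin (G n) × Fin n) ω => ε n ω q.1 q.2) Pr)
    (hε_pub : ∀ n, IndepFun (fun ω => (X n ω, F n ω)) (ε n) Pr)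
    -- observed data
    (D : ∀ n, Ω → Fin (G n) → GroupData n d)
    (hD : ∀ n ω g, D n ω g =
      gameData (X n ω g) (F n ω g) (ε n ω g) (μ₀ n g) (v₀ (k₀ n g)))
    -- the group NPL Jacobians are invertible, with bounded inverses, with probability tending to 1
    (hinv : ∃ η > 0, Tendsto (fun n => Pr {ω | ¬ ∀ (g : Fin (G n)) (u : ℝ × Slope d),
      η * ‖u‖ ≤ ‖nplJacobian (D n ω g) (μ₀ n g, v₀ (k₀ n g)) u‖}) atTop (𝓝 0))
    -- so are the concentrated Jacobians of the true clusters
    (hconc : ∃ η > 0, Tendsto (fun n => Pr {ω | ¬ ∀ (k : Fin K₀) (u : Slope d),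
      ∃ w : Slope d, ‖w‖ ≤ 1 ∧
        η * ‖u‖ ≤ concentratedJacobian (D n ω) (cluster (k₀ n) k) (μ₀ n) (v₀ k) u w})
      atTop (𝓝 0))
    -- tuning parameters
    (Kmax : ℕ) (hKmax : K₀ ≤ Kmax)
    (ρ : ℕ → ℝ) (hρ : ∀ n, 0 < ρ n)
    (hρn : Tendsto (fun n : ℕ => (n : ℝ) * ρ n / Real.log n) atTop atTop)
    (lam : ℕ → ℝ) (hlam : ∀ n, 0 < lam n)
    (hlamn : Tendsto (fun n : ℕ => lam n + ((n : ℝ) * lam n)⁻¹) atTop (𝓝 0))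
    -- the selected number of clusters
    (Khat : ℕ → Ω → ℕ)
    (hKhat : ∀ᶠ n in atTop, ∀ᵐ ω ∂Pr, IsSelected A Θ (ρ n) (lam n) (D n ω) Kmax (Khat n ω)) :
    Tendsto (fun n => Pr {ω | Khat n ω = K₀}) atTop (𝓝 1) ∧
      Tendsto (fun n => Pr {ω | Khat n ω ≠ K₀}) atTop (𝓝 0) := by
  obtain ⟨η₁, hη₁, hinv⟩ := hinv
  obtain ⟨η₂, hη₂, hconc⟩ := hconc
  obtain ⟨s₁, hs₁, hμ₀⟩ := hμ₀
  obtain ⟨s₂, hs₂, hball⟩ := exists_interior_radius hv₀_int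
  obtain ⟨r, hr0, hr, hrΘ⟩ := exists_peer_bound hΘ hpeer
  obtain ⟨R, hR0, hR⟩ := exists_norm_bound hA hΘ
  set B := max 1 C with hBdef
  have hB : 1 ≤ B := le_max_left _ _
  set η := min η₁ η₂ with hηdef
  have hη : 0 < η := lt_min hη₁ hη₂
  obtain ⟨c₀, hc₀, hsig⟩ := exists_sigmoidDeriv_lower (indexBound d B * R)
  obtain ⟨c₁, hc₁, hdesign⟩ := exists_design_lower d hB hr0 hr hη
  let b : Bounds d := ⟨B, r, R, min s₁ s₂, c₀, c₁, hB, hr0, hr, hR0, lt_min hs₁ hs₂, hc₀, hc₁, hsig⟩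
  -- a lower bound for the proportions of the clusters
  obtain ⟨cm, hcm, hcmK⟩ : ∃ cm > 0, ∀ k, cm < cK k := by
    rcases isEmpty_or_nonempty (Fin K₀) with h | h
    · exact ⟨1, one_pos, fun k => (h.false k).elim⟩
    · obtain ⟨k, hk⟩ := Finite.exists_min cK
      exact ⟨cK k / 2, half_pos (hcK k), fun l => by linarith [hk l, hcK k]⟩
  obtain ⟨τ, hτ, hselect⟩ := exists_selection b hη hv₀ hcm
  obtain rfl : D = fun n ω g => gameData (X n ω g) (F n ω g) (ε n ω g) (μ₀ n g) (v₀ (k₀ n g)) :=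
    funext fun n => funext fun ω => funext fun g => hD n ω g
  -- the true parameters and the sampling model
  let z₀ : ∀ n, Fin (G n) → Param d := fun n g => (μ₀ n g, v₀ (k₀ n g))
  let f : ∀ n, Fin (G n) → Ω → PublicInfo n d := fun n g ω => (X n ω g, F n ω g)
  let e : ∀ n, Fin (G n) → Ω → Fin n → ℝ := fun n g ω => ε n ω g
  have hint : ∀ n g, ∀ z : Param d, ‖z - z₀ n g‖ ≤ b.s → z.1 ∈ A ∧ z.2 ∈ Θ := by
    intro n g z hz
    refine ⟨hμ₀ n g ?_, hball (k₀ n g) ?_⟩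
    · rw [mem_closedBall_iff_norm]
      exact (norm_fst_le (z - z₀ n g)).trans (hz.trans (min_le_left _ _))
    · rw [mem_closedBall_iff_norm]
      exact (norm_snd_le (z - z₀ n g)).trans (hz.trans (min_le_right _ _))
  have hadm : ∀ z : Param d, z.1 ∈ A → z.2 ∈ Θ → b.Admissible z := fun z h1 h2 =>
    ⟨hrΘ _ h2, hR z h1 h2⟩
  have hballAdm : ∀ n g, ∀ z : Param d, ‖z - z₀ n g‖ ≤ b.s → b.Admissible z := fun n g z hz =>
    hadm z (hint n g z hz).1 (hint n g z hz).2
  have hz₀ : ∀ n g, |(z₀ n g).2 0| ≤ 4 * r := fun n g =>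
    (hballAdm n g (z₀ n g) (by simpa using b.s_pos.le)).peer
  have hregular : ∀ n, ∀ᵐ ω ∂Pr, ∀ g, IsRegular B (f n g ω).1 (f n g ω).2 := by
    intro n
    filter_upwards [hXC n, hFC n] with ω h1 h2 g
    exact ⟨hB, fun i j => (abs_le_norm (X n ω g i) j).trans ((h1 g i).trans (le_max_right _ _)),
      fun j => (h2 g j).trans (le_max_right _ _)⟩
  have hsample : ∀ n g, IsGroupSample Pr B (f n g) (e n g) := fun n g =>
    { measurable_pub := (measurable_pi_iff.1 (hX n) g).prodMk (measurable_pi_iff.1 (hF n) g)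
      measurable_priv := measurable_pi_iff.1 (hε n) g
      indep := (hε_pub n).comp (φ := fun p => (p.1 g, p.2 g)) (ψ := fun x => x g)
        (((measurable_pi_apply g).comp measurable_fst).prodMk
          ((measurable_pi_apply g).comp measurable_snd)) (measurable_pi_apply g)
      law := fun i t => hε_law n g i t
      iIndep := (hε_indep n).precomp (g := fun i : Fin n => (g, i))
        fun i j h => (Prod.mk.inj h).2
      regular := (hregular n).mono fun ω h => h g }
  -- the rate that the squared sampling errors have to beat
  set x : ℕ → ℝ := fun n => min 1 (min (ρ n) (lam n)) with hx
  have hxn := tendsto_mul_min_atTop hρn hρ hlam hlamn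
  have hlam0 : Tendsto lam atTop (𝓝 0) :=
    squeeze_zero (fun n => (hlam n).le) (fun n => le_add_of_nonneg_right
      (inv_nonneg.2 (mul_nonneg n.cast_nonneg (hlam n).le))) hlamn
  have E1 := tendsto_measure_noise hGn hB hr0 hr hsample hz₀ (lt_min hτ (half_pos hη))
  obtain ⟨L, hL, E2⟩ := tendsto_measure_noiseRem hGn hB hr0 hr hsample hz₀
    (q := b.lowerConst / 4) (R := R) (div_pos b.lowerConst_pos four_pos)
    (Z := {z | z.1 ∈ A ∧ z.2 ∈ Θ}) fun z hz => ⟨hrΘ _ hz.2, hR z hz.1 hz.2⟩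
  have E3 := tendsto_measure_mean_noise_sq (z₀ := z₀) hG hB hr0 hr hsample hz₀
    (x := fun n => τ / 2 * x n) (by
      have := hxn.const_mul_atTop (half_pos hτ)
      exact this.congr fun n => by ring)
  have hbad : Tendsto (fun n => Pr {ω | Khat n ω ≠ K₀}) atTop (𝓝 0) := by
    have hall := tendsto_measure_not_and (tendsto_measure_not_and (tendsto_measure_not_and
      (tendsto_measure_not_and E1 E2) E3) hinv) hconc
    refine tendsto_measure_not_of_imp (q := fun n ω => Khat n ω = K₀) hall ?_
    have hprop' : ∀ᶠ n in atTop, ∀ k, cm * G n ≤ (cluster (k₀ n) k).card := by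
      rw [eventually_all]
      intro k
      filter_upwards [(hprop k).eventually_const_lt (hcmK k)] with n hn
      have hG' : (0 : ℝ) < G n := by exact_mod_cast hG n
      exact ((lt_div_iff₀ hG').1 hn).le
    filter_upwards [hKhat, hprop', eventually_gt_atTop 0, hlam0.eventually_le_const hτ,
      (tendsto_const_div_atTop_nhds_zero_nat L).eventually_le_const hτ,
      hxn.eventually_ge_atTop (2 * L / τ)] with n hsel hpropn hn hlamτ hLτ hLx
    have hn' : (0 : ℝ) < n := by exact_mod_cast hn
    filter_upwards [hregular n, hsel] with ω h6 h7
    rintro ⟨⟨⟨⟨h1, h2⟩, h3⟩, h4⟩, h5⟩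
    have hdata : ∀ g, IsRegularData B (sampleData (z₀ n g) (f n g ω) (e n g ω)) := fun g =>
      isRegularData_sampleData (h6 g) _ _
    have hjac : ∀ g u, η * ‖u‖
        ≤ ‖scoreDeriv (sampleData (z₀ n g) (f n g ω) (e n g ω)) (z₀ n g) u‖ := by
      intro g u
      rw [← nplJacobian_eq (hdata g) hr0 hr b.s_pos fun z hz => (hballAdm n g z hz).peer]
      exact (mul_le_mul_of_nonneg_right (min_le_left _ _) (norm_nonneg u)).trans (h4 g u)
    have hgood : ∀ g, b.Good (sampleData (z₀ n g) (f n g ω) (e n g ω)) (z₀ n g) := fun g =>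
      { n_pos := hn
        data := hdata g
        ball := hballAdm n g
        design := by
          refine hdesign n _ _ (hdata g) (hz₀ n g) ?_ (hjac g)
          have h8 := (h1 g).trans (min_le_right _ _)
          unfold noise at h8
          linarith [norm_nonneg (nplScore (sampleData (z₀ n g) (f n g ω) (e n g ω)) (z₀ n g))] }
    have hx1 : x n ≤ 1 := min_le_left _ _
    have hxρ : x n ≤ ρ n := (min_le_right _ _).trans (min_le_left _ _)
    have hxl : x n ≤ lam n := (min_le_right _ _).trans (min_le_right _ _)
    have hLx' : L / n ≤ τ / 2 * x n := by
      rw [div_le_iff₀ hn']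
      rw [div_le_iff₀ hτ] at hLx
      change 2 * L ≤ n * x n * τ at hLx
      linarith
    have hpos : 0 < K₀ := (k₀ n ⟨0, hG n⟩).pos
    refine hselect n (G n) A Θ _ (k₀ n) (μ₀ n) (ρ n) (lam n) (L / n) (x n) Kmax (Khat n ω) (hG n)
      (hρ n) (hlam n) hA hpeer hgood (hint n)
      (fun g z hzA hzΘ => ⟨hadm z hzA hzΘ, h2 g z ⟨hzA, hzΘ⟩⟩) hjac (fun k u => ?_) hpropn
      (fun g => (h1 g).trans (min_le_left _ _)) (div_nonneg hL.le hn'.le) hLτ hlamτ hx1 hxρ hxl ?_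
      (Finset.mem_Icc.2 ⟨hpos, hKmax⟩) h7
    · obtain ⟨w, hw, hle⟩ := h5 k u
      exact ⟨w, hw, (mul_le_mul_of_nonneg_right (min_le_right _ _) (norm_nonneg u)).trans hle⟩
    · have h8 : mean Finset.univ (fun g =>
          noise (sampleData (z₀ n g) (f n g ω) (e n g ω)) (z₀ n g) ^ 2) + L / n ≤ τ * x n := by
        linarith
      exact h8
  refine ⟨?_, hbad⟩
  have hlow : Tendsto (fun n => 1 - Pr {ω | Khat n ω ≠ K₀}) atTop (𝓝 1) := by
    have := ENNReal.Tendsto.sub (tendsto_const_nhds (x := (1 : ENNReal))) hbad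
      (Or.inl ENNReal.one_ne_top)
    rwa [tsub_zero] at this
  refine tendsto_of_tendsto_of_tendsto_of_le_of_le hlow tendsto_const_nhds (fun n => ?_)
    fun n => prob_le_one
  rw [tsub_le_iff_right, ← measure_univ (μ := Pr)]
  refine (measure_mono fun ω _ => ?_).trans (measure_union_le _ _)
  exact em (Khat n ω = K₀)
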